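/- Let $\mathbb F$ be an algebraically closed field of characteristic $0$, $n\ge 1$, and $\mathcal R=\mathbb F[x_1,\dots,x_n]$ with its degree grading $\mathcal R=\bigoplus_{i\ge 0}\mathcal R_i$. Let $W(n)=\mathrm{Der}_{\mathbb F}(\mathcal R)=\{\sum_i f_i\partial_i\}$, graded so that $f\partial_j$ has degree $i$ when $f\in\mathcal R_{i+1}$; let $S(n)\subseteq W(n)$ be the subalgebra of divergence-free fields ($\sum_i\partial_i f_i=0$) and, for $n=2r$, let $H(n)\subseteq W(n)$ be the subalgebra of fields annihilating the $2$-form $\sum_{i=1}^r dx_i\wedge dx_{i+r}$. Let $\mathfrak g$ be one of $W(n)$, $S(n)$, $H(n)$ ($n$ even in the last case), with the induced grading $\mathfrak g=\bigoplus_{i\ge -1}\mathfrak g_i$, so that $\mathfrak g_0\cong\mathfrak{gl}(n),\mathfrak{sl}(n),\mathfrak{sp}(n)$ respectively. Let $\mathfrak h\subset\mathfrak g_0$ be the standard (diagonal) Cartan subalgebra and $\mathfrak n^+\subset \mathfrak g_0$ the standard positive part: for $W(n)$ and $S(n)$ it is spanned by the $x_i\partial_j$ with $i<j$, and for $H(2r)$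 by the $x_i\partial_j-x_{j+r}\partial_{i+r}$ with $1\le i<j\le r$ and the $x_s\partial_{t+r}+x_t\partial_{s+r}$ with $1\le s\le t\le r$. Let $\Lambda^+\subset\mathfrak h^*$ be the set of dominant integral weights, i.e. those $\lambda$ with $\lambda(\alpha^\vee)\in\mathbb Z_{\ge 0}$ for every positive coroot $\alpha^\vee$ (for $\mathfrak{gl}(n)$ there is no condition on the centre). A *Lie–Cartan module* is a vector space $M$ with a $\mathfrak g$-module structure $\rho$, an $\mathcal R$-module structure $\theta$ and a grading $M=\bigoplus_{i\in\mathbb Z}M_i$ such that: every $M_i$ is finite-dimensional and $\mathfrak g_iM_j\subseteq M_{i+j}$; $M$ is locally finite over $\mathfrak g_{-1}\oplus\mathfrak g_0$; $M$ is the direct sum of its $\mathfrak h$-weight spaces; $[\rho(X),\theta(f)]=\theta(X(f))$ for all $X\in\mathfrak g$, $f\in\mathcal R$; and $\theta(\mathcal R_i)M_j\subseteq M_{i+j}$. Morphisms are the linear maps commuting with $\rho$ and $\theta$ and preserving the gradings. $M$ is *irreducible* if $M\neq 0$ and its only graded subspaces stable under $\rho$ and $\theta$ are $0$ and $M$. For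 $\lambda\in\Lambda^+$ and $d\in\mathbb Z$, let $L^0(\lambda)$ be the simple $\mathfrak g_0$-module of highest weight $\lambda$, with representation $\xi$, and let ${}^d\mathcal V(\lambda)=\mathcal R\otimes_{\mathbb F}L^0(\lambda)$ with $\mathcal R_i\otimes L^0(\lambda)$ placed in degree $i+d$, $\mathcal R$ acting by multiplication on the left factor, and $X=\sum_i f_i\partial_i\in\mathfrak g$ acting by $$X\cdot(g\otimes v)=X(g)\otimes v+\sum_{i,j}\partial_j(f_i)\,g\otimes\xi(x_j\partial_i)v,$$ where the second term is understood through $\sum_{i,j}\partial_j(f_i)\otimes x_j\partial_i\in\mathcal R\otimes\mathfrak g_0$. Then: 1. for all $\lambda\in\Lambda^+$ and $d\in\mathbb Z$, ${}^d\mathcal V(\lambda)$ is an irreducible Lie–Cartan module; 2. if ${}^d\mathcal V(\lambda)\cong{}^e\mathcal V(\mu)$ as Lie–Cartan modules, with $\lambda,\mu\in\Lambda^+$ and $d,e\in\mathbb Z$, then $\lambda=\mu$ and $d=e$; 3. every irreducible Lie–Cartan module is isomorphic to ${}^d\mathcal V(\lambda)$ for some $\lambda\in\Lambda^+$ and $d\in\mathbb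 Z$. -/

import Mathlib

open scoped TensorProduct

universe u v w

noncomputable section

namespace LieCartan

/-! ### The Lie algebras of vector fields `W(n)`, `S(n)`, `H(n)` -/

/-- The polynomial algebra `R = F[x_1, …, x_n]`. -/
abbrev Poly (F : Type u) [Field F] (n : ℕ) : Type u := MvPolynomial (Fin n) F

/-- `W(n)`: the Lie algebra of all derivations of `R`. -/
abbrev Vect (F : Type u) [Field F] (n : ℕ) : Type u := Derivation F (Poly F n) (Poly F n)

/-- The three types of Lie algebras of vector fields: general, special, Hamiltonian. -/
inductive VFType
  | W
  | S
  | H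

section Algebras

variable {F : Type u} [Field F] {n : ℕ}

/-- The partial derivation `∂_i`. -/
def pd (i : Fin n) : Vect F n := MvPolynomial.pderiv i

/-- The linear vector field `x_i ∂_j`. -/
def xd (i j : Fin n) : Vect F n := (MvPolynomial.X i : Poly F n) • pd j

theorem vect_sum_apply {ι : Type*} (s : Finset ι) (D : ι → Vect F n) (p : Poly F n) :
    (∑ j ∈ s, D j) p = ∑ j ∈ s, D j p := by
  classical
  induction s using Finset.induction_on with
  | empty => simp
  | insert a s ha ih => rw [Finset.sum_insert ha, Finset.sum_insert ha, Derivation.add_apply, ih]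

theorem pd_X (i j : Fin n) :
    (pd i : Vect F n) (MvPolynomial.X j) = if i = j then 1 else 0 := by
  simp [pd, MvPolynomial.pderiv_X, Pi.single_apply, eq_comm]

/-- Every vector field is `∑ f_j ∂_j` with `f_j = D x_j`. -/
theorem vect_eq_sum (D : Vect F n) : D = ∑ j, D (MvPolynomial.X j) • (pd j : Vect F n) := by
  apply MvPolynomial.derivation_ext
  intro i
  simp [vect_sum_apply, pd_X]

theorem vect_apply (D : Vect F n) (p : Poly F n) :
    D p = ∑ j, D (MvPolynomial.X j) * pd j p := by
  conv_lhs => rw [vect_eq_sum D]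
  simp [vect_sum_apply]

theorem vect_add_lie (a b c : Vect F n) : ⁅a + b, c⁆ = ⁅a, c⁆ + ⁅b, c⁆ := add_lie a b c

theorem vect_lie_lie (a b c : Vect F n) : ⁅⁅a, b⁆, c⁆ = ⁅a, ⁅b, c⁆⁆ - ⁅b, ⁅a, c⁆⁆ := lie_lie a b c

theorem xd_apply (i j : Fin n) (p : Poly F n) :
    (xd i j : Vect F n) p = MvPolynomial.X i * pd j p := by
  simp [xd]

/-- The divergence `∑ f_i ∂_i ↦ ∑ ∂_i f_i`. -/
def divergence (D : Vect F n) : Poly F n := ∑ i, pd i (D (MvPolynomial.X i))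

theorem pd_vect (i : Fin n) (D : Vect F n) (p : Poly F n) :
    pd i (D p) = D (pd i p) + ∑ j, pd i (D (MvPolynomial.X j)) * pd j p := by
  have h : ⁅(pd i : Vect F n), D⁆ p = ∑ j, ⁅(pd i : Vect F n), D⁆ (MvPolynomial.X j) * pd j p :=
    vect_apply _ _
  simp only [Derivation.commutator_apply, pd_X] at h
  have h0 : ∀ j, D (if i = j then 1 else 0) = 0 := by
    intro j; split_ifs <;> simp
  simp only [h0, sub_zero] at h
  rw [← h]; ring

theorem divergence_lie (D E : Vect F n) :
    divergence ⁅D, E⁆ = D (divergence E) - E (divergence D) := by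
  simp only [divergence, Derivation.commutator_apply, map_sub, map_sum]
  rw [Finset.sum_congr rfl fun i _ => congrArg₂ (· - ·) (pd_vect i D (E (MvPolynomial.X i)))
    (pd_vect i E (D (MvPolynomial.X i)))]
  simp only [Finset.sum_sub_distrib, Finset.sum_add_distrib]
  have : ∑ x, ∑ j, pd x (D (MvPolynomial.X j)) * pd j (E (MvPolynomial.X x)) =
      ∑ x, ∑ j, pd x (E (MvPolynomial.X j)) * pd j (D (MvPolynomial.X x)) := by
    rw [Finset.sum_comm]
    exact Finset.sum_congr rfl fun _ _ => Finset.sum_congr rfl fun _ _ => mul_comm _ _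
  rw [this]; ring

/-- The value `ω(D, E)` of the 2-form `ω = ∑_{i ≤ r} dx_i ∧ dx_{i+r}` on two vector fields, where
`n = 2r` (the condition on `i, j` forces `i` into the first half of the indices). -/
def omega (D E : Vect F n) : Poly F n :=
  ∑ i : Fin n, ∑ j : Fin n, if (j : ℕ) = (i : ℕ) + n / 2 then
    D (MvPolynomial.X i) * E (MvPolynomial.X j) - D (MvPolynomial.X j) * E (MvPolynomial.X i)
  else 0

theorem omega_add_left (D D' E : Vect F n) : omega (D + D') E = omega D E + omega D' E := by
  simp only [omega, ← Finset.sum_add_distrib]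
  refine Finset.sum_congr rfl fun i _ => Finset.sum_congr rfl fun j _ => ?_
  split_ifs
  · simp only [Derivation.add_apply]; ring
  · simp

theorem omega_smul_left (p : Poly F n) (D E : Vect F n) : omega (p • D) E = p * omega D E := by
  simp only [omega, Finset.mul_sum]
  refine Finset.sum_congr rfl fun i _ => Finset.sum_congr rfl fun j _ => ?_
  split_ifs
  · simp only [Derivation.smul_apply, smul_eq_mul]; ring
  · simp

theorem omega_swap (D E : Vect F n) : omega D E = -omega E D := by
  simp only [omega, ← Finset.sum_neg_distrib]
  refine Finset.sum_congr rfl fun i _ => Finset.sum_congr rfl fun j _ => ?_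
  split_ifs
  · ring
  · simp

theorem omega_add_right (D E E' : Vect F n) : omega D (E + E') = omega D E + omega D E' := by
  rw [omega_swap, omega_add_left, omega_swap E, omega_swap E']; ring

theorem omega_smul_right (p : Poly F n) (D E : Vect F n) : omega D (p • E) = p * omega D E := by
  rw [omega_swap, omega_smul_left, omega_swap E]; ring

theorem omega_sub_left (D D' E : Vect F n) : omega (D - D') E = omega D E - omega D' E := by
  have := omega_add_left (D - D') D' E
  rw [sub_add_cancel] at this; rw [this]; ring

theorem omega_sub_right (D E E' : Vect F n) : omega D (E - E') = omega D E - omega D E' := by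
  rw [omega_swap, omega_sub_left, omega_swap E, omega_swap E']; ring

/-- The Lie derivative of `ω` along `X`:
`(L_X ω)(D, E) = X(ω(D, E)) - ω([X, D], E) - ω(D, [X, E])`. -/
def lieDerivOmega (X D E : Vect F n) : Poly F n :=
  X (omega D E) - omega ⁅X, D⁆ E - omega D ⁅X, E⁆

/-- The Lie algebra `X(n)` as a subalgebra of `W(n)`: `W(n)` itself, the divergence-free fields
`S(n)`, or (for even `n`) the fields `H(n)` annihilating the 2-form `ω`. -/
def vf (F : Type u) [Field F] (T : VFType) (n : ℕ) : LieSubalgebra F (Vect F n) :=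
  match T with
  | .W => ⊤
  | .S =>
    { carrier := {X | divergence X = 0}
      zero_mem' := by simp [divergence]
      add_mem' := by
        intro a b ha hb
        have ha' : divergence a = 0 := ha
        have hb' : divergence b = 0 := hb
        simp only [divergence] at ha' hb'
        simp [divergence, Finset.sum_add_distrib, ha', hb']
      smul_mem' := by
        intro c a ha
        have ha' : divergence a = 0 := ha
        simp only [divergence] at ha'
        simp [divergence, ← Finset.smul_sum, ha']
      lie_mem' := by
        intro a b ha hb
        have ha' : divergence a = 0 := ha
        have hb' : divergence b = 0 := hb
        show divergence ⁅a, b⁆ = 0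
        rw [divergence_lie, ha', hb']; simp }
  | .H =>
    { carrier := {X | ∀ D E, lieDerivOmega X D E = 0}
      zero_mem' := by
        intro D E
        simp [lieDerivOmega, omega, Derivation.commutator_apply]
      add_mem' := by
        intro a b ha hb D E
        have ha' := ha D E
        have hb' := hb D E
        simp only [lieDerivOmega, Derivation.add_apply, vect_add_lie, omega_add_left,
          omega_add_right] at *
        linear_combination ha' + hb'
      smul_mem' := by
        intro c a ha D E
        have ha' := ha D E
        have h1 : ∀ G : Vect F n, ⁅c • a, G⁆ = (MvPolynomial.C c : Poly F n) • ⁅a, G⁆ := by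
          intro G
          exact (smul_lie c a G).trans (by ext p : 1; simp [MvPolynomial.smul_eq_C_mul])
        simp only [lieDerivOmega, Derivation.smul_apply, h1, omega_smul_left,
          omega_smul_right, MvPolynomial.smul_eq_C_mul] at *
        linear_combination (MvPolynomial.C c) * ha'
      lie_mem' := by
        intro a b ha hb D E
        have e1 := ha D E
        have e2 := hb D E
        have e3 := ha ⁅b, D⁆ E
        have e4 := ha D ⁅b, E⁆
        have e5 := hb ⁅a, D⁆ E
        have e6 := hb D ⁅a, E⁆
        have f1 := congrArg b e1
        have f2 := congrArg a e2
        simp only [lieDerivOmega, map_sub, map_zero, Derivation.commutator_apply, vect_lie_lie,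
          omega_sub_left, omega_sub_right] at *
        linear_combination f2 - f1 - e5 - e6 + e3 + e4 }

/-- The homogeneous part of `W(n)` of degree `m - 1`: the fields `∑ f_i ∂_i` with all `f_i`
homogeneous of degree `m`. -/
def vectPart (F : Type u) [Field F] (n m : ℕ) : Submodule F (Vect F n) where
  carrier := {X | ∀ i, (X (MvPolynomial.X i)).IsHomogeneous m}
  zero_mem' := fun i => by simpa using MvPolynomial.isHomogeneous_zero (Fin n) F m
  add_mem' := fun {a b} ha hb i => by simpa using (ha i).add (hb i)
  smul_mem' := fun c a ha i => by
    simpa [MvPolynomial.smul_eq_C_mul] using (ha i).C_mul c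

theorem isHomogeneous_vect {D : Vect F n} (hD : D ∈ vectPart F n 1) {p : Poly F n} 
    (hp : p.IsHomogeneous 1) : (D p).IsHomogeneous 1 := by
  rw [vect_apply]
  refine MvPolynomial.IsHomogeneous.sum _ _ _ fun j _ => ?_
  have := (hD j).mul (hp.pderiv (i := j))
  simpa [pd] using this

/-- The degree zero part `g_0` of `g = X(n)`. -/
def vf0 (F : Type u) [Field F] (T : VFType) (n : ℕ) : LieSubalgebra F (Vect F n) where
  carrier := {X | X ∈ vf F T n ∧ X ∈ vectPart F n 1}
  zero_mem' := ⟨zero_mem _, zero_mem _⟩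
  add_mem' := fun ha hb => ⟨add_mem ha.1 hb.1, add_mem ha.2 hb.2⟩
  smul_mem' := fun c _ ha => ⟨Submodule.smul_mem _ c ha.1, Submodule.smul_mem _ c ha.2⟩
  lie_mem' := fun {a b} ha hb => ⟨LieSubalgebra.lie_mem _ ha.1 hb.1, fun i => by
    rw [Derivation.commutator_apply]
    exact (isHomogeneous_vect ha.2 (hb.2 i)).sub (isHomogeneous_vect hb.2 (ha.2 i))⟩

/-- The inclusion `g_0 → g`. -/
def toVf {T : VFType} (x : vf0 F T n) : vf F T n := ⟨x, x.2.1⟩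

/-- The inclusion `g_0 → W(n)` as a linear map. -/
def incl0 (F : Type u) [Field F] (T : VFType) (n : ℕ) : vf0 F T n →ₗ[F] Vect F n where
  toFun x := x
  map_add' _ _ := rfl
  map_smul' _ _ := rfl

/-! ### The `R ⊗ g_0`-valued Jacobian of a vector field -/

/-- The linear vector field `∑_{i,j} c_{ij} x_j ∂_i`, where `c_{ij}` is the coefficient of `x^α` in
`∂_j f_i`, for `X = ∑ f_i ∂_i`. -/
def linPart (α : Fin n →₀ ℕ) (X : Vect F n) : Vect F n :=
  ∑ i, ∑ j, MvPolynomial.coeff α (pd j (X (MvPolynomial.X i))) • (xd j i : Vect F n)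

theorem linPart_X (α : Fin n →₀ ℕ) (X : Vect F n) (k : Fin n) :
    linPart α X (MvPolynomial.X k) = ∑ j,
      MvPolynomial.C (MvPolynomial.coeff α (pd j (X (MvPolynomial.X k)))) * MvPolynomial.X j := by
  simp [linPart, vect_sum_apply, xd_apply, pd_X, MvPolynomial.smul_eq_C_mul]

theorem pd_linPart_X (α : Fin n →₀ ℕ) (X : Vect F n) (a k : Fin n) :
    pd a (linPart α X (MvPolynomial.X k)) =
      MvPolynomial.C (MvPolynomial.coeff α (pd a (X (MvPolynomial.X k)))) := by
  rw [linPart_X, map_sum]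
  rw [Finset.sum_congr rfl fun j _ => (pd a : Vect F n).leibniz _ _]
  simp only [pd_X, smul_eq_mul, MvPolynomial.derivation_C, mul_zero, add_zero, mul_ite, mul_one]
  simp

theorem lieDerivOmega_swap (X D E : Vect F n) : lieDerivOmega X D E = -lieDerivOmega X E D := by
  simp only [lieDerivOmega]
  rw [omega_swap D E, omega_swap ⁅X, D⁆, omega_swap D, map_neg]; ring

theorem lieDerivOmega_smul_left (p : Poly F n) (X D E : Vect F n) :
    lieDerivOmega X (p • D) E = p * lieDerivOmega X D E := by
  have h : ⁅X, p • D⁆ = X p • D + p • ⁅X, D⁆ := by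
    ext i : 1
    simp [Derivation.commutator_apply]; ring
  simp only [lieDerivOmega, h, omega_smul_left, omega_add_left, Derivation.leibniz, smul_eq_mul]
  ring

theorem lieDerivOmega_sum_left {ι : Type*} (s : Finset ι) (X E : Vect F n) (D : ι → Vect F n) :
    lieDerivOmega X (∑ j ∈ s, D j) E = ∑ j ∈ s, lieDerivOmega X (D j) E := by
  classical
  induction s using Finset.induction_on with
  | empty =>
    have := lieDerivOmega_smul_left 0 X 0 E
    simpa using this
  | insert a s ha ih =>
    rw [Finset.sum_insert ha, Finset.sum_insert ha, ← ih]
    have h : ∀ a b : Vect F n, ⁅X, a + b⁆ = ⁅X, a⁆ + ⁅X, b⁆ := fun a b => lie_add X a b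
    simp only [lieDerivOmega, h, omega_add_left, map_add]
    ring

/-- The Lie derivative of `ω` is determined by its values on the coordinate fields. -/
theorem lieDerivOmega_eq_zero (X : Vect F n)
    (h : ∀ a b, lieDerivOmega X (pd a) (pd b) = 0) (D E : Vect F n) : lieDerivOmega X D E = 0 := by
  have h1 : ∀ b (D : Vect F n), lieDerivOmega X D (pd b) = 0 := by
    intro b D
    rw [vect_eq_sum D, lieDerivOmega_sum_left]
    exact Finset.sum_eq_zero fun j _ => by rw [lieDerivOmega_smul_left, h, mul_zero]
  rw [lieDerivOmega_swap, vect_eq_sum E, lieDerivOmega_sum_left, neg_eq_zero]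
  exact Finset.sum_eq_zero fun j _ => by
    rw [lieDerivOmega_smul_left, lieDerivOmega_swap, h1, neg_zero, mul_zero]

theorem lieDerivOmega_pd (X : Vect F n) (a b : Fin n) :
    lieDerivOmega X (pd a) (pd b) = ∑ i : Fin n, ∑ j : Fin n, if (j : ℕ) = (i : ℕ) + n / 2 then
      (if b = j then pd a (X (MvPolynomial.X i)) else 0)
      - (if b = i then pd a (X (MvPolynomial.X j)) else 0)
      + (if a = i then pd b (X (MvPolynomial.X j)) else 0)
      - (if a = j then pd b (X (MvPolynomial.X i)) else 0) else 0 := by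
  simp only [lieDerivOmega, omega, map_sum, ← Finset.sum_sub_distrib]
  refine Finset.sum_congr rfl fun i _ => Finset.sum_congr rfl fun j _ => ?_
  have h0 : ∀ a j : Fin n, X (if a = j then 1 else 0) = 0 := by
    intro a j; split_ifs <;> simp
  split_ifs with h
  all_goals
    simp_all [Derivation.commutator_apply, pd_X]

theorem linPart_mem (T : VFType) (α : Fin n →₀ ℕ) {X : Vect F n} (hX : X ∈ vf F T n) :
    linPart α X ∈ vf0 F T n := by
  refine ⟨?_, fun k => ?_⟩
  · match T, hX with
    | .W, _ => exact LieSubalgebra.mem_top _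
    | .S, hX =>
      have hX' : divergence X = 0 := hX
      show divergence (linPart α X) = 0
      simp only [divergence, pd_linPart_X] at hX' ⊢
      rw [← map_sum, ← MvPolynomial.coeff_sum, hX']; simp
    | .H, hX =>
      refine lieDerivOmega_eq_zero _ fun a b => ?_
      have h := congrArg (fun p : Poly F n => (MvPolynomial.C (MvPolynomial.coeff α p) : Poly F n)) (hX (pd a) (pd b))
      simp only [MvPolynomial.coeff_zero, map_zero] at h
      rw [← h, lieDerivOmega_pd, lieDerivOmega_pd]
      simp only [MvPolynomial.coeff_sum, map_sum]
      refine Finset.sum_congr rfl fun i _ => Finset.sum_congr rfl fun j _ => ?_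
      simp only [pd_linPart_X]
      split_ifs <;> simp
  · rw [linPart_X]
    exact MvPolynomial.IsHomogeneous.sum _ _ _ fun j _ => MvPolynomial.isHomogeneous_C_mul_X _ _

/-- The element `∑_{i,j} ∂_j(f_i) ⊗ x_j ∂_i` of `R ⊗ W(n)` attached to `∑ f_i ∂_i`. -/
def jacobianW (X : Vect F n) : Poly F n ⊗[F] Vect F n :=
  ∑ i, ∑ j, pd j (X (MvPolynomial.X i)) ⊗ₜ[F] (xd j i : Vect F n)

/-- For `X = ∑ f_i ∂_i` in `g`, the element `∑_{i,j} ∂_j(f_i) ⊗ x_j ∂_i`, regarded as an element of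
`R ⊗ g_0` by collecting the coefficients of each monomial; see `jacobian_spec`. -/
def jacobian (T : VFType) (X : vf F T n) : Poly F n ⊗[F] vf0 F T n :=
  ∑ α ∈ Finset.univ.biUnion fun i => Finset.univ.biUnion fun j =>
      (pd j ((X : Vect F n) (MvPolynomial.X i))).support,
    MvPolynomial.monomial α (1 : F) ⊗ₜ[F] (⟨linPart α X, linPart_mem T α X.2⟩ : vf0 F T n)

theorem jacobian_spec (T : VFType) (X : vf F T n) :
    (incl0 F T n).lTensor (Poly F n) (jacobian T X) = jacobianW (X : Vect F n) := by
  simp only [jacobian, jacobianW, map_sum, LinearMap.lTensor_tmul]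
  have : ∀ α, (MvPolynomial.monomial α (1 : F)) ⊗ₜ[F] incl0 F T n
      (⟨linPart α X, linPart_mem T α X.2⟩ : vf0 F T n) = ∑ i, ∑ j,
        (MvPolynomial.monomial α (MvPolynomial.coeff α (pd j ((X : Vect F n) (MvPolynomial.X i)))))
          ⊗ₜ[F] (xd j i : Vect F n) := by
    intro α
    show _ ⊗ₜ[F] linPart α (X : Vect F n) = _
    simp only [linPart, TensorProduct.tmul_sum, TensorProduct.tmul_smul]
    simp only [TensorProduct.smul_tmul', MvPolynomial.smul_monomial, smul_eq_mul, mul_one]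
  rw [Finset.sum_congr rfl fun α _ => this α, Finset.sum_comm]
  refine Finset.sum_congr rfl fun i _ => ?_
  rw [Finset.sum_comm]
  refine Finset.sum_congr rfl fun j _ => ?_
  rw [← TensorProduct.sum_tmul]
  congr 1
  conv_rhs => rw [MvPolynomial.as_sum (pd j ((X : Vect F n) (MvPolynomial.X i)))]
  symm
  refine Finset.sum_subset (fun α hα => ?_) fun α _ hα => ?_
  · simp only [Finset.mem_biUnion, Finset.mem_univ, true_and]
    exact ⟨i, j, hα⟩
  · rw [MvPolynomial.notMem_support_iff.mp hα, map_zero]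

theorem jacobian_injective (F : Type u) [Field F] (n : ℕ) (T : VFType) :
    Function.Injective ((incl0 F T n).lTensor (Poly F n)) :=
  Module.Flat.lTensor_preserves_injective_linearMap _ Subtype.val_injective

theorem xd_lie (i j k l : Fin n) : ⁅(xd j i : Vect F n), (xd l k : Vect F n)⁆ =
    (if i = l then (xd j k : Vect F n) else 0) - if k = j then (xd l i : Vect F n) else 0 := by
  apply MvPolynomial.derivation_ext
  intro m
  rw [Derivation.commutator_apply]
  simp only [xd_apply, pd_X, Derivation.sub_apply]
  split_ifs <;> simp_all [xd_apply, pd_X]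

theorem tensor_sum_lie_sum (f g : Fin n → Poly F n ⊗[F] Vect F n) :
    ⁅∑ i, f i, ∑ k, g k⁆ = ∑ i, ∑ k, ⁅f i, g k⁆ :=
  sum_lie_sum Finset.univ Finset.univ f g

theorem jacobianW_lie (X Y : Vect F n) : jacobianW ⁅X, Y⁆ =
    (X : Poly F n →ₗ[F] Poly F n).rTensor _ (jacobianW Y)
      - (Y : Poly F n →ₗ[F] Poly F n).rTensor _ (jacobianW X) + ⁅jacobianW X, jacobianW Y⁆ := by
  have hb : ⁅jacobianW X, jacobianW Y⁆ =
      (∑ i, ∑ j, (∑ k, pd j (X (MvPolynomial.X k)) * pd k (Y (MvPolynomial.X i))) ⊗ₜ[F]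
        (xd j i : Vect F n))
      - ∑ i, ∑ j, (∑ k, pd j (Y (MvPolynomial.X k)) * pd k (X (MvPolynomial.X i))) ⊗ₜ[F]
        (xd j i : Vect F n) := by
    have e : ∀ (i j k l : Fin n),
        ⁅pd j (X (MvPolynomial.X i)) ⊗ₜ[F] (xd j i : Vect F n),
          pd l (Y (MvPolynomial.X k)) ⊗ₜ[F] (xd l k : Vect F n)⁆ =
        (if i = l then (pd j (X (MvPolynomial.X i)) * pd l (Y (MvPolynomial.X k))) ⊗ₜ[F]
          (xd j k : Vect F n) else 0) -
        if k = j then (pd l (Y (MvPolynomial.X k)) * pd j (X (MvPolynomial.X i))) ⊗ₜ[F]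
          (xd l i : Vect F n) else 0 := by
      intro i j k l
      rw [LieAlgebra.ExtendScalars.bracket_tmul]
      have := xd_lie (F := F) i j k l
      refine (congrArg (fun t => _ ⊗ₜ[F] t) this).trans ?_
      rw [TensorProduct.tmul_sub]
      congr 1
      · split_ifs <;> simp
      · split_ifs
        · rw [mul_comm]
        · simp
    rw [jacobianW, jacobianW]
    rw [tensor_sum_lie_sum]
    rw [Finset.sum_congr rfl fun i _ => Finset.sum_congr rfl fun k _ => tensor_sum_lie_sum _ _]
    simp only [e, Finset.sum_sub_distrib, TensorProduct.sum_tmul]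
    refine congrArg₂ (· - ·) ?_ ?_
    · simp only [Finset.sum_ite_eq, Finset.mem_univ, if_true]
      rw [Finset.sum_comm]
      refine Finset.sum_congr rfl fun i _ => ?_
      rw [Finset.sum_comm]
    · have h2 : ∀ i k : Fin n, (∑ j, ∑ l, if k = j then
          (pd l (Y (MvPolynomial.X k)) * pd j (X (MvPolynomial.X i))) ⊗ₜ[F] (xd l i : Vect F n)
          else 0) = ∑ l,
          (pd l (Y (MvPolynomial.X k)) * pd k (X (MvPolynomial.X i))) ⊗ₜ[F] (xd l i : Vect F n) := by
        intro i k
        rw [Finset.sum_comm]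
        simp
      simp only [h2]
      refine Finset.sum_congr rfl fun i _ => ?_
      rw [Finset.sum_comm]
  rw [hb]
  simp only [jacobianW, map_sum, LinearMap.rTensor_tmul, ← Finset.sum_sub_distrib,
    ← Finset.sum_add_distrib]
  refine Finset.sum_congr rfl fun i _ => Finset.sum_congr rfl fun j _ => ?_
  rw [Derivation.commutator_apply, map_sub, pd_vect j X (Y _), pd_vect j Y (X _)]
  simp only [TensorProduct.add_tmul, TensorProduct.sub_tmul, Derivation.coeFn_coe]
  abel

theorem lTensor_lie (T : VFType) (s t : Poly F n ⊗[F] vf0 F T n) :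
    (incl0 F T n).lTensor (Poly F n) ⁅s, t⁆ =
      ⁅(incl0 F T n).lTensor (Poly F n) s,
        (incl0 F T n).lTensor (Poly F n) t⁆ := by
  have hadd : ∀ a b c : Poly F n ⊗[F] vf0 F T n, ⁅a + b, c⁆ = ⁅a, c⁆ + ⁅b, c⁆ :=
    fun a b c => add_lie a b c
  have hadd' : ∀ a b c : Poly F n ⊗[F] vf0 F T n, ⁅a, b + c⁆ = ⁅a, b⁆ + ⁅a, c⁆ :=
    fun a b c => lie_add a b c
  have gadd : ∀ a b c : Poly F n ⊗[F] Vect F n, ⁅a + b, c⁆ = ⁅a, c⁆ + ⁅b, c⁆ :=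
    fun a b c => add_lie a b c
  have gadd' : ∀ a b c : Poly F n ⊗[F] Vect F n, ⁅a, b + c⁆ = ⁅a, b⁆ + ⁅a, c⁆ :=
    fun a b c => lie_add a b c
  have hz : ∀ c : Poly F n ⊗[F] vf0 F T n, ⁅(0 : Poly F n ⊗[F] vf0 F T n), c⁆ = 0 :=
    fun c => zero_lie c
  have hz' : ∀ c : Poly F n ⊗[F] vf0 F T n, ⁅c, (0 : Poly F n ⊗[F] vf0 F T n)⁆ = 0 :=
    fun c => lie_zero c
  have gz : ∀ c : Poly F n ⊗[F] Vect F n, ⁅(0 : Poly F n ⊗[F] Vect F n), c⁆ = 0 :=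
    fun c => zero_lie (L := Poly F n ⊗[F] Vect F n) c
  have gz' : ∀ c : Poly F n ⊗[F] Vect F n, ⁅c, (0 : Poly F n ⊗[F] Vect F n)⁆ = 0 :=
    fun c => lie_zero c
  induction s using TensorProduct.induction_on with
  | zero => rw [hz, map_zero, gz]
  | add a b ha hb => rw [hadd, map_add, map_add, gadd, ha, hb]
  | tmul p x =>
    induction t using TensorProduct.induction_on with
    | zero => rw [hz', map_zero, gz']
    | add a b ha hb => rw [hadd', map_add, map_add, gadd', ha, hb]
    | tmul q y => rfl

theorem lTensor_rTensor (T : VFType) (D : Poly F n →ₗ[F] Poly F n)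
    (t : Poly F n ⊗[F] vf0 F T n) :
    (incl0 F T n).lTensor (Poly F n) (D.rTensor _ t) =
      D.rTensor _ ((incl0 F T n).lTensor (Poly F n) t) := by
  rw [← LinearMap.comp_apply, ← LinearMap.comp_apply, LinearMap.lTensor_comp_rTensor,
    LinearMap.rTensor_comp_lTensor]

theorem jacobian_lie (T : VFType) (X Y : vf F T n) : jacobian T ⁅X, Y⁆ =
    ((X : Vect F n) : Poly F n →ₗ[F] Poly F n).rTensor _ (jacobian T Y)
      - ((Y : Vect F n) : Poly F n →ₗ[F] Poly F n).rTensor _ (jacobian T X)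
      + ⁅jacobian T X, jacobian T Y⁆ := by
  apply jacobian_injective F n T
  rw [map_add, map_sub, lTensor_lie, lTensor_rTensor, lTensor_rTensor, jacobian_spec,
    jacobian_spec, jacobian_spec]
  exact jacobianW_lie _ _

theorem jacobian_add (T : VFType) (X Y : vf F T n) :
    jacobian T (X + Y) = jacobian T X + jacobian T Y := by
  apply jacobian_injective F n T
  rw [map_add, jacobian_spec, jacobian_spec, jacobian_spec]
  simp [jacobianW, TensorProduct.add_tmul, Finset.sum_add_distrib]

theorem jacobian_smul (T : VFType) (c : F) (X : vf F T n) :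
    jacobian T (c • X) = c • jacobian T X := by
  apply jacobian_injective F n T
  rw [map_smul, jacobian_spec, jacobian_spec]
  simp [jacobianW, TensorProduct.smul_tmul', Finset.smul_sum]

end Algebras

/-! ### Prolongation of a representation of `g_0` -/

section Prolongation

attribute [local instance] LieRing.ofAssociativeRing

variable {F : Type u} [Field F] {n : ℕ} {T : VFType} {L : Type v} [AddCommGroup L] [Module F L]

/-- The action of `R ⊗ g_0` on `R ⊗ L` given by `(f ⊗ x)(g ⊗ v) = f g ⊗ ξ(x) v`. -/
def tensorAct (ξ : vf0 F T n →ₗ⁅F⁆ Module.End F L) :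
    Poly F n ⊗[F] vf0 F T n →ₗ[F] Module.End F (Poly F n ⊗[F] L) :=
  TensorProduct.lift <| LinearMap.compl₁₂ (TensorProduct.mapBilinear (RingHom.id F) _ _ _ _)
    (LinearMap.mul F (Poly F n)) (ξ : vf0 F T n →ₗ[F] Module.End F L)

@[simp] theorem tensorAct_tmul (ξ : vf0 F T n →ₗ⁅F⁆ Module.End F L) (f g : Poly F n)
    (x : vf0 F T n) (y : L) : tensorAct ξ (f ⊗ₜ x) (g ⊗ₜ y) = (f * g) ⊗ₜ ξ x y := rfl

theorem tensorAct_lie (ξ : vf0 F T n →ₗ⁅F⁆ Module.End F L) (s t : Poly F n ⊗[F] vf0 F T n) :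
    tensorAct ξ ⁅s, t⁆ = tensorAct ξ s * tensorAct ξ t - tensorAct ξ t * tensorAct ξ s := by
  have hadd : ∀ a b c : Poly F n ⊗[F] vf0 F T n, ⁅a + b, c⁆ = ⁅a, c⁆ + ⁅b, c⁆ :=
    fun a b c => add_lie a b c
  have hadd' : ∀ a b c : Poly F n ⊗[F] vf0 F T n, ⁅a, b + c⁆ = ⁅a, b⁆ + ⁅a, c⁆ :=
    fun a b c => lie_add a b c
  have hz : ∀ c : Poly F n ⊗[F] vf0 F T n, ⁅(0 : Poly F n ⊗[F] vf0 F T n), c⁆ = 0 :=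
    fun c => zero_lie c
  have hz' : ∀ c : Poly F n ⊗[F] vf0 F T n, ⁅c, (0 : Poly F n ⊗[F] vf0 F T n)⁆ = 0 :=
    fun c => lie_zero c
  induction s using TensorProduct.induction_on with
  | zero => rw [hz, map_zero, zero_mul, mul_zero]; exact LinearMap.ext fun _ => (sub_self (0 : Poly F n ⊗[F] L)).symm
  | add a b ha hb => rw [hadd, map_add, map_add, ha, hb]; noncomm_ring
  | tmul p x =>
    induction t using TensorProduct.induction_on with
    | zero => rw [hz', map_zero, zero_mul, mul_zero]; exact LinearMap.ext fun _ => (sub_self (0 : Poly F n ⊗[F] L)).symm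
    | add a b ha hb => rw [hadd', map_add, map_add, ha, hb]; noncomm_ring
    | tmul q y =>
      rw [LieAlgebra.ExtendScalars.bracket_tmul]
      ext g l
      simp [Ring.lie_def, TensorProduct.tmul_sub, mul_left_comm, mul_assoc]

theorem rTensor_tensorAct (ξ : vf0 F T n →ₗ⁅F⁆ Module.End F L) (D : Vect F n)
    (t : Poly F n ⊗[F] vf0 F T n) :
    (D : Poly F n →ₗ[F] Poly F n).rTensor L * tensorAct ξ t
      - tensorAct ξ t * (D : Poly F n →ₗ[F] Poly F n).rTensor L =
    tensorAct ξ ((D : Poly F n →ₗ[F] Poly F n).rTensor _ t) := by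
  induction t using TensorProduct.induction_on with
  | zero => rw [map_zero, map_zero, map_zero, zero_mul, mul_zero]; exact LinearMap.ext fun _ => sub_self (0 : Poly F n ⊗[F] L)
  | add a b ha hb => rw [map_add, map_add, map_add, ← ha, ← hb]; noncomm_ring
  | tmul p x =>
    apply TensorProduct.ext'
    intro g l
    simp [TensorProduct.add_tmul, mul_comm]

/-- The prolongation of a representation `ξ` of `g_0` on `L` to a representation of `g` on `R ⊗ L`:
`X = ∑ f_i ∂_i` acts by `X(g ⊗ v) = X(g) ⊗ v + ∑_{i,j} ∂_j(f_i) g ⊗ ξ(x_j ∂_i) v`, where the second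
sum is the action of the element `∑_{i,j} ∂_j(f_i) ⊗ x_j ∂_i` of `R ⊗ g_0`. -/
def prolong (ξ : vf0 F T n →ₗ⁅F⁆ Module.End F L) :
    vf F T n →ₗ⁅F⁆ Module.End F (Poly F n ⊗[F] L) where
  toFun X := ((X : Vect F n) : Poly F n →ₗ[F] Poly F n).rTensor L + tensorAct ξ (jacobian T X)
  map_add' X Y := by
    rw [jacobian_add, map_add]
    have : (((X + Y : vf F T n) : Vect F n) : Poly F n →ₗ[F] Poly F n) =
      ((X : Vect F n) : Poly F n →ₗ[F] Poly F n) + ((Y : Vect F n) : Poly F n →ₗ[F] Poly F n) := rfl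
    rw [this, LinearMap.rTensor_add]; abel
  map_smul' c X := by
    rw [jacobian_smul, map_smul]
    have : (((c • X : vf F T n) : Vect F n) : Poly F n →ₗ[F] Poly F n) =
      c • ((X : Vect F n) : Poly F n →ₗ[F] Poly F n) := rfl
    rw [this, LinearMap.rTensor_smul, RingHom.id_apply, smul_add]
  map_lie' {X Y} := by
    have : (((⁅X, Y⁆ : vf F T n) : Vect F n) : Poly F n →ₗ[F] Poly F n) =
      ((X : Vect F n) : Poly F n →ₗ[F] Poly F n) * ((Y : Vect F n) : Poly F n →ₗ[F] Poly F n)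
      - ((Y : Vect F n) : Poly F n →ₗ[F] Poly F n) * ((X : Vect F n) : Poly F n →ₗ[F] Poly F n) := by
      exact LinearMap.ext fun p => Derivation.commutator_apply p
    rw [jacobian_lie, map_add, map_sub, ← rTensor_tensorAct, ← rTensor_tensorAct, tensorAct_lie,
      this, LinearMap.rTensor_sub, LinearMap.rTensor_mul, LinearMap.rTensor_mul, Ring.lie_def]
    noncomm_ring

end Prolongation

/-! ### Cartan subalgebra, positive part and dominant integral weights of `g_0`

In type `H`, the index called `i + r` is written as an index `i'` with `(i' : ℕ) = i + n / 2`. -/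

section Weights

/-- The generators of the standard Cartan subalgebra. -/
def cartanGens (F : Type u) [Field F] (T : VFType) (n : ℕ) : Set (Vect F n) :=
  match T with
  | .W => {D | ∃ i, D = xd i i}
  | .S => {D | ∃ i j, i < j ∧ D = xd i i - xd j j}
  | .H => {D | ∃ i i' : Fin n, (i' : ℕ) = i + n / 2 ∧ D = xd i i - xd i' i'}

/-- The standard Cartan subalgebra `h` of `g_0`. -/
def cartan (F : Type u) [Field F] (T : VFType) (n : ℕ) : Submodule F (vf0 F T n) :=
  (Submodule.span F (cartanGens F T n)).comap (incl0 F T n)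

/-- The generators of the positive part `n⁺` (the standard root vectors). -/
def nPlusGens (F : Type u) [Field F] (T : VFType) (n : ℕ) : Set (Vect F n) :=
  match T with
  | .W => {D | ∃ i j, i < j ∧ D = xd i j}
  | .S => {D | ∃ i j, i < j ∧ D = xd i j}
  | .H => {D | ∃ i i' j j' : Fin n, (i' : ℕ) = i + n / 2 ∧ (j' : ℕ) = j + n / 2 ∧
      ((i < j ∧ D = xd i j - xd j' i') ∨ (i ≤ j ∧ D = xd i j' + xd j i'))}

/-- The positive part `n⁺` of `g_0 = n⁻ ⊕ h ⊕ n⁺`. -/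
def nPlus (F : Type u) [Field F] (T : VFType) (n : ℕ) : Submodule F (vf0 F T n) :=
  (Submodule.span F (nPlusGens F T n)).comap (incl0 F T n)

/-- The coroots of the positive roots of `g_0` with respect to `h` and `n⁺`. -/
def posCoroots (F : Type u) [Field F] (T : VFType) (n : ℕ) : Set (Vect F n) :=
  match T with
  | .W => {D | ∃ i j, i < j ∧ D = xd i i - xd j j}
  | .S => {D | ∃ i j, i < j ∧ D = xd i i - xd j j}
  | .H => {D | ∃ i i' j j' : Fin n, (i' : ℕ) = i + n / 2 ∧ (j' : ℕ) = j + n / 2 ∧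
      ((i < j ∧ D = (xd i i - xd i' i') - (xd j j - xd j' j')) ∨
       (i < j ∧ D = (xd i i - xd i' i') + (xd j j - xd j' j')) ∨
       D = xd i i - xd i' i')}

/-- `h^*`. -/
abbrev Weight (F : Type u) [Field F] (T : VFType) (n : ℕ) : Type u :=
  Module.Dual F (cartan F T n)

variable {F : Type u} [Field F] {T : VFType} {n : ℕ}

/-- `lam` is dominant integral: its value on the coroot of every positive root is a natural
number. -/
def Weight.IsDominantIntegral (lam : Weight F T n) : Prop :=
  ∀ h : cartan F T n, ((h : vf0 F T n) : Vect F n) ∈ posCoroots F T n → ∃ k : ℕ, lam h = k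

end Weights

/-! ### The simple highest weight module `L⁰(λ)` of `g_0` -/

section HighestWeight

attribute [local instance] LieRing.ofAssociativeRing

variable {F : Type u} [Field F] {T : VFType} {n : ℕ}

/-- The enveloping algebra `U(g_0)`. -/
abbrev U0 (F : Type u) [Field F] (T : VFType) (n : ℕ) : Type u :=
  UniversalEnvelopingAlgebra F (vf0 F T n)

/-- The left ideal of `U(g_0)` generated by `n⁺` and all `h - λ(h)` for `h` in the Cartan
subalgebra. -/
def vermaIdeal (lam : Weight F T n) : Submodule (U0 F T n) (U0 F T n) :=
  Submodule.span (U0 F T n)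
    ({u | ∃ x ∈ nPlus F T n, u = UniversalEnvelopingAlgebra.ι F x} ∪
     {u | ∃ h : cartan F T n, u = UniversalEnvelopingAlgebra.ι F (h : vf0 F T n)
        - algebraMap F (U0 F T n) (lam h)})

/-- The Verma module of highest weight `λ` over `g_0`. -/
abbrev Verma (lam : Weight F T n) : Type u := U0 F T n ⧸ vermaIdeal lam

/-- The sum of all proper submodules of the Verma module. -/
def vermaRadical (lam : Weight F T n) : Submodule (U0 F T n) (Verma lam) :=
  sSup {N | N ≠ ⊤}

/-- `L⁰(λ)`: the simple `g_0`-module of highest weight `λ`, as the quotient of the Verma module by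
the sum of its proper submodules. -/
abbrev LZero (lam : Weight F T n) : Type u := Verma lam ⧸ vermaRadical lam

/-- The representation of `g_0` on `L⁰(λ)`. -/
def lZeroRep (lam : Weight F T n) : vf0 F T n →ₗ⁅F⁆ Module.End F (LZero lam) :=
  ((Algebra.lsmul F F (LZero lam) : U0 F T n →ₐ[F] Module.End F (LZero lam)) :
    U0 F T n →ₗ⁅F⁆ Module.End F (LZero lam)).comp (UniversalEnvelopingAlgebra.ι F)

end HighestWeight

/-! ### Lie-Cartan modules -/

section LieCartanModules

attribute [local instance] LieRing.ofAssociativeRing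

/-- A vector space `M` with a `g`-module structure `ρ`, an `R`-module structure `θ` and a family of
subspaces `M_i`, `i ∈ ℤ`. -/
structure Triple (F : Type u) [Field F] (T : VFType) (n : ℕ) (M : Type v)
    [AddCommGroup M] [Module F M] where
  ρ : vf F T n →ₗ⁅F⁆ Module.End F M
  θ : Poly F n →ₐ[F] Module.End F M
  gr : ℤ → Submodule F M

namespace Triple

variable {F : Type u} [Field F] {T : VFType} {n : ℕ}
variable {M : Type v} [AddCommGroup M] [Module F M]
variable {N : Type w} [AddCommGroup N] [Module F N]

/-- The weight space `M_λ` for `λ ∈ h^*`. -/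
def weightSpace (D : Triple F T n M) (lam : Weight F T n) : Submodule F M where
  carrier := {m | ∀ h : cartan F T n, D.ρ (toVf (h : vf0 F T n)) m = lam h • m}
  zero_mem' := by simp
  add_mem' := fun {a b} ha hb h => by rw [map_add, ha h, hb h, smul_add]
  smul_mem' := fun c a ha h => by rw [map_smul, ha h, smul_comm]

/-- The `g`-module `M` with its grading is an object of the category `O`. -/
structure InCategoryO (D : Triple F T n M) : Prop where
  /-- `M` is the direct sum of the `M_i`. -/
  internal : DirectSum.IsInternal D.gr
  finite : ∀ i, FiniteDimensional F (D.gr i)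
  /-- `g_{m-1} M_i ⊆ M_{i+m-1}`. -/
  graded : ∀ (m : ℕ) (X : vf F T n), (X : Vect F n) ∈ vectPart F n m →
    ∀ (i : ℤ), ∀ v ∈ D.gr i, D.ρ X v ∈ D.gr (i + m - 1)
  /-- `M` is locally finite over `P = g_{-1} ⊕ g_0`. -/
  locallyFinite : ∀ v : M, ∃ V : Submodule F M, v ∈ V ∧ FiniteDimensional F V ∧
    ∀ X : vf F T n, ((X : Vect F n) ∈ vectPart F n 0 ∨ (X : Vect F n) ∈ vectPart F n 1) →
      ∀ x ∈ V, D.ρ X x ∈ V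
  /-- `M` is the sum (automatically direct) of its weight spaces. -/
  weight : ⨆ lam, D.weightSpace lam = ⊤

/-- `M` is a Lie-Cartan module. -/
structure IsLieCartan (D : Triple F T n M) : Prop extends InCategoryO D where
  /-- `[ρ(X), θ(f)] = θ(X(f))`. -/
  compat : ∀ (X : vf F T n) (f : Poly F n) (v : M),
    D.ρ X (D.θ f v) - D.θ f (D.ρ X v) = D.θ ((X : Vect F n) f) v
  /-- `θ(R_m) M_i ⊆ M_{m+i}`. -/
  graded_poly : ∀ (m : ℕ) (f : Poly F n), f.IsHomogeneous m →
    ∀ (i : ℤ), ∀ v ∈ D.gr i, D.θ f v ∈ D.gr (m + i)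

/-- `V` is a Lie-Cartan submodule: a graded subspace stable under `g` and `R`. -/
structure IsSub (D : Triple F T n M) (V : Submodule F M) : Prop where
  ρ_mem : ∀ (X : vf F T n), ∀ v ∈ V, D.ρ X v ∈ V
  θ_mem : ∀ (f : Poly F n), ∀ v ∈ V, D.θ f v ∈ V
  graded : V = ⨆ i, V ⊓ D.gr i

/-- `M` is nonzero and has no Lie-Cartan submodules other than `0` and `M`. -/
def IsIrreducible (D : Triple F T n M) : Prop :=
  Nontrivial M ∧ ∀ V : Submodule F M, D.IsSub V → V = ⊥ ∨ V = ⊤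

/-- Isomorphisms of Lie-Cartan modules: linear isomorphisms respecting the actions of `g` and `R`
and the gradings. -/
structure Iso (D : Triple F T n M) (E : Triple F T n N) where
  toEquiv : M ≃ₗ[F] N
  map_ρ : ∀ (X : vf F T n) (v : M), toEquiv (D.ρ X v) = E.ρ X (toEquiv v)
  map_θ : ∀ (f : Poly F n) (v : M), toEquiv (D.θ f v) = E.θ f (toEquiv v)
  map_gr : ∀ (i : ℤ) (v : M), toEquiv v ∈ E.gr i ↔ v ∈ D.gr i

end Triple

variable {F : Type u} [Field F] {T : VFType} {n : ℕ}

/-- `ᵈV(λ) = R ⊗ ᵈL⁰(λ)`: the prolongation of `L⁰(λ)`, with `R` acting by multiplication on the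
left factor, and with `R_m ⊗ L⁰(λ)` in degree `m + d`. -/
def prolongation (lam : Weight F T n) (d : ℤ) : Triple F T n (Poly F n ⊗[F] LZero lam) where
  ρ := prolong (lZeroRep lam)
  θ := Algebra.lsmul F F (Poly F n ⊗[F] LZero lam)
  gr k := Submodule.span F {t | ∃ (m : ℕ) (p : Poly F n) (v : LZero lam),
    p.IsHomogeneous m ∧ (m : ℤ) + d = k ∧ t = p ⊗ₜ[F] v}

end LieCartanModules

end LieCartan

end

/-! Every `∂_i` lies in all three algebras and spans, with the others, `g_{-1}`. Everything rests on
the homogeneous vectors killed by `g_{-1}`. A nonzero graded submodule contains a nonzero one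
(`exists_homogeneous_killed`): otherwise some `∂_i` could always be applied again with nonzero
result, giving nonzero vectors in infinitely many degrees of a finite-dimensional subspace.

In a prolongation `R ⊗ L⁰(λ)` the operator `∑ θ(x_i) ρ(∂_i)` is the Euler operator, which is
multiplication by `k - d` on degree `k`. It vanishes on killed vectors, so in characteristic 0 these
have degree `d` and lie in `1 ⊗ L⁰(λ)`. Simplicity of `L⁰(λ)` and multiplication by `R` then give
irreducibility. The lowest degree recovers `d`, and the `g_0`-module in that degree recovers `λ`,
because a simple representation has only one highest weight.

Conversely, let `M` be irreducible. A killed vector of degree `j` generates, under `g` and then `R`,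
a submodule in degrees at least `j`, which must be `M`. Hence killed vectors occur in exactly one
degree `d` (`gr_eq_bot_of_lt`, `killed_eq_bot_of_ne`). A simple `g_0`-submodule of the killed
vectors has a highest weight `λ`, dominant by `sl₂`-theory, and so receives a nonzero map `e` from
`L⁰(λ)`. The map `f ⊗ l ↦ θ(f) e(l)` commutes with `g`: by the compatibility of `ρ` and `θ` it
suffices to look at `1 ⊗ l`, and there one inducts on the degree of the vector field. The defect is
killed by each `∂_i`, since brackets with `∂_i` have smaller degree, and it lies in a degree other
than `d`, so it is zero (`prolongMap_prolong_one_tmul`). Schur's lemma finishes the argument.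

The representation theory of `g_0` that this needs is elementary. A grading element `ρ` of the
Cartan subalgebra replaces the order on weights, and all proper submodules of a Verma module avoid
its top `ρ`-eigenvalue. That `L⁰(λ)` is nonzero and finite-dimensional for dominant `λ` is seen from
explicit highest weight vectors, namely products of minors in the polynomial ring on `n × n`
matrices, with a trace twist for `gl(n)`. No basis theorem for the enveloping algebra is used. -/

noncomputable section

namespace LieCartan

/-! ### Highest weight theory -/

section HighestWeightTheory

attribute [local instance] LieRing.ofAssociativeRing

variable {F : Type u} [Field F] {𝔤 : Type v} [LieRing 𝔤] [LieAlgebra F 𝔤]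
  {V : Type w} [AddCommGroup V] [Module F V]

/-- A subspace stable under all operators of a representation. -/
def IsStable (ξ : 𝔤 →ₗ⁅F⁆ Module.End F V) (N : Submodule F V) : Prop :=
  ∀ x, ∀ v ∈ N, ξ x v ∈ N

theorem rep_lie_apply (ξ : 𝔤 →ₗ⁅F⁆ Module.End F V) (x y : 𝔤) (v : V) :
    ξ ⁅x, y⁆ v = ξ x (ξ y v) - ξ y (ξ x v) := by
  rw [LieHom.map_lie, Ring.lie_def]; rfl

theorem rep_rep_apply (ξ : 𝔤 →ₗ⁅F⁆ Module.End F V) (x y : 𝔤) (v : V) :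
    ξ x (ξ y v) = ξ y (ξ x v) + ξ ⁅x, y⁆ v := by
  rw [rep_lie_apply]; abel

/-- The smallest subspace that contains `B` and is closed under the operators `ξ x`, `x ∈ S`. -/
def wordSpan (ξ : 𝔤 →ₗ⁅F⁆ Module.End F V) (S : Set 𝔤) (B : Submodule F V) : Submodule F V :=
  sInf {A | B ≤ A ∧ ∀ x ∈ S, ∀ a ∈ A, ξ x a ∈ A}

theorem le_wordSpan (ξ : 𝔤 →ₗ⁅F⁆ Module.End F V) (S : Set 𝔤) (B : Submodule F V) :
    B ≤ wordSpan ξ S B := le_sInf fun _ h => h.1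

theorem apply_mem_wordSpan {ξ : 𝔤 →ₗ⁅F⁆ Module.End F V} {S : Set 𝔤} {B : Submodule F V}
    {x : 𝔤} (hx : x ∈ S) {a : V} (ha : a ∈ wordSpan ξ S B) : ξ x a ∈ wordSpan ξ S B := by
  rw [wordSpan, Submodule.mem_sInf] at ha ⊢
  exact fun A hA => hA.2 x hx a (ha A hA)

theorem wordSpan_le {ξ : 𝔤 →ₗ⁅F⁆ Module.End F V} {S : Set 𝔤} {A B : Submodule F V}
    (hB : B ≤ A) (hA : ∀ x ∈ S, ∀ a ∈ A, ξ x a ∈ A) : wordSpan ξ S B ≤ A :=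
  sInf_le ⟨hB, hA⟩

/-- If every operator of the representation maps `B` into the subspace generated from `B` by the
operators from `S`, then this subspace is stable. -/
theorem isStable_wordSpan {ξ : 𝔤 →ₗ⁅F⁆ Module.End F V} {S : Set 𝔤} {B : Submodule F V}
    (h : ∀ y, ∀ b ∈ B, ξ y b ∈ wordSpan ξ S B) : IsStable ξ (wordSpan ξ S B) := by
  -- `A'` consists of the vectors that every `ξ y` keeps in the span. It is closed under `S` because
  -- `ξ y (ξ x a) = ξ x (ξ y a) + ξ ⁅y, x⁆ a`, so minimality of the span applies.
  let A' : Submodule F V := wordSpan ξ S B ⊓ ⨅ y, (wordSpan ξ S B).comap (ξ y)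
  have : wordSpan ξ S B ≤ A' := by
    refine wordSpan_le (fun b hb => ?_) fun x hx a ha => ?_
    · simp only [A', Submodule.mem_inf, Submodule.mem_iInf, Submodule.mem_comap]
      exact ⟨le_wordSpan _ _ _ hb, fun y => h y b hb⟩
    · simp only [A', Submodule.mem_inf, Submodule.mem_iInf, Submodule.mem_comap] at ha ⊢
      refine ⟨apply_mem_wordSpan hx ha.1, fun y => ?_⟩
      rw [rep_rep_apply]
      exact add_mem (apply_mem_wordSpan hx (ha.2 y)) (ha.2 _)
  intro y a ha
  have := this ha
  simp only [A', Submodule.mem_inf, Submodule.mem_iInf, Submodule.mem_comap] at this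
  exact this.2 y

/-- The features of a triangular decomposition `g = n⁻ ⊕ h ⊕ n⁺` used here; `ρ` is an element of
`h` whose adjoint eigenvalues on `n⁺` are positive integers and on `n⁻` negative integers. -/
structure IsTriangular (h n : Submodule F 𝔤) (ρ : 𝔤) : Prop where
  mem : ρ ∈ h
  comm : ∀ x ∈ h, ∀ y ∈ h, ⁅x, y⁆ = 0
  pos : n ≤ Submodule.span F {x | ∃ k : ℕ, 0 < k ∧ ⁅ρ, x⁆ = (k : F) • x}
  span : ⊤ ≤ h ⊔ n ⊔ Submodule.span F {x | ∃ k : ℕ, 0 < k ∧ ⁅ρ, x⁆ = -(k : F) • x}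

/-- `v` is killed by `n` and is a weight vector of weight `lam` for `h`. -/
structure IsHighestWeight (ξ : 𝔤 →ₗ⁅F⁆ Module.End F V) (h n : Submodule F 𝔤)
    (lam : Module.Dual F h) (v : V) : Prop where
  pos : ∀ x ∈ n, ξ x v = 0
  cartan : ∀ x : h, ξ x v = lam x • v

/-- `v` generates the representation. -/
def IsCyclic' (ξ : 𝔤 →ₗ⁅F⁆ Module.End F V) (v : V) : Prop :=
  ∀ N : Submodule F V, IsStable ξ N → v ∈ N → N = ⊤

/-- The representation has no stable subspaces other than `0` and the whole space. -/
def IsSimpleRep (ξ : 𝔤 →ₗ⁅F⁆ Module.End F V) : Prop :=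
  ∀ N : Submodule F V, IsStable ξ N → N = ⊥ ∨ N = ⊤

theorem IsSimpleRep.isCyclic' {ξ : 𝔤 →ₗ⁅F⁆ Module.End F V} (h : IsSimpleRep ξ) {v : V}
    (hv : v ≠ 0) : IsCyclic' ξ v := fun N hN hvN =>
  (h N hN).resolve_left fun h0 => hv (by simpa [h0] using hvN)

/-- The polynomial is a product of factors `X - e i` over the eigencomponents of `y`. It serves as a
projection onto the eigenvalue `c` that also works in infinite dimension. -/
theorem exists_polynomial_of_mem_iSup_eigenspace {ι : Type*} (T : Module.End F V) (e : ι → F)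
    (c : F) (hc : ∀ i, e i ≠ c) {y : V} (hy : y ∈ ⨆ i, T.eigenspace (e i)) :
    ∃ p : Polynomial F, Polynomial.aeval T p y = 0 ∧ p.eval c ≠ 0 := by
  induction hy using Submodule.iSup_induction' with
  | mem i x hx =>
    refine ⟨Polynomial.X - Polynomial.C (e i), ?_, ?_⟩
    · rw [Module.End.mem_eigenspace_iff] at hx
      simp [hx]
    · simpa [sub_eq_zero] using (hc i).symm
  | zero => exact ⟨1, by simp, by simp⟩
  | add x y _ _ hx hy =>
    obtain ⟨p, hp, hp'⟩ := hx
    obtain ⟨q, hq, hq'⟩ := hy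
    refine ⟨p * q, ?_, by simpa using ⟨hp', hq'⟩⟩
    rw [map_add]
    conv_lhs => arg 1; rw [mul_comm]
    simp [hp, hq]

theorem aeval_apply_of_eigenvector (T : Module.End F V) {c : F} {v : V} (hv : T v = c • v)
    (p : Polynomial F) : Polynomial.aeval T p v = p.eval c • v := by
  induction p using Polynomial.induction_on' with
  | add p q hp hq => simp [hp, hq, add_smul]
  | monomial k a =>
    have : ∀ k : ℕ, (T ^ k) v = c ^ k • v := by
      intro k
      induction k with
      | zero => simp
      | succ k ih => rw [pow_succ', Module.End.mul_apply, ih, map_smul, hv, smul_smul, pow_succ]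
    simp [Polynomial.aeval_monomial, this, smul_smul, mul_comm]

theorem eq_zero_of_mem_iSup_eigenspace {ι : Type*} (T : Module.End F V) (e : ι → F)
    (c : F) (hc : ∀ i, e i ≠ c) {y : V} (hy : y ∈ ⨆ i, T.eigenspace (e i)) (hy' : T y = c • y) :
    y = 0 := by
  obtain ⟨p, hp, hp'⟩ := exists_polynomial_of_mem_iSup_eigenspace T e c hc hy
  rw [aeval_apply_of_eigenvector T hy'] at hp
  exact (smul_eq_zero.mp hp).resolve_left hp'

theorem IsStable.aeval_mem {ξ : 𝔤 →ₗ⁅F⁆ Module.End F V} {N : Submodule F V}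
    (hN : IsStable ξ N) (x : 𝔤) (p : Polynomial F) {v : V} (hv : v ∈ N) :
    Polynomial.aeval (ξ x) p v ∈ N := by
  induction p using Polynomial.induction_on' with
  | add p q hp hq => simpa using add_mem hp hq
  | monomial k a =>
    have : ∀ k : ℕ, (ξ x ^ k) v ∈ N := by
      intro k
      induction k with
      | zero => simpa
      | succ k ih => rw [pow_succ']; exact hN x _ ih
    simpa [Polynomial.aeval_monomial] using N.smul_mem a (this k)

section

variable {ξ : 𝔤 →ₗ⁅F⁆ Module.End F V} {h n : Submodule F 𝔤} {ρ : 𝔤}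
  {lam mu : Module.Dual F h} {v v' : V}

/-- The sum of the eigenspaces of `ρ` strictly below the highest eigenvalue. -/
def lowerPart (ξ : 𝔤 →ₗ⁅F⁆ Module.End F V) (ρ : 𝔤) (c : F) : Submodule F V :=
  ⨆ k : ℕ, (ξ ρ).eigenspace (c - (k + 1 : ℕ))

theorem apply_mem_eigenspace {x : 𝔤} {a c : F} (hx : ⁅ρ, x⁆ = a • x)
    (hv : v ∈ (ξ ρ).eigenspace c) : ξ x v ∈ (ξ ρ).eigenspace (c + a) := by
  rw [Module.End.mem_eigenspace_iff] at hv ⊢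
  rw [rep_rep_apply, hx, hv]
  simp [add_smul]

/-- By the triangular decomposition every operator sends `v` into the span of words in lowering
operators applied to `v`. That span is therefore stable, hence everything by cyclicity, and each
nonempty word strictly lowers the `ρ`-eigenvalue. -/
theorem IsHighestWeight.top_le (H : IsTriangular h n ρ) (hv : IsHighestWeight ξ h n lam v)
    (hc : IsCyclic' ξ v) : ⊤ ≤ (F ∙ v) ⊔ lowerPart ξ ρ (lam ⟨ρ, H.mem⟩) := by
  set S : Set 𝔤 := {x | ∃ k : ℕ, 0 < k ∧ ⁅ρ, x⁆ = -(k : F) • x}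
  have hvA : v ∈ wordSpan ξ S (F ∙ v) := le_wordSpan _ _ _ (Submodule.mem_span_singleton_self v)
  have h1 : IsStable ξ (wordSpan ξ S (F ∙ v)) := by
    refine isStable_wordSpan fun y b hb => ?_
    obtain ⟨c, rfl⟩ := Submodule.mem_span_singleton.mp hb
    rw [map_smul]
    refine Submodule.smul_mem _ _ ?_
    have : (⊤ : Submodule F 𝔤) ≤ (wordSpan ξ S (F ∙ v)).comap
        (LinearMap.applyₗ v ∘ₗ (ξ : 𝔤 →ₗ[F] Module.End F V)) := by
      refine H.span.trans (sup_le (sup_le (fun x hx => ?_) fun x hx => ?_)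
        (Submodule.span_le.mpr fun x hx => ?_))
      · simpa [hv.cartan ⟨x, hx⟩] using Submodule.smul_mem _ _ hvA
      · simp [hv.pos x hx]
      · exact apply_mem_wordSpan hx hvA
    simpa using this (Submodule.mem_top (x := y))
  rw [← hc _ h1 hvA]
  refine wordSpan_le le_sup_left ?_
  rintro x ⟨k, hk, hx⟩ a ha
  obtain ⟨b, hb, y, hy, rfl⟩ := Submodule.mem_sup.mp ha
  rw [map_add]
  refine add_mem (Submodule.mem_sup_right ?_) (Submodule.mem_sup_right ?_)
  · obtain ⟨c, rfl⟩ := Submodule.mem_span_singleton.mp hb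
    rw [map_smul]
    refine Submodule.smul_mem _ _ ?_
    obtain ⟨j, rfl⟩ : ∃ j, k = j + 1 := ⟨k - 1, by omega⟩
    refine Submodule.mem_iSup_of_mem j ?_
    rw [sub_eq_add_neg]
    exact apply_mem_eigenspace hx (Module.End.mem_eigenspace_iff.mpr (hv.cartan ⟨ρ, H.mem⟩))
  · have : lowerPart ξ ρ (lam ⟨ρ, H.mem⟩) ≤ (lowerPart ξ ρ (lam ⟨ρ, H.mem⟩)).comap (ξ x) := by
      refine iSup_le fun j z hz => ?_
      refine Submodule.mem_iSup_of_mem (j + k) ?_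
      have := apply_mem_eigenspace hx hz
      convert this using 2
      push_cast; ring
    exact this hy

/-- A representation generated by a weight vector is the sum of its weight spaces, if the Lie
algebra is spanned by weight vectors of the adjoint representation. -/
theorem iSup_weight_eq_top (hspan : (⊤ : Submodule F 𝔤) ≤ Submodule.span F
      {x | ∃ χ : Module.Dual F h, ∀ y : h, ⁅(y : 𝔤), x⁆ = χ y • x})
    (hc : IsCyclic' ξ v) (hv : ∀ x : h, ξ x v = lam x • v) :
    ⨆ mu : Module.Dual F h, ⨅ x : h, (ξ x).eigenspace (mu x) = ⊤ := by
  refine hc _ (fun x m hm => ?_) (Submodule.mem_iSup_of_mem lam ?_)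
  · have : (⊤ : Submodule F 𝔤) ≤
        (⨆ mu : Module.Dual F h, ⨅ x : h, (ξ x).eigenspace (mu x)).comap
        (LinearMap.applyₗ m ∘ₗ (ξ : 𝔤 →ₗ[F] Module.End F V)) := by
      refine hspan.trans (Submodule.span_le.mpr ?_)
      rintro x ⟨χ, hχ⟩
      have h1 : (⨆ mu : Module.Dual F h, ⨅ x : h, (ξ x).eigenspace (mu x)) ≤
          (⨆ mu : Module.Dual F h, ⨅ x : h, (ξ x).eigenspace (mu x)).comap (ξ x) := by
        refine iSup_le fun mu m hm => ?_
        refine Submodule.mem_iSup_of_mem (mu + χ) ?_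
        rw [Submodule.mem_iInf] at hm ⊢
        exact fun y => apply_mem_eigenspace (hχ y) (hm y)
      exact h1 hm
    exact this (Submodule.mem_top (x := x))
  · rw [Submodule.mem_iInf]
    exact fun x => Module.End.mem_eigenspace_iff.mpr (hv x)

/-- A commuting family of operators on a nonzero finite-dimensional space over an algebraically
closed field has a common eigenvector. -/
theorem exists_common_eigenvector [IsAlgClosed F] {ι : Type*} (T : ι → Module.End F V)
    (E : Submodule F V) (hE : E ≠ ⊥) [FiniteDimensional F E] (hT : ∀ i, ∀ v ∈ E, T i v ∈ E)
    (hcomm : ∀ i j, ∀ v ∈ E, T i (T j v) = T j (T i v)) :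
    ∃ v ∈ E, v ≠ 0 ∧ ∀ i, ∃ c : F, T i v = c • v := by
  induction hd : Module.finrank F E using Nat.strong_induction_on generalizing E with
  | _ d ih =>
    obtain ⟨v, hv, hv0⟩ := Submodule.exists_mem_ne_zero_of_ne_bot hE
    by_cases hall : ∀ i, ∃ c : F, ∀ v ∈ E, T i v = c • v
    · exact ⟨v, hv, hv0, fun i => (hall i).imp fun c hc => hc v hv⟩
    -- An operator that is not scalar on `E` has a proper eigenspace there. The other operators
    -- preserve it because they commute with this one, so the induction on dimension continues.
    push Not at hall
    obtain ⟨i, hi⟩ := hall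
    have : Nontrivial E := Submodule.nontrivial_iff_ne_bot.mpr hE
    obtain ⟨c, hc⟩ := Module.End.exists_eigenvalue ((T i).restrict (hT i))
    obtain ⟨⟨x, hxE⟩, hx⟩ := hc.exists_hasEigenvector
    have hx1 : T i x = c • x := congrArg Subtype.val hx.apply_eq_smul
    have hx0 : x ≠ 0 := fun h => hx.2 (Subtype.ext h)
    let E' : Submodule F V := E ⊓ (T i).eigenspace c
    have hlt : E' < E := by
      refine lt_of_le_of_ne inf_le_left fun heq => ?_
      obtain ⟨y, hy, hy'⟩ := hi c
      rw [← heq] at hy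
      exact hy' (Module.End.mem_eigenspace_iff.mp hy.2)
    have : FiniteDimensional F E' := Submodule.finiteDimensional_of_le hlt.le
    obtain ⟨y, hy, hy'⟩ := ih (Module.finrank F E') (hd ▸ Submodule.finrank_lt_finrank_of_lt hlt) E'
      (fun hb => hx0 (by
        have : x ∈ E' := ⟨hxE, Module.End.mem_eigenspace_iff.mpr hx1⟩
        simpa [hb] using this))
      (fun j z hz => ⟨hT j z hz.1, by
        rw [SetLike.mem_coe, Module.End.mem_eigenspace_iff, hcomm i j z hz.1,
          Module.End.mem_eigenspace_iff.mp hz.2, map_smul]⟩)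
      (fun j k z hz => hcomm j k z hz.1) rfl
    exact ⟨y, hlt.le hy, hy'⟩

variable [CharZero F]

/-- Write an element of `N` as `c • v + y` with `y` in the lower part. A polynomial in `ρ` that
kills `y` but not `v` puts a nonzero multiple of `c • v` into `N`, so `c ≠ 0` would make `N`
everything. -/
theorem IsHighestWeight.le_lowerPart (H : IsTriangular h n ρ) (hv : IsHighestWeight ξ h n lam v)
    (hc : IsCyclic' ξ v) {N : Submodule F V} (hN : IsStable ξ N) (hN' : N ≠ ⊤) :
    N ≤ lowerPart ξ ρ (lam ⟨ρ, H.mem⟩) := by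
  intro x hx
  obtain ⟨b, hb, y, hy, rfl⟩ := Submodule.mem_sup.mp (hv.top_le H hc (Submodule.mem_top (x := x)))
  obtain ⟨c, rfl⟩ := Submodule.mem_span_singleton.mp hb
  obtain ⟨p, hp, hp'⟩ := exists_polynomial_of_mem_iSup_eigenspace (ξ ρ) _ (lam ⟨ρ, H.mem⟩)
    (fun k => by rw [Ne, sub_eq_self]; exact_mod_cast Nat.succ_ne_zero k) hy
  have := hN.aeval_mem ρ p hx
  rw [map_add, hp, add_zero, map_smul, aeval_apply_of_eigenvector _ (hv.cartan ⟨ρ, H.mem⟩),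
    smul_smul] at this
  by_cases hc0 : c = 0
  · simpa [hc0] using hy
  · refine absurd (hc N hN ?_) hN'
    have h1 := N.smul_mem (c * p.eval (lam ⟨ρ, H.mem⟩))⁻¹ this
    rwa [smul_smul, inv_mul_cancel₀ (mul_ne_zero hc0 hp'), one_smul] at h1

theorem IsHighestWeight.notMem_lowerPart (H : IsTriangular h n ρ)
    (hv : IsHighestWeight ξ h n lam v) (hv0 : v ≠ 0) :
    v ∉ lowerPart ξ ρ (lam ⟨ρ, H.mem⟩) := fun hmem =>
  hv0 <| eq_zero_of_mem_iSup_eigenspace (ξ ρ) _ (lam ⟨ρ, H.mem⟩)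
    (fun k => by rw [Ne, sub_eq_self]; exact_mod_cast Nat.succ_ne_zero k) hmem
    (hv.cartan ⟨ρ, H.mem⟩)

/-- All eigenvalues of `ρ` on a cyclic highest weight representation lie a natural number below the
top one. For a simple representation this applies to two highest weight vectors in both directions.
-/
theorem IsHighestWeight.exists_eq_sub (H : IsTriangular h n ρ)
    (hv : IsHighestWeight ξ h n lam v) (hc : IsCyclic' ξ v)
    (hw : IsHighestWeight ξ h n mu v') (hw0 : v' ≠ 0) :
    ∃ k : ℕ, mu ⟨ρ, H.mem⟩ = lam ⟨ρ, H.mem⟩ - k := by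
  by_contra! hk
  refine hw0 (eq_zero_of_mem_iSup_eigenspace (ξ ρ) (fun k : ℕ => lam ⟨ρ, H.mem⟩ - k) _
    (fun k => (hk k).symm) ?_ (hw.cartan ⟨ρ, H.mem⟩))
  have h1 : (F ∙ v) ⊔ lowerPart ξ ρ (lam ⟨ρ, H.mem⟩) ≤
      ⨆ k : ℕ, (ξ ρ).eigenspace (lam ⟨ρ, H.mem⟩ - k) := by
    refine sup_le ?_ (iSup_le fun k => le_iSup (fun k : ℕ => (ξ ρ).eigenspace
      (lam ⟨ρ, H.mem⟩ - k)) (k + 1))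
    rw [Submodule.span_singleton_le_iff_mem]
    refine Submodule.mem_iSup_of_mem 0 ?_
    simpa [Module.End.mem_eigenspace_iff] using hv.cartan ⟨ρ, H.mem⟩
  exact h1 (hv.top_le H hc Submodule.mem_top)

/-- The highest weight of a simple representation is unique. -/
theorem IsHighestWeight.unique (H : IsTriangular h n ρ) (hξ : IsSimpleRep ξ)
    (hv : IsHighestWeight ξ h n lam v) (hv0 : v ≠ 0)
    (hw : IsHighestWeight ξ h n mu v') (hw0 : v' ≠ 0) : lam = mu := by
  obtain ⟨k, hk⟩ := hv.exists_eq_sub H (hξ.isCyclic' hv0) hw hw0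
  obtain ⟨l, hl⟩ := hw.exists_eq_sub H (hξ.isCyclic' hw0) hv hv0
  -- Each weight is below the other at `ρ`, so in characteristic 0 the two values agree.
  have hkl : ((k + l : ℕ) : F) = 0 := by push_cast; linear_combination hk + hl
  have hk0 : k = 0 := by
    have : k + l = 0 := by exact_mod_cast hkl
    omega
  subst hk0
  have heq : mu ⟨ρ, H.mem⟩ = lam ⟨ρ, H.mem⟩ := by simpa using hk
  obtain ⟨b, hb, y, hy, hby⟩ := Submodule.mem_sup.mp
    (hv.top_le H (hξ.isCyclic' hv0) (Submodule.mem_top (x := v')))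
  obtain ⟨c, rfl⟩ := Submodule.mem_span_singleton.mp hb
  -- `y = v' - c • v` is an eigenvector for the top eigenvalue and also lies in the lower part.
  -- Hence `v'` is proportional to `v`, and the full weights coincide, not just their values at `ρ`.
  have hy0 : y = 0 := by
    refine eq_zero_of_mem_iSup_eigenspace (ξ ρ) _ (lam ⟨ρ, H.mem⟩)
      (fun k => by rw [Ne, sub_eq_self]; exact_mod_cast Nat.succ_ne_zero k) hy ?_
    have e : y = v' - c • v := by rw [← hby]; abel
    have e1 : ξ ρ v = lam ⟨ρ, H.mem⟩ • v := hv.cartan ⟨ρ, H.mem⟩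
    have e2 : ξ ρ v' = lam ⟨ρ, H.mem⟩ • v' := heq ▸ hw.cartan ⟨ρ, H.mem⟩
    rw [e, map_sub, map_smul, e1, e2, smul_sub, smul_comm]
  have hcv : v' = c • v := by rw [← hby, hy0, add_zero]
  refine LinearMap.ext fun x => ?_
  have e1 := hw.cartan x
  rw [hcv, map_smul, hv.cartan x, smul_comm, ← hcv, ← sub_eq_zero, ← sub_smul] at e1
  exact sub_eq_zero.mp ((smul_eq_zero.mp e1).resolve_right hw0)

/-- A nonzero finite-dimensional representation has a highest weight vector. -/
theorem exists_isHighestWeight [IsAlgClosed F] [FiniteDimensional F V] [Nontrivial V]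
    (H : IsTriangular h n ρ) (ξ : 𝔤 →ₗ⁅F⁆ Module.End F V) :
    ∃ (lam : Module.Dual F h) (v : V), v ≠ 0 ∧ IsHighestWeight ξ h n lam v := by
  obtain ⟨c, hc⟩ := Module.End.exists_eigenvalue (ξ ρ)
  -- There are finitely many eigenvalues, and the `c + k` are distinct in characteristic 0, so some
  -- `k` is largest. Raising operators annihilate the eigenspace at that `c + k`.
  have hfin : {k : ℕ | (ξ ρ).HasEigenvalue (c + k)}.Finite := by
    have h1 : {μ : F | (ξ ρ).HasEigenvalue μ}.Finite :=
      Module.End.finite_hasEigenvalue _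
    exact h1.preimage (fun a _ b _ hab => by simpa using hab)
  obtain ⟨k, hk, hmax⟩ := hfin.exists_maximalFor id _ ⟨0, by simpa using hc⟩
  have hbot : ∀ j : ℕ, 0 < j → (ξ ρ).eigenspace (c + k + j) = ⊥ := by
    intro j hj
    by_contra hne
    have : (ξ ρ).HasEigenvalue (c + (k + j : ℕ)) := by
      rw [Module.End.hasEigenvalue_iff]; push_cast; rwa [← add_assoc]
    have := hmax this (Nat.le_add_right k j)
    simp at this; omega
  have hρ : ∀ x ∈ h, ⁅ρ, x⁆ = (0 : F) • x := fun x hx => by rw [H.comm ρ H.mem x hx, zero_smul]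
  -- The Cartan subalgebra commutes with `ρ` and so acts on the top eigenspace by commuting
  -- operators.
  obtain ⟨v, hv, hv0, hvh⟩ := exists_common_eigenvector (fun x : h => ξ x)
    ((ξ ρ).eigenspace (c + k)) hk
    (fun x v hv => by simpa using apply_mem_eigenspace (hρ x x.2) hv)
    (fun x y v _ => by simp [rep_rep_apply ξ x y v, H.comm x x.2 y y.2])
  choose l hl using hvh
  refine ⟨⟨⟨l, fun x y => ?_⟩, fun a x => ?_⟩, v, hv0, fun x hx => ?_, hl⟩
  · refine smul_left_injective F hv0 ?_
    simp only [add_smul]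
    rw [← hl, ← hl, ← hl]; simp
  · refine smul_left_injective F hv0 ?_
    simp only [RingHom.id_apply, smul_assoc]
    rw [← hl, ← hl]; simp
  · have : n ≤ LinearMap.ker (LinearMap.applyₗ v ∘ₗ (ξ : 𝔤 →ₗ[F] Module.End F V)) := by
      refine H.pos.trans (Submodule.span_le.mpr ?_)
      rintro x ⟨j, hj, hx⟩
      have := apply_mem_eigenspace hx hv
      rw [hbot j hj] at this
      simpa using this
    simpa using this hx

/-- The value of the highest weight of a finite-dimensional representation on the semisimple
element of an `sl₂`-triple with `e ∈ n` is a natural number. -/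
theorem IsHighestWeight.exists_nat [FiniteDimensional F V] (hv : IsHighestWeight ξ h n lam v)
    (hv0 : v ≠ 0) (x : h) {e f : 𝔤} (he : e ∈ n) (hef : ⁅e, f⁆ = x)
    (hxe : ⁅(x : 𝔤), e⁆ = (2 : F) • e) (hxf : ⁅(x : 𝔤), f⁆ = -((2 : F) • f)) :
    ∃ k : ℕ, lam x = k := by
  -- An `IsSl2Triple` requires a nonzero semisimple element, so the zero element is treated apart.
  by_cases hx0 : (x : 𝔤) = 0
  · exact ⟨0, by rw [show x = 0 from Subtype.ext hx0]; simp⟩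
  have t : IsSl2Triple (x : 𝔤) e f :=
    ⟨hx0, hef, by rw [hxe, two_smul, two_smul], by rw [hxf, two_smul, two_smul]⟩
  let _ : LieRingModule 𝔤 V := LieRingModule.compLieHom V ξ
  have : LieModule F 𝔤 V := LieModule.compLieHom V ξ
  have P : t.HasPrimitiveVectorWith v (lam x) := ⟨hv0, hv.cartan x, hv.pos e he⟩
  exact P.exists_nat

end

end HighestWeightTheory

/-! ### Verma modules and their simple quotients -/

section Enveloping

attribute [local instance] LieRing.ofAssociativeRing

variable {F : Type u} [Field F] {𝔤 : Type v} [LieRing 𝔤] [LieAlgebra F 𝔤]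
  {V : Type w} [AddCommGroup V] [Module F V]

theorem enveloping_induction {p : UniversalEnvelopingAlgebra F 𝔤 → Prop}
    (hι : ∀ x, p (UniversalEnvelopingAlgebra.ι F x)) (halg : ∀ c, p (algebraMap F _ c))
    (hadd : ∀ a b, p a → p b → p (a + b)) (hmul : ∀ a b, p a → p b → p (a * b))
    (a : UniversalEnvelopingAlgebra F 𝔤) : p a := by
  obtain ⟨t, rfl⟩ : ∃ t, UniversalEnvelopingAlgebra.mkAlgHom F 𝔤 t = a :=
    Quotient.mk_surjective a
  induction t using TensorAlgebra.induction with
  | algebraMap r => simpa using halg r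
  | ι x => exact hι x
  | mul a b ha hb => simpa using hmul _ _ ha hb
  | add a b ha hb => simpa using hadd _ _ ha hb

variable [Module (UniversalEnvelopingAlgebra F 𝔤) V]
  [IsScalarTower F (UniversalEnvelopingAlgebra F 𝔤) V]

variable (F 𝔤 V) in
/-- The representation on a module over the enveloping algebra. -/
def envelopingRep : 𝔤 →ₗ⁅F⁆ Module.End F V :=
  ((Algebra.lsmul F F V : UniversalEnvelopingAlgebra F 𝔤 →ₐ[F] Module.End F V) :
    UniversalEnvelopingAlgebra F 𝔤 →ₗ⁅F⁆ Module.End F V).comp (UniversalEnvelopingAlgebra.ι F)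

theorem envelopingRep_apply (x : 𝔤) (v : V) :
    envelopingRep F 𝔤 V x v = UniversalEnvelopingAlgebra.ι F x • v := rfl

theorem IsStable.smul_mem {N : Submodule F V} (hN : IsStable (envelopingRep F 𝔤 V) N)
    (a : UniversalEnvelopingAlgebra F 𝔤) {v : V} (hv : v ∈ N) : a • v ∈ N := by
  induction a using enveloping_induction generalizing v with
  | hι x => exact hN x v hv
  | halg c => rw [algebraMap_smul]; exact N.smul_mem c hv
  | hadd a b ha hb => rw [add_smul]; exact add_mem (ha hv) (hb hv)
  | hmul a b ha hb => rw [mul_smul]; exact ha (hb hv)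

/-- A stable subspace as a submodule over the enveloping algebra. -/
def IsStable.toSubmodule {N : Submodule F V} (hN : IsStable (envelopingRep F 𝔤 V) N) :
    Submodule (UniversalEnvelopingAlgebra F 𝔤) V where
  carrier := N
  zero_mem' := N.zero_mem
  add_mem' := N.add_mem
  smul_mem' a _ hv := hN.smul_mem a hv

theorem isStable_restrictScalars (N : Submodule (UniversalEnvelopingAlgebra F 𝔤) V) :
    IsStable (envelopingRep F 𝔤 V) (N.restrictScalars F) :=
  fun _ _ hv => N.smul_mem _ hv

theorem isCyclic'_of_span {v : V} (hv : Submodule.span (UniversalEnvelopingAlgebra F 𝔤) {v} = ⊤) :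
    IsCyclic' (envelopingRep F 𝔤 V) v := by
  intro N hN hvN
  have h1 : (⊤ : Submodule (UniversalEnvelopingAlgebra F 𝔤) V) ≤ hN.toSubmodule := by
    rw [← hv, Submodule.span_singleton_le_iff_mem]; exact hvN
  exact eq_top_iff.mpr fun x _ => h1 (Submodule.mem_top (x := x))

end Enveloping

/-! ### The module `L⁰(λ)`: simplicity, nonvanishing, finite-dimensionality, universal property. -/

section LZeroTheory

attribute [local instance] LieRing.ofAssociativeRing

variable {F : Type u} [Field F] {T : VFType} {n : ℕ} (lam : Weight F T n)

/-- The canonical generator of the Verma module. -/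
def vermaVec : Verma lam := (vermaIdeal lam).mkQ 1

/-- The canonical generator of `L⁰(λ)`. -/
def lZeroVec : LZero lam := (vermaRadical lam).mkQ (vermaVec lam)

theorem span_vermaVec : Submodule.span (U0 F T n) {vermaVec lam} = ⊤ := by
  rw [vermaVec, ← Set.image_singleton, ← Submodule.map_span, ← Ideal.span, Ideal.span_singleton_one,
    Submodule.map_top, Submodule.range_mkQ]

theorem span_lZeroVec : Submodule.span (U0 F T n) {lZeroVec lam} = ⊤ := by
  rw [lZeroVec, ← Set.image_singleton, ← Submodule.map_span, span_vermaVec,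
    Submodule.map_top, Submodule.range_mkQ]

theorem isCyclic'_vermaVec : IsCyclic' (envelopingRep F (vf0 F T n) (Verma lam)) (vermaVec lam) :=
  isCyclic'_of_span (span_vermaVec lam)

theorem lZeroRep_eq : lZeroRep lam = envelopingRep F (vf0 F T n) (LZero lam) := rfl

theorem isCyclic'_lZeroVec : IsCyclic' (lZeroRep lam) (lZeroVec lam) :=
  isCyclic'_of_span (span_lZeroVec lam)

theorem isHighestWeight_vermaVec : IsHighestWeight (envelopingRep F (vf0 F T n) (Verma lam))
    (cartan F T n) (nPlus F T n) lam (vermaVec lam) where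
  pos x hx := by
    rw [envelopingRep_apply, vermaVec, ← map_smul, smul_eq_mul, mul_one, Submodule.mkQ_apply,
      Submodule.Quotient.mk_eq_zero]
    exact Submodule.subset_span (Or.inl ⟨x, hx, rfl⟩)
  cartan x := by
    rw [envelopingRep_apply, ← algebraMap_smul (U0 F T n) (lam x), ← sub_eq_zero, ← sub_smul,
      vermaVec, ← map_smul, smul_eq_mul, mul_one, Submodule.mkQ_apply,
      Submodule.Quotient.mk_eq_zero]
    exact Submodule.subset_span (Or.inr ⟨x, rfl⟩)

theorem isHighestWeight_lZeroVec : IsHighestWeight (lZeroRep lam)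
    (cartan F T n) (nPlus F T n) lam (lZeroVec lam) where
  pos x hx := by
    have h := (isHighestWeight_vermaVec lam).pos x hx
    rw [lZeroRep_eq, envelopingRep_apply] at *
    rw [lZeroVec, ← map_smul, h, map_zero]
  cartan x := by
    have h := (isHighestWeight_vermaVec lam).cartan x
    rw [lZeroRep_eq, envelopingRep_apply] at *
    rw [lZeroVec, ← map_smul, h]; rfl

variable {lam} {ρ : vf0 F T n}

/-- Each proper submodule lies in the lower part, hence so does their sum. This keeps the canonical
generator, when nonzero, out of the radical. -/
theorem mem_lowerPart_of_mem_vermaRadical [CharZero F]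
    (H : IsTriangular (cartan F T n) (nPlus F T n) ρ) {x : Verma lam} (hx : x ∈ vermaRadical lam) :
    x ∈ lowerPart (envelopingRep F (vf0 F T n) (Verma lam)) ρ (lam ⟨ρ, H.mem⟩) := by
  rw [vermaRadical, sSup_eq_iSup'] at hx
  induction hx using Submodule.iSup_induction' with
  | mem N x hx =>
    refine (isHighestWeight_vermaVec lam).le_lowerPart H (isCyclic'_vermaVec lam)
      (isStable_restrictScalars N.1) (fun h => N.2 ?_) hx
    exact eq_top_iff.mpr fun y _ => (h ▸ Submodule.mem_top : y ∈ N.1.restrictScalars F)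
  | zero => exact zero_mem _
  | add x y _ _ hx hy => exact add_mem hx hy

theorem lZeroVec_ne_zero [CharZero F] (H : IsTriangular (cartan F T n) (nPlus F T n) ρ)
    (h0 : vermaVec lam ≠ 0) : lZeroVec lam ≠ 0 := fun h =>
  (isHighestWeight_vermaVec lam).notMem_lowerPart H h0 <|
    mem_lowerPart_of_mem_vermaRadical H <| by
      rwa [lZeroVec, Submodule.mkQ_apply, Submodule.Quotient.mk_eq_zero] at h

/-- The preimage of a stable subspace in the Verma module is either everything or one of the proper
submodules summed in the radical. -/
theorem isSimpleRep_lZeroRep : IsSimpleRep (lZeroRep lam) := by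
  intro N hN
  let N' : Submodule (U0 F T n) (LZero lam) := IsStable.toSubmodule hN
  by_cases h : N'.comap (vermaRadical lam).mkQ = ⊤
  · right
    refine eq_top_iff.mpr fun x _ => ?_
    obtain ⟨y, rfl⟩ := (vermaRadical lam).mkQ_surjective x
    have : y ∈ N'.comap (vermaRadical lam).mkQ := h ▸ Submodule.mem_top
    exact this
  · left
    refine (Submodule.eq_bot_iff _).mpr fun x hx => ?_
    obtain ⟨y, rfl⟩ := (vermaRadical lam).mkQ_surjective x
    have hy : y ∈ vermaRadical lam := (le_sSup (a := N'.comap (vermaRadical lam).mkQ) h) hx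
    simpa using hy

section

variable {V : Type w} [AddCommGroup V] [Module F V] (ξ : vf0 F T n →ₗ⁅F⁆ Module.End F V) {v : V}

/-- Universal property of the Verma module: acting on `v` annihilates the generators of the left
ideal. The vector `v` need not generate `V`. -/
theorem exists_verma_hom (hv : IsHighestWeight ξ (cartan F T n) (nPlus F T n) lam v) :
    ∃ φ : Verma lam →ₗ[F] V, φ (vermaVec lam) = v ∧
      ∀ (x : vf0 F T n) m, φ (UniversalEnvelopingAlgebra.ι F x • m) = ξ x (φ m) := by
  let _ : Module (U0 F T n) V :=
    Module.compHom V (UniversalEnvelopingAlgebra.lift F ξ).toRingHom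
  have hsm : ∀ (a : U0 F T n) (v : V), a • v = UniversalEnvelopingAlgebra.lift F ξ a v :=
    fun _ _ => rfl
  have : IsScalarTower F (U0 F T n) V := ⟨fun c a v => by
    rw [hsm, hsm, map_smul, LinearMap.smul_apply]⟩
  have hι : ∀ (x : vf0 F T n) (v : V), UniversalEnvelopingAlgebra.ι F x • v = ξ x v := fun x v => by
    rw [hsm, UniversalEnvelopingAlgebra.lift_ι_apply]
  have hle : vermaIdeal lam ≤ LinearMap.ker (LinearMap.toSpanSingleton (U0 F T n) V v) := by
    rw [vermaIdeal, Submodule.span_le]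
    rintro u (⟨x, hx, rfl⟩ | ⟨x, rfl⟩)
    · simp only [SetLike.mem_coe, LinearMap.mem_ker, LinearMap.toSpanSingleton_apply]
      rw [hι, hv.pos x hx]
    · simp only [SetLike.mem_coe, LinearMap.mem_ker, LinearMap.toSpanSingleton_apply]
      rw [sub_smul, hι, hv.cartan, algebraMap_smul, sub_self]
  refine ⟨((vermaIdeal lam).liftQ _ hle).restrictScalars F, ?_, fun x m => ?_⟩
  · simp [vermaVec]
  · simp only [LinearMap.coe_restrictScalars, map_smul, hι]

variable {ξ}

/-- A nonzero highest weight vector in any representation witnesses that the Verma module is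
nonzero, which replaces a basis of the enveloping algebra. -/
theorem vermaVec_ne_zero (hv : IsHighestWeight ξ (cartan F T n) (nPlus F T n) lam v)
    (hv0 : v ≠ 0) : vermaVec lam ≠ 0 := fun h => by
  obtain ⟨φ, hφ, -⟩ := exists_verma_hom ξ hv
  exact hv0 (by rw [← hφ, h, map_zero])

/-- The kernel of an equivariant linear map as a submodule over the enveloping algebra. -/
def equivariantKer (ξ : vf0 F T n →ₗ⁅F⁆ Module.End F V) (φ : Verma lam →ₗ[F] V)
    (hφ : ∀ (x : vf0 F T n) m, φ (UniversalEnvelopingAlgebra.ι F x • m) = ξ x (φ m)) :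
    Submodule (U0 F T n) (Verma lam) :=
  IsStable.toSubmodule (F := F) (𝔤 := vf0 F T n) (N := LinearMap.ker φ) fun x m hm => by
    rw [LinearMap.mem_ker] at hm ⊢
    rw [envelopingRep_apply, hφ, hm, map_zero]

/-- The kernel misses the generator, so it is one of the proper submodules. -/
theorem ker_le_vermaRadical {φ : Verma lam →ₗ[F] V}
    (hφ : ∀ (x : vf0 F T n) m, φ (UniversalEnvelopingAlgebra.ι F x • m) = ξ x (φ m))
    (h0 : φ (vermaVec lam) ≠ 0) :
    LinearMap.ker φ ≤ (vermaRadical lam).restrictScalars F := by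
  have : equivariantKer ξ φ hφ ≤ vermaRadical lam := by
    refine le_sSup fun h => h0 ?_
    have : vermaVec lam ∈ equivariantKer ξ φ hφ := h ▸ Submodule.mem_top
    exact this
  exact this

/-- If `λ` is the weight of a highest weight vector in a finite-dimensional representation, then
`L⁰(λ)` is finite-dimensional. -/
theorem finiteDimensional_lZero [FiniteDimensional F V]
    (hv : IsHighestWeight ξ (cartan F T n) (nPlus F T n) lam v) (hv0 : v ≠ 0) :
    FiniteDimensional F (LZero lam) := by
  obtain ⟨φ, hφv, hφ⟩ := exists_verma_hom ξ hv
  have hle := ker_le_vermaRadical hφ (by rwa [hφv])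
  -- The image of the Verma module in `V` is finite-dimensional, and `L⁰(λ)` is a quotient of it
  -- because the kernel lies in the radical.
  have : FiniteDimensional F (Verma lam ⧸ LinearMap.ker φ) :=
    Module.Finite.equiv φ.quotKerEquivRange.symm
  let ψ : (Verma lam ⧸ LinearMap.ker φ) →ₗ[F] LZero lam :=
    (LinearMap.ker φ).liftQ ((vermaRadical lam).mkQ.restrictScalars F) fun x hx => by
      have := hle hx
      simpa using this
  refine Module.Finite.of_surjective ψ fun x => ?_
  obtain ⟨y, rfl⟩ := (vermaRadical lam).mkQ_surjective x
  exact ⟨(LinearMap.ker φ).mkQ y, by simp [ψ]⟩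

/-- A simple representation with a highest weight vector of weight `λ` is isomorphic to `L⁰(λ)`. -/
theorem exists_lZero_equiv [CharZero F] (H : IsTriangular (cartan F T n) (nPlus F T n) ρ)
    (hξ : IsSimpleRep ξ) (hv : IsHighestWeight ξ (cartan F T n) (nPlus F T n) lam v)
    (hv0 : v ≠ 0) :
    ∃ e : LZero lam →ₗ[F] V, e ≠ 0 ∧ ∀ x l, e (lZeroRep lam x l) = ξ x (e l) := by
  obtain ⟨φ, hφv, hφ⟩ := exists_verma_hom ξ hv
  have hle : (vermaRadical lam).restrictScalars F ≤ LinearMap.ker φ := by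
    have hst : IsStable ξ (((vermaRadical lam).restrictScalars F).map φ) := by
      rintro x _ ⟨m, hm, rfl⟩
      exact ⟨UniversalEnvelopingAlgebra.ι F x • m, (vermaRadical lam).smul_mem _ hm, hφ x m⟩
    -- If the radical maps onto `V`, then `v = φ m` with `m` in the radical. The generator minus `m`
    -- lies in the kernel, hence in the radical, and so does the generator itself, which is
    -- impossible.
    rcases hξ _ hst with h | h
    · rwa [LinearMap.le_ker_iff_map]
    · obtain ⟨m, hm, hm'⟩ : v ∈ ((vermaRadical lam).restrictScalars F).map φ :=
        h ▸ Submodule.mem_top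
      have hker := ker_le_vermaRadical hφ (by rwa [hφv])
      have h1 : vermaVec lam - m ∈ vermaRadical lam :=
        hker (by rw [LinearMap.mem_ker, map_sub, hφv, hm', sub_self])
      have h2 : vermaVec lam ∈ vermaRadical lam := by simpa using add_mem h1 hm
      refine absurd ?_ (lZeroVec_ne_zero H (vermaVec_ne_zero hv hv0))
      simpa [lZeroVec] using h2
  let e : LZero lam →ₗ[F] V := (((vermaRadical lam).restrictScalars F).liftQ φ hle) ∘ₗ
    ((Submodule.Quotient.restrictScalarsEquiv F (vermaRadical lam)).symm : _ →ₗ[F] _)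
  have he : ∀ m, e ((vermaRadical lam).mkQ m) = φ m := fun m => rfl
  refine ⟨e, fun h => hv0 ?_, fun x l => ?_⟩
  · rw [← hφv, ← he, h, LinearMap.zero_apply]
  · obtain ⟨y, rfl⟩ := (vermaRadical lam).mkQ_surjective l
    rw [lZeroRep_eq, envelopingRep_apply, ← map_smul, he, he, hφ]

end

end LZeroTheory

/-! ### The structure of `g_0` -/

section Linear

variable {F : Type u} [Field F] {n : ℕ}

theorem vect_lie_add (a b c : Vect F n) : ⁅a, b + c⁆ = ⁅a, b⁆ + ⁅a, c⁆ := lie_add a b c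

theorem vect_sub_lie (a b c : Vect F n) : ⁅a - b, c⁆ = ⁅a, c⁆ - ⁅b, c⁆ := sub_lie a b c

theorem vect_lie_sub (a b c : Vect F n) : ⁅a, b - c⁆ = ⁅a, b⁆ - ⁅a, c⁆ := lie_sub a b c

theorem vect_smul_lie (c : F) (a b : Vect F n) : ⁅c • a, b⁆ = c • ⁅a, b⁆ := smul_lie c a b

theorem vect_lie_smul (c : F) (a b : Vect F n) : ⁅a, c • b⁆ = c • ⁅a, b⁆ := lie_smul c a b

theorem vect_sub_smul (c d : F) (a : Vect F n) : (c - d) • a = c • a - d • a := sub_smul c d a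

theorem vect_sum_lie {ι : Type*} (s : Finset ι) (a : ι → Vect F n) (b : Vect F n) :
    ⁅∑ i ∈ s, a i, b⁆ = ∑ i ∈ s, ⁅a i, b⁆ := sum_lie s a b

theorem vect_lie_sum {ι : Type*} (s : Finset ι) (a : ι → Vect F n) (b : Vect F n) :
    ⁅b, ∑ i ∈ s, a i⁆ = ∑ i ∈ s, ⁅b, a i⁆ := lie_sum s a b

/-- The coefficient of `x_a ∂_b` in a vector field. -/
def cf (a b : Fin n) : Vect F n →ₗ[F] F where
  toFun D := MvPolynomial.coeff 0 (pd a (D (MvPolynomial.X b)))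
  map_add' D E := by simp
  map_smul' c D := by simp

theorem cf_apply (a b : Fin n) (D : Vect F n) :
    cf a b D = MvPolynomial.coeff 0 (pd a (D (MvPolynomial.X b))) := rfl

theorem pd_eq_C_cf {D : Vect F n} (hD : D ∈ vectPart F n 1) (a b : Fin n) :
    pd a (D (MvPolynomial.X b)) = MvPolynomial.C (cf a b D) := by
  have h : (pd a (D (MvPolynomial.X b))).IsHomogeneous 0 := by
    simpa [pd] using (hD b).pderiv (i := a)
  rw [cf_apply]
  exact MvPolynomial.totalDegree_eq_zero_iff_eq_C.mp (Nat.le_zero.mp h.totalDegree_le)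

theorem linPart_zero_eq {D : Vect F n} (hD : D ∈ vectPart F n 1) : linPart 0 D = D := by
  apply MvPolynomial.derivation_ext
  intro k
  rw [linPart_X]
  have h := (hD k).sum_X_mul_pderiv
  rw [one_smul] at h
  conv_rhs => rw [← h]
  refine Finset.sum_congr rfl fun j _ => ?_
  have := pd_eq_C_cf hD j k
  rw [← cf_apply, ← this, mul_comm]; rfl

theorem eq_sum_cf {D : Vect F n} (hD : D ∈ vectPart F n 1) :
    D = ∑ a, ∑ b, cf a b D • (xd a b : Vect F n) := by
  conv_lhs => rw [← linPart_zero_eq hD, linPart, Finset.sum_comm]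
  rfl

theorem xd_mem_vectPart (a b : Fin n) : (xd a b : Vect F n) ∈ vectPart F n 1 := by
  intro i
  rw [xd_apply, pd_X]
  split_ifs
  · simpa using MvPolynomial.isHomogeneous_X F a
  · simpa using MvPolynomial.isHomogeneous_zero (Fin n) F 1

theorem cf_xd (a b c d : Fin n) :
    cf a b (xd c d : Vect F n) = if a = c ∧ b = d then 1 else 0 := by
  rw [cf_apply, xd_apply, pd_X]
  by_cases h : d = b
  · subst h
    simp [pd_X]
    split_ifs <;> simp
  · rw [if_neg h, if_neg (fun h' => h h'.2.symm)]; simp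

/-- The diagonal vector field with the given coefficients. -/
def diag (d : Fin n → F) : Vect F n := ∑ a, d a • (xd a a : Vect F n)

theorem diag_lie_xd (d : Fin n → F) (a b : Fin n) :
    ⁅diag d, (xd a b : Vect F n)⁆ = (d a - d b) • (xd a b : Vect F n) := by
  rw [diag, vect_sum_lie]
  simp only [vect_smul_lie, xd_lie, smul_sub, Finset.sum_sub_distrib, smul_ite, smul_zero,
    Finset.sum_ite_eq, Finset.sum_ite_eq', Finset.mem_univ, if_true, vect_sub_smul]

theorem eq_diag_of_mem_cartanGens {T : VFType} {D : Vect F n}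
    (hD : D ∈ Submodule.span F (cartanGens F T n)) : D = diag fun a => cf a a D := by
  induction hD using Submodule.span_induction with
  | zero => simp [diag]
  | add x y _ _ hx hy =>
    conv_lhs => rw [hx, hy]
    simp [diag, add_smul, Finset.sum_add_distrib]
  | smul c x _ hx =>
    conv_lhs => rw [hx]
    simp [diag, Finset.smul_sum, smul_smul]
  | mem x hx =>
    have h1 : ∀ i : Fin n, (xd i i : Vect F n) = diag fun a => cf a a (xd i i) := by
      intro i
      simp [diag, cf_xd]
    have h2 : ∀ i j : Fin n, (xd i i - xd j j : Vect F n) =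
        diag fun a => cf a a (xd i i - xd j j) := by
      intro i j
      conv_lhs => rw [h1 i, h1 j]
      simp only [diag, map_sub, vect_sub_smul, Finset.sum_sub_distrib]
    match T, hx with
    | .W, ⟨i, hi⟩ => rw [hi]; exact h1 i
    | .S, ⟨i, j, _, hi⟩ => rw [hi]; exact h2 i j
    | .H, ⟨i, j, _, hi⟩ => rw [hi]; exact h2 i j

/-- The partner index: `i ↦ i + r` and `i + r ↦ i`, where `n = 2r`. -/
def cj (a : Fin n) : Fin n :=
  if h : (a : ℕ) < n / 2 then ⟨a + n / 2, by omega⟩ else ⟨a - n / 2, by omega⟩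

/-- The sign of an index: `1` on the first half of the indices and `-1` on the second half. -/
def sg (a : Fin n) : ℤ := if (a : ℕ) < n / 2 then 1 else -1

theorem sg_mul_self (a : Fin n) : sg a * sg a = 1 := by
  unfold sg; split_ifs <;> rfl

theorem cj_cj (hn : Even n) (a : Fin n) : cj (cj a) = a := by
  obtain ⟨r, rfl⟩ := hn
  have := a.2
  ext
  by_cases h : (a : ℕ) < (r + r) / 2
  · simp [cj, h]
  · have : ((a : ℕ) - (r + r) / 2 < (r + r) / 2) := by omega
    simp [cj, h, this]
    omega

theorem sg_cj (hn : Even n) (a : Fin n) : sg (cj a) = -sg a := by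
  obtain ⟨r, rfl⟩ := hn
  have := a.2
  by_cases h : (a : ℕ) < (r + r) / 2
  · have : ¬ ((a : ℕ) + (r + r) / 2 < (r + r) / 2) := by omega
    simp [sg, cj, h]
  · have : ((a : ℕ) - (r + r) / 2 < (r + r) / 2) := by omega
    simp [sg, cj, h, this]

theorem cj_inj (hn : Even n) {a b : Fin n} : cj a = cj b ↔ a = b :=
  (Function.LeftInverse.injective (cj_cj hn)).eq_iff

theorem val_eq_add_iff (hn : Even n) (i j : Fin n) :
    (j : ℕ) = i + n / 2 ↔ sg i = 1 ∧ j = cj i := by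
  obtain ⟨r, rfl⟩ := hn
  have := i.2
  have := j.2
  unfold sg cj
  by_cases h : (i : ℕ) < (r + r) / 2
  · simp [h, Fin.ext_iff]
  · simp [h]; omega

theorem sum_half_left {A : Type*} [AddCommMonoid A] (hn : Even n) (f : Fin n → A) (b : Fin n) :
    (∑ i : Fin n, ∑ j : Fin n, if (j : ℕ) = (i : ℕ) + n / 2 then
      (if b = i then f j else 0) else 0) = if sg b = 1 then f (cj b) else 0 := by
  rw [Finset.sum_eq_single b (fun i _ hi => by simp [Ne.symm hi]) (by simp)]
  simp only [val_eq_add_iff hn, if_true]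
  by_cases h : sg b = 1 <;> simp [h]

theorem sum_half_right {A : Type*} [AddCommMonoid A] (hn : Even n) (f : Fin n → A) (b : Fin n) :
    (∑ i : Fin n, ∑ j : Fin n, if (j : ℕ) = (i : ℕ) + n / 2 then
      (if b = j then f i else 0) else 0) = if sg b = -1 then f (cj b) else 0 := by
  have h1 : ∀ i j : Fin n, (j : ℕ) = i + n / 2 ↔ sg j = -1 ∧ i = cj j := by
    intro i j
    rw [val_eq_add_iff hn]
    constructor
    · rintro ⟨h, rfl⟩; rw [sg_cj hn, cj_cj hn, h]; simp
    · rintro ⟨h, rfl⟩; rw [sg_cj hn, cj_cj hn, h]; simp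
  rw [Finset.sum_comm]
  rw [Finset.sum_eq_single b (fun i _ hi => by simp [Ne.symm hi]) (by simp)]
  simp only [h1, if_true]
  by_cases h : sg b = -1 <;> simp [h]

theorem sg_eq (a : Fin n) : sg a = 1 ∨ sg a = -1 := by unfold sg; split_ifs <;> simp

/-- For even `n` each index occurs in exactly one pair of the form, so the double sum collapses to
the partner index, with a sign telling which half the index is in. -/
theorem lieDerivOmega_pd_eq (hn : Even n) (D : Vect F n) (a b : Fin n) :
    lieDerivOmega D (pd a) (pd b) = (sg a : Poly F n) * pd b (D (MvPolynomial.X (cj a))) -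
      (sg b : Poly F n) * pd a (D (MvPolynomial.X (cj b))) := by
  rw [lieDerivOmega_pd]
  have e : ∀ (i j : Fin n) (p q r s : Poly F n), (if (j : ℕ) = (i : ℕ) + n / 2 then
      p - q + r - s else 0) = (if (j : ℕ) = (i : ℕ) + n / 2 then p else 0) -
      (if (j : ℕ) = (i : ℕ) + n / 2 then q else 0) + (if (j : ℕ) = (i : ℕ) + n / 2 then r else 0) -
      (if (j : ℕ) = (i : ℕ) + n / 2 then s else 0) := by
    intros; split_ifs <;> simp
  simp only [e, Finset.sum_add_distrib, Finset.sum_sub_distrib]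
  rw [sum_half_right hn (fun i => pd a (D (MvPolynomial.X i))),
    sum_half_left hn (fun i => pd a (D (MvPolynomial.X i))),
    sum_half_left hn (fun i => pd b (D (MvPolynomial.X i))),
    sum_half_right hn (fun i => pd b (D (MvPolynomial.X i)))]
  rcases sg_eq a with h | h <;> rcases sg_eq b with h' | h' <;> simp [h, h'] <;> ring

theorem mem_vf_H_iff (hn : Even n) (D : Vect F n) : D ∈ vf F .H n ↔
    ∀ a b, (sg a : Poly F n) * pd b (D (MvPolynomial.X (cj a))) =
      (sg b : Poly F n) * pd a (D (MvPolynomial.X (cj b))) := by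
  constructor
  · intro h a b
    rw [← sub_eq_zero, ← lieDerivOmega_pd_eq hn]
    exact h _ _
  · intro h
    refine lieDerivOmega_eq_zero _ fun a b => ?_
    rw [lieDerivOmega_pd_eq hn, h, sub_self]

/-- The linear Hamiltonian vector fields `± x_a ∂_{b'} ± x_b ∂_{a'}`. -/
def hxd (a b : Fin n) : Vect F n :=
  (sg b : F) • (xd a (cj b) : Vect F n) + (sg a : F) • (xd b (cj a) : Vect F n)

theorem hxd_comm (a b : Fin n) : (hxd a b : Vect F n) = hxd b a := add_comm _ _

theorem hxd_mem_vf (hn : Even n) (a b : Fin n) : (hxd a b : Vect F n) ∈ vf F .H n := by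
  rw [mem_vf_H_iff hn]
  have key : ∀ c d, (sg c : Poly F n) * pd d ((hxd a b : Vect F n) (MvPolynomial.X (cj c))) =
      (if c = b ∧ d = a then 1 else 0) + if c = a ∧ d = b then 1 else 0 := by
    intro c d
    simp only [hxd, Derivation.add_apply, Derivation.smul_apply, xd_apply, pd_X, cj_inj hn,
      map_add, mul_add, MvPolynomial.smul_eq_C_mul, map_intCast]
    congr 1
    · by_cases h : b = c
      · subst h
        simp only [if_true, mul_one, true_and]
        rcases sg_eq b with h | h <;> by_cases h2 : d = a <;> simp [h, h2, pd_X]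
      · simp [h, Ne.symm h]
    · by_cases h : a = c
      · subst h
        simp only [if_true, mul_one, true_and]
        rcases sg_eq a with h | h <;> by_cases h2 : d = b <;> simp [h, h2, pd_X]
      · simp [h, Ne.symm h]
  intro c d
  rw [key, key, add_comm]
  simp [and_comm]

theorem hxd_mem_vf0 (hn : Even n) (a b : Fin n) : (hxd a b : Vect F n) ∈ vf0 F .H n :=
  ⟨hxd_mem_vf hn a b, add_mem (Submodule.smul_mem _ _ (xd_mem_vectPart _ _))
    (Submodule.smul_mem _ _ (xd_mem_vectPart _ _))⟩

theorem cf_H (hn : Even n) {D : Vect F n} (hD : D ∈ vf F .H n) (a b : Fin n) :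
    (sg a : F) * cf b (cj a) D = (sg b : F) * cf a (cj b) D := by
  have h := congrArg (MvPolynomial.coeff 0) ((mem_vf_H_iff hn D).mp hD a b)
  simp only [← zsmul_eq_mul, MvPolynomial.coeff_smul] at h ⊢
  exact h

/-- By `cf_H` the signed coefficients of `D` form a symmetric matrix, so the sum over all `a`, `b`
counts each one twice. Keeping the factor 2 on the left avoids a condition on the characteristic. -/
theorem two_smul_eq_sum_hxd (hn : Even n) {D : Vect F n} (hD : D ∈ vf0 F .H n) :
    (2 : F) • D = ∑ a, ∑ b, ((sg b : F) * cf a (cj b) D) • (hxd a b : Vect F n) := by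
  have hs : ∀ e : Fin n, ((sg e : ℤ) : F) * (sg e : F) = 1 := fun e => by
    rw [← Int.cast_mul, sg_mul_self, Int.cast_one]
  have h1 : D = ∑ a, ∑ b, cf a (cj b) D • (xd a (cj b) : Vect F n) := by
    conv_lhs => rw [eq_sum_cf hD.2]
    refine Finset.sum_congr rfl fun a _ => ?_
    exact (Equiv.sum_comp (Function.Involutive.toPerm cj (cj_cj hn))
      fun b => cf a b D • (xd a b : Vect F n)).symm
  have h2 : ∀ a b : Fin n, ((sg b : F) * cf a (cj b) D) • (hxd a b : Vect F n) =
      cf a (cj b) D • (xd a (cj b) : Vect F n) + cf b (cj a) D • (xd b (cj a) : Vect F n) := by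
    intro a b
    rw [hxd, smul_add, smul_smul, smul_smul]
    congr 2
    · rw [mul_right_comm, hs, one_mul]
    · rw [← cf_H hn hD.1 a b, mul_right_comm, hs, one_mul]
  simp only [h2, Finset.sum_add_distrib]
  rw [two_smul]
  conv_rhs => arg 2; rw [Finset.sum_comm]
  rw [← h1]

end Linear

/-! ### Root vectors, the grading element and the triangular decomposition of `g_0`. -/

section Triangular

variable {F : Type u} [Field F] {n : ℕ}

/-- The integral weights of the coordinates under the grading element of `h`. -/
def rhoWt (T : VFType) (a : Fin n) : ℤ :=
  match T with
  | .W => n - 1 - 2 * (a : ℤ)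
  | .S => n - 1 - 2 * (a : ℤ)
  | .H => if (a : ℕ) < n / 2 then (n / 2 : ℕ) - (a : ℤ) else (a : ℤ) - n

/-- An element of `h` whose adjoint eigenvalues on positive root vectors are positive integers. -/
def rho (F : Type u) [Field F] (T : VFType) (n : ℕ) : Vect F n := diag fun a => (rhoWt T a : F)

theorem rho_lie_xd (T : VFType) (a b : Fin n) : ⁅rho F T n, (xd a b : Vect F n)⁆ =
    ((rhoWt T a - rhoWt T b : ℤ) : F) • (xd a b : Vect F n) := by
  rw [rho, diag_lie_xd]; push_cast; rfl

theorem rhoWt_cj (hn : Even n) (a : Fin n) : rhoWt .H (cj a) = -rhoWt .H a := by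
  obtain ⟨r, rfl⟩ := hn
  have := a.2
  by_cases h : (a : ℕ) < (r + r) / 2
  · simp [rhoWt, cj, h]; omega
  · have : ((a : ℕ) - (r + r) / 2 < (r + r) / 2) := by omega
    simp [rhoWt, cj, h, this]; omega

theorem rho_lie_hxd (hn : Even n) (a b : Fin n) : ⁅rho F .H n, (hxd a b : Vect F n)⁆ =
    ((rhoWt .H a + rhoWt .H b : ℤ) : F) • (hxd a b : Vect F n) := by
  rw [hxd, vect_lie_add, vect_lie_smul, vect_lie_smul, rho_lie_xd, rho_lie_xd, rhoWt_cj hn,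
    rhoWt_cj hn, smul_add, sub_neg_eq_add, sub_neg_eq_add, smul_comm, smul_comm (sg a : F),
    add_comm (rhoWt _ b)]

/-- Reindexing by `σ` changes the sign of the coefficients, so a diagonal field antisymmetric under
an involution is a combination of differences. This places `ρ` in the Cartan subalgebra in types `S`
and `H`. -/
theorem diag_eq_half_sum [CharZero F] (σ : Fin n → Fin n) (hσ : Function.Involutive σ)
    (d : Fin n → F) (hd : ∀ a, d (σ a) = -d a) :
    (diag d : Vect F n) = (2⁻¹ : F) • ∑ a, d a • (xd a a - xd (σ a) (σ a) : Vect F n) := by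
  have h1 : ∑ a, d a • (xd (σ a) (σ a) : Vect F n) = - diag d := by
    rw [diag, ← Equiv.sum_comp hσ.toPerm, ← Finset.sum_neg_distrib]
    refine Finset.sum_congr rfl fun a _ => ?_
    simp only [Function.Involutive.coe_toPerm, hσ a, hd]
    exact neg_smul (d a) (xd a a : Vect F n)
  have h2 : ∑ a, d a • (xd a a - xd (σ a) (σ a) : Vect F n) = (2 : F) • diag d := by
    simp only [smul_sub, Finset.sum_sub_distrib, h1]
    exact (sub_neg_eq_add (diag d) (diag d)).trans (two_smul F (diag d : Vect F n)).symm
  rw [h2, smul_smul, inv_mul_cancel₀ two_ne_zero, one_smul]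

theorem xd_sub_xd_mem_span_S (a b : Fin n) :
    (xd a a - xd b b : Vect F n) ∈ Submodule.span F (cartanGens F .S n) := by
  rcases lt_trichotomy a b with h | rfl | h
  · exact Submodule.subset_span ⟨a, b, h, rfl⟩
  · simp
  · rw [← neg_sub]
    exact neg_mem (Submodule.subset_span ⟨b, a, h, rfl⟩)

theorem xd_sub_xd_mem_span_H (hn : Even n) (a : Fin n) :
    (xd a a - xd (cj a) (cj a) : Vect F n) ∈ Submodule.span F (cartanGens F .H n) := by
  rcases sg_eq a with h | h
  · exact Submodule.subset_span ⟨a, cj a, (val_eq_add_iff hn _ _).mpr ⟨h, rfl⟩, rfl⟩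
  · rw [← neg_sub]
    have : (xd (cj a) (cj a) - xd a a : Vect F n) ∈ cartanGens F .H n :=
      ⟨cj a, a, (val_eq_add_iff hn _ _).mpr ⟨by rw [sg_cj hn, h]; rfl, (cj_cj hn a).symm⟩, rfl⟩
    exact neg_mem (Submodule.subset_span this)

/-- With indices from 0, the weights in types `W` and `S` are `n-1, n-3, …, 1-n`, antisymmetric
under reversal. In type `H` they are `r, …, 1` on the first half and the negatives on the partners.
-/
theorem rho_mem_span [CharZero F] (T : VFType) (hT : T = .H → Even n) :
    rho F T n ∈ Submodule.span F (cartanGens F T n) := by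
  match T with
  | .W =>
    rw [rho, diag]
    refine sum_mem fun a _ => Submodule.smul_mem _ _ (Submodule.subset_span ?_)
    exact ⟨a, rfl⟩
  | .S =>
    rw [rho, diag_eq_half_sum Fin.rev Fin.rev_rev _ fun a => by
      have := a.2
      simp only [rhoWt, Fin.val_rev]
      rw [Nat.cast_sub (by omega)]
      push_cast; ring]
    exact Submodule.smul_mem _ _ (sum_mem fun a _ =>
      Submodule.smul_mem _ _ (xd_sub_xd_mem_span_S _ _))
  | .H =>
    rw [rho, diag_eq_half_sum cj (cj_cj (hT rfl)) _ fun a => by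
      rw [rhoWt_cj (hT rfl)]; push_cast; rfl]
    exact Submodule.smul_mem _ _ (sum_mem fun a _ =>
      Submodule.smul_mem _ _ (xd_sub_xd_mem_span_H (hT rfl) _))

theorem xd_mem_vf0_W (a b : Fin n) : (xd a b : Vect F n) ∈ vf0 F .W n :=
  ⟨LieSubalgebra.mem_top _, xd_mem_vectPart a b⟩

theorem divergence_xd (a b : Fin n) :
    divergence (xd a b : Vect F n) = if a = b then 1 else 0 := by
  rw [divergence, Finset.sum_eq_single b]
  · rw [xd_apply, pd_X, if_pos rfl, mul_one, pd_X]
    simp [eq_comm]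
  · intro i _ hi
    rw [xd_apply, pd_X, if_neg (Ne.symm hi), mul_zero, map_zero]
  · simp

theorem xd_mem_vf0_S {a b : Fin n} (h : a ≠ b) : (xd a b : Vect F n) ∈ vf0 F .S n :=
  ⟨by show divergence _ = 0; rw [divergence_xd, if_neg h], xd_mem_vectPart a b⟩

theorem xd_sub_xd_mem_vf0_S (a b : Fin n) : (xd a a - xd b b : Vect F n) ∈ vf0 F .S n := by
  refine ⟨?_, sub_mem (xd_mem_vectPart a a) (xd_mem_vectPart b b)⟩
  show divergence _ = 0
  have : ∀ D E : Vect F n, divergence (D - E) = divergence D - divergence E := by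
    intro D E; simp [divergence]
  rw [this, divergence_xd, divergence_xd, if_pos rfl, if_pos rfl, sub_self]

theorem hxd_self_cj (hn : Even n) (a : Fin n) :
    (hxd a (cj a) : Vect F n) = -(sg a : F) • (xd a a - xd (cj a) (cj a) : Vect F n) := by
  rw [hxd, cj_cj hn, sg_cj hn]; push_cast; module

theorem smul_hxd (hn : Even n) {a b : Fin n} (ha : sg a = 1) (hb : sg b = 1) :
    (xd a b - xd (cj b) (cj a) : Vect F n) = -(hxd a (cj b) : Vect F n) := by
  rw [hxd, cj_cj hn, sg_cj hn, ha, hb]; push_cast; module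

theorem xd_add_xd_eq_hxd {a b : Fin n} (ha : sg a = 1) (hb : sg b = 1) :
    (xd a (cj b) + xd b (cj a) : Vect F n) = hxd a b := by
  rw [hxd, ha, hb]; push_cast; module

theorem xd_sub_xd_mem_vf0_H (hn : Even n) (a : Fin n) :
    (xd a a - xd (cj a) (cj a) : Vect F n) ∈ vf0 F .H n := by
  have h := hxd_mem_vf0 (F := F) hn a (cj a)
  rw [hxd_self_cj hn] at h
  have h2 := Submodule.smul_mem (vf0 F .H n).toSubmodule (-(sg a : F)) h
  rcases sg_eq a with h' | h' <;> simpa [h', smul_smul] using h2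

theorem cartanGens_subset (T : VFType) (hT : T = .H → Even n) {D : Vect F n}
    (hD : D ∈ cartanGens F T n) : D ∈ vf0 F T n := by
  match T, hD with
  | .W, ⟨i, hi⟩ => rw [hi]; exact xd_mem_vf0_W _ _
  | .S, ⟨i, j, _, hi⟩ => rw [hi]; exact xd_sub_xd_mem_vf0_S _ _
  | .H, ⟨i, j, hij, hi⟩ =>
    rw [hi, ((val_eq_add_iff (hT rfl) i j).mp hij).2]
    exact xd_sub_xd_mem_vf0_H (hT rfl) i

theorem lt_iff_of_sg (T : Fin n) : sg T = 1 ↔ (T : ℕ) < n / 2 := by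
  unfold sg; split_ifs with h <;> simp [h]

/-- The positive root vectors lie in `g_0` and have positive integral eigenvalues under `ρ`. -/
theorem nPlusGens_spec (T : VFType) (hT : T = .H → Even n) {D : Vect F n}
    (hD : D ∈ nPlusGens F T n) :
    D ∈ vf0 F T n ∧ ∃ k : ℕ, 0 < k ∧ ⁅rho F T n, D⁆ = (k : F) • D := by
  have key : ∀ (D : Vect F n) (z : ℤ), 0 < z → ⁅rho F T n, D⁆ = (z : F) • D →
      ∃ k : ℕ, 0 < k ∧ ⁅rho F T n, D⁆ = (k : F) • D := by
    intro D z hz h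
    obtain ⟨k, rfl⟩ := Int.eq_ofNat_of_zero_le hz.le
    exact ⟨k, by exact_mod_cast hz, by rw [h]; simp⟩
  match T, hD with
  | .W, ⟨i, j, hij, hi⟩ =>
    rw [hi]
    exact ⟨xd_mem_vf0_W _ _, key _ _ (by simp only [rhoWt]; omega) (rho_lie_xd _ _ _)⟩
  | .S, ⟨i, j, hij, hi⟩ =>
    rw [hi]
    exact ⟨xd_mem_vf0_S hij.ne, key _ _ (by simp only [rhoWt]; omega) (rho_lie_xd _ _ _)⟩
  | .H, ⟨i, i', j, j', hi, hj, h⟩ =>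
    have hn := hT rfl
    obtain ⟨si, rfl⟩ := (val_eq_add_iff hn _ _).mp hi
    obtain ⟨sj, rfl⟩ := (val_eq_add_iff hn _ _).mp hj
    have hi' := (lt_iff_of_sg i).mp si
    have hj' := (lt_iff_of_sg j).mp sj
    rcases h with ⟨hij, h⟩ | ⟨hij, h⟩
    · rw [h, smul_hxd hn si sj]
      refine ⟨neg_mem (hxd_mem_vf0 hn _ _), key _ (rhoWt .H i + rhoWt .H (cj j)) ?_ ?_⟩
      · rw [rhoWt_cj hn]; simp only [rhoWt, hi', hj', if_true]; omega
      · rw [smul_neg, ← rho_lie_hxd hn]; exact lie_neg (rho F .H n) (hxd i (cj j))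
    · rw [h, xd_add_xd_eq_hxd si sj]
      refine ⟨hxd_mem_vf0 hn _ _, key _ (rhoWt .H i + rhoWt .H j) ?_ (rho_lie_hxd hn _ _)⟩
      simp only [rhoWt, hi', hj', if_true]; omega

/-- The coefficient functionals on `h`. -/
def cartanCoord (T : VFType) (a : Fin n) : Weight F T n :=
  cf a a ∘ₗ incl0 F T n ∘ₗ (cartan F T n).subtype

theorem cartan_lie_xd {T : VFType} (h : cartan F T n) (a b : Fin n) :
    ⁅((h : vf0 F T n) : Vect F n), (xd a b : Vect F n)⁆ =
      (cartanCoord T a - cartanCoord T b : Weight F T n) h • (xd a b : Vect F n) := by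
  have h2 : ((h : vf0 F T n) : Vect F n) ∈ Submodule.span F (cartanGens F T n) := h.2
  rw [eq_diag_of_mem_cartanGens h2, diag_lie_xd]
  rfl

theorem cartanCoord_cj (hn : Even n) (a : Fin n) :
    (cartanCoord .H (cj a) : Weight F .H n) = -cartanCoord .H a := by
  refine LinearMap.ext fun h => ?_
  have h1 := cf_H hn (h : vf0 F .H n).2.1 a (cj a)
  rw [cj_cj hn, sg_cj hn] at h1
  show cf (cj a) (cj a) ((h : vf0 F .H n) : Vect F n) = -cf a a ((h : vf0 F .H n) : Vect F n)
  rcases sg_eq a with h' | h' <;> rw [h'] at h1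
  · simpa using h1
  · have := congrArg Neg.neg h1
    simpa using this

theorem cartan_lie_hxd (hn : Even n) (h : cartan F .H n) (a b : Fin n) :
    ⁅((h : vf0 F .H n) : Vect F n), (hxd a b : Vect F n)⁆ =
      (cartanCoord .H a + cartanCoord .H b : Weight F .H n) h • (hxd a b : Vect F n) := by
  rw [hxd, vect_lie_add, vect_lie_smul, vect_lie_smul, cartan_lie_xd, cartan_lie_xd,
    cartanCoord_cj hn, cartanCoord_cj hn, smul_add, sub_neg_eq_add, sub_neg_eq_add, smul_comm,
    smul_comm (sg a : F), add_comm (cartanCoord _ b)]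

theorem cartan_lie_cartan {T : VFType} (h : cartan F T n) {D : Vect F n}
    (hD : D ∈ Submodule.span F (cartanGens F T n)) : ⁅((h : vf0 F T n) : Vect F n), D⁆ = 0 := by
  rw [eq_diag_of_mem_cartanGens hD, diag, vect_lie_sum]
  refine Finset.sum_eq_zero fun a _ => ?_
  rw [vect_lie_smul, cartan_lie_xd, sub_self, LinearMap.zero_apply, zero_smul, smul_zero]

/-- Elements of `g_0` which are weight vectors for `h` and lie in `h`, `n⁺`, or have a negative
eigenvalue under `ρ`. -/
def rootVectors (F : Type u) [Field F] (T : VFType) (n : ℕ) : Set (Vect F n) :=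
  {D | D ∈ vf0 F T n ∧
    (D ∈ Submodule.span F (cartanGens F T n) ∨ D ∈ Submodule.span F (nPlusGens F T n) ∨
      ∃ k : ℕ, 0 < k ∧ ⁅rho F T n, D⁆ = -(k : F) • D) ∧
    ∃ χ : Weight F T n, ∀ h : cartan F T n, ⁅((h : vf0 F T n) : Vect F n), D⁆ = χ h • D}

theorem cartan_mem_rootVectors {T : VFType} (hT : T = .H → Even n) {D : Vect F n}
    (hD : D ∈ Submodule.span F (cartanGens F T n)) : D ∈ rootVectors F T n :=
  ⟨(Submodule.span_le (p := (vf0 F T n).toSubmodule)).mpr (fun _ h => cartanGens_subset T hT h) hD,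
    Or.inl hD, 0, fun h => by rw [cartan_lie_cartan h hD, LinearMap.zero_apply, zero_smul]⟩

theorem neg_eigen {T : VFType} {D : Vect F n} {z : ℤ} (hz : z < 0)
    (h : ⁅rho F T n, D⁆ = (z : F) • D) : ∃ k : ℕ, 0 < k ∧ ⁅rho F T n, D⁆ = -(k : F) • D := by
  obtain ⟨k, hk⟩ := Int.eq_ofNat_of_zero_le (neg_nonneg.mpr hz.le)
  refine ⟨k, by omega, ?_⟩
  rw [h, show z = -(k : ℤ) by omega]
  simp

theorem xd_mem_rootVectors_W {a b : Fin n} (hab : a ≠ b) :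
    (xd a b : Vect F n) ∈ rootVectors F .W n := by
  refine ⟨xd_mem_vf0_W _ _, Or.inr ?_, _, fun h => cartan_lie_xd h a b⟩
  rcases lt_or_gt_of_ne hab with h | h
  · exact Or.inl (Submodule.subset_span ⟨a, b, h, rfl⟩)
  · exact Or.inr (neg_eigen (by simp only [rhoWt]; omega) (rho_lie_xd _ _ _))

theorem xd_mem_rootVectors_S {a b : Fin n} (hab : a ≠ b) :
    (xd a b : Vect F n) ∈ rootVectors F .S n := by
  refine ⟨xd_mem_vf0_S hab, Or.inr ?_, _, fun h => cartan_lie_xd h a b⟩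
  rcases lt_or_gt_of_ne hab with h | h
  · exact Or.inl (Submodule.subset_span ⟨a, b, h, rfl⟩)
  · exact Or.inr (neg_eigen (by simp only [rhoWt]; omega) (rho_lie_xd _ _ _))

/-- `hxd a b` has weight `ε_a + ε_b`, where passing to the partner index changes the sign of `ε`.
Two indices in the first half give a positive root and two in the second a negative one. The mixed
case `ε_i - ε_j` depends on the order of `i` and `j` and falls in the Cartan subalgebra when they
agree. -/
theorem hxd_mem_rootVectors (hn : Even n) (a b : Fin n) :
    (hxd a b : Vect F n) ∈ rootVectors F .H n := by
  refine ⟨hxd_mem_vf0 hn _ _, ?_, _, fun h => cartan_lie_hxd hn h a b⟩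
  have hlow : rhoWt .H a + rhoWt .H b < 0 → ∃ k : ℕ, 0 < k ∧
      ⁅rho F .H n, (hxd a b : Vect F n)⁆ = -(k : F) • (hxd a b : Vect F n) := fun h =>
    neg_eigen h (rho_lie_hxd hn _ _)
  have mixed : ∀ i j : Fin n, sg i = 1 → sg j = 1 →
      ((hxd i (cj j) : Vect F n) ∈ Submodule.span F (cartanGens F .H n) ∨
      (hxd i (cj j) : Vect F n) ∈ Submodule.span F (nPlusGens F .H n)) ∨
      rhoWt .H i + rhoWt .H (cj j) < 0 := by
    intro i j hi hj
    have hi' := (lt_iff_of_sg i).mp hi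
    have hj' := (lt_iff_of_sg j).mp hj
    rcases lt_trichotomy i j with h | rfl | h
    · left; right
      rw [← neg_neg (hxd i (cj j) : Vect F n), ← smul_hxd hn hi hj]
      exact neg_mem (Submodule.subset_span ⟨i, cj i, j, cj j,
        (val_eq_add_iff hn _ _).mpr ⟨hi, rfl⟩, (val_eq_add_iff hn _ _).mpr ⟨hj, rfl⟩,
        Or.inl ⟨h, rfl⟩⟩)
    · left; left
      rw [hxd_self_cj hn]
      exact Submodule.smul_mem _ _ (xd_sub_xd_mem_span_H hn i)
    · right
      rw [rhoWt_cj hn]; simp only [rhoWt, hi', hj', if_true]; omega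
  have hcj : ∀ c : Fin n, sg c = -1 → ∃ j, sg j = 1 ∧ c = cj j := fun c hc =>
    ⟨cj c, by rw [sg_cj hn, hc]; rfl, (cj_cj hn c).symm⟩
  rcases sg_eq a with ha | ha <;> rcases sg_eq b with hb | hb
  · right; left
    rcases le_total a b with h | h
    · exact Submodule.subset_span ⟨a, cj a, b, cj b, (val_eq_add_iff hn _ _).mpr ⟨ha, rfl⟩,
        (val_eq_add_iff hn _ _).mpr ⟨hb, rfl⟩, Or.inr ⟨h, (xd_add_xd_eq_hxd ha hb).symm⟩⟩
    · rw [hxd_comm]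
      exact Submodule.subset_span ⟨b, cj b, a, cj a, (val_eq_add_iff hn _ _).mpr ⟨hb, rfl⟩,
        (val_eq_add_iff hn _ _).mpr ⟨ha, rfl⟩, Or.inr ⟨h, (xd_add_xd_eq_hxd hb ha).symm⟩⟩
  · obtain ⟨j, hj, rfl⟩ := hcj b hb
    rcases mixed a j ha hj with (h | h) | h
    exacts [Or.inl h, Or.inr (Or.inl h), Or.inr (Or.inr (hlow h))]
  · obtain ⟨j, hj, rfl⟩ := hcj a ha
    rw [add_comm] at hlow
    rw [hxd_comm] at hlow ⊢
    rcases mixed b j hb hj with (h | h) | h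
    exacts [Or.inl h, Or.inr (Or.inl h), Or.inr (Or.inr (hlow h))]
  · right; right
    apply hlow
    have hna : ¬ (a : ℕ) < n / 2 := by rw [← lt_iff_of_sg, ha]; decide
    have hnb : ¬ (b : ℕ) < n / 2 := by rw [← lt_iff_of_sg, hb]; decide
    simp only [rhoWt, hna, hnb, if_false]
    omega

theorem mem_span_rootVectors [CharZero F] {T : VFType} (hT : T = .H → Even n) {D : Vect F n}
    (hD : D ∈ vf0 F T n) : D ∈ Submodule.span F (rootVectors F T n) := by
  match T, hD with
  | .W, hD =>
    rw [eq_sum_cf hD.2]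
    refine sum_mem fun a _ => sum_mem fun b _ =>
      Submodule.smul_mem _ _ (Submodule.subset_span ?_)
    by_cases h : a = b
    · subst h
      exact cartan_mem_rootVectors hT (Submodule.subset_span ⟨a, rfl⟩)
    · exact xd_mem_rootVectors_W h
  | .S, hD =>
    rcases Nat.eq_zero_or_pos n with rfl | hn
    · rw [eq_sum_cf hD.2]; simp
    have hdiv : ∑ a, cf a a D = 0 := by
      have h1 : divergence D = 0 := hD.1
      have h2 := congrArg (MvPolynomial.coeff 0) h1
      rw [divergence, MvPolynomial.coeff_sum, MvPolynomial.coeff_zero] at h2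
      exact h2
    -- The trace vanishes, so subtracting the same diagonal field from every diagonal term changes
    -- nothing and leaves differences in the Cartan subalgebra.
    have e : D = ∑ a, ∑ b, cf a b D • (xd a b - if a = b then
        (xd ⟨0, hn⟩ ⟨0, hn⟩ : Vect F n) else 0) := by
      simp only [smul_sub, Finset.sum_sub_distrib, smul_ite, smul_zero, Finset.sum_ite_eq,
        Finset.mem_univ, if_true]
      rw [← Finset.sum_smul, hdiv, zero_smul, sub_zero]
      exact eq_sum_cf hD.2
    rw [e]
    refine sum_mem fun a _ => sum_mem fun b _ =>
      Submodule.smul_mem _ _ (Submodule.subset_span ?_)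
    split_ifs with h
    · subst h
      exact cartan_mem_rootVectors hT (xd_sub_xd_mem_span_S _ _)
    · rw [sub_zero]; exact xd_mem_rootVectors_S h
  | .H, hD =>
    have h2 := two_smul_eq_sum_hxd (hT rfl) hD
    have : D = (2⁻¹ : F) • ((2 : F) • D) := by
      rw [smul_smul, inv_mul_cancel₀ two_ne_zero, one_smul]
    rw [this, h2]
    exact Submodule.smul_mem _ _ (sum_mem fun a _ => sum_mem fun b _ =>
      Submodule.smul_mem _ _ (Submodule.subset_span (hxd_mem_rootVectors (hT rfl) a b)))

/-- The Cartan and root data are spans inside `W(n)`, whereas `IsTriangular` concerns spans inside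
`g_0`; this passes from one to the other. -/
theorem mem_span_preimage {T : VFType} {S : Set (Vect F n)} (hS : ∀ D ∈ S, D ∈ vf0 F T n)
    {D : Vect F n} (hD : D ∈ Submodule.span F S) : ∃ h : D ∈ vf0 F T n,
      (⟨D, h⟩ : vf0 F T n) ∈ Submodule.span F {x : vf0 F T n | (x : Vect F n) ∈ S} := by
  have h1 : (incl0 F T n) '' (incl0 F T n ⁻¹' S) = S :=
    Set.image_preimage_eq_of_subset fun D hD => ⟨⟨D, hS D hD⟩, rfl⟩
  rw [← h1, ← Submodule.map_span] at hD
  obtain ⟨x, hx, rfl⟩ := hD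
  exact ⟨x.2, hx⟩

variable [CharZero F] {T : VFType}

theorem rho_mem_vf0 (hT : T = .H → Even n) : rho F T n ∈ vf0 F T n :=
  (cartan_mem_rootVectors hT (rho_mem_span T hT)).1

/-- The grading element as an element of `g_0`. -/
def rho0 (hT : T = .H → Even n) : vf0 F T n := ⟨rho F T n, rho_mem_vf0 hT⟩

theorem isTriangular (hT : T = .H → Even n) : IsTriangular (cartan F T n) (nPlus F T n) (rho0 hT) where
  mem := rho_mem_span T hT
  comm x hx y hy := Subtype.ext (cartan_lie_cartan ⟨x, hx⟩ hy)
  pos x hx := by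
    obtain ⟨_, h⟩ := mem_span_preimage (T := T) (fun D hD => (nPlusGens_spec T hT hD).1) hx
    refine Submodule.span_mono ?_ h
    intro y hy
    obtain ⟨_, k, hk, hk'⟩ := nPlusGens_spec T hT hy
    exact ⟨k, hk, Subtype.ext hk'⟩
  span x _ := by
    obtain ⟨_, h⟩ := mem_span_preimage (T := T) (fun D hD => hD.1) (mem_span_rootVectors hT x.2)
    refine Submodule.span_le.mpr ?_ h
    rintro y ⟨-, h | h | ⟨k, hk, hk'⟩, -⟩
    · exact Submodule.mem_sup_left (Submodule.mem_sup_left h)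
    · exact Submodule.mem_sup_left (Submodule.mem_sup_right h)
    · exact Submodule.mem_sup_right (Submodule.subset_span ⟨k, hk, Subtype.ext hk'⟩)

theorem top_le_span_weight (hT : T = .H → Even n) : (⊤ : Submodule F (vf0 F T n)) ≤ Submodule.span F
    {x | ∃ χ : Weight F T n, ∀ y : cartan F T n, ⁅(y : vf0 F T n), x⁆ = χ y • x} := by
  intro x _
  obtain ⟨_, h⟩ := mem_span_preimage (T := T) (fun D hD => hD.1) (mem_span_rootVectors hT x.2)
  refine Submodule.span_mono ?_ h
  rintro y ⟨-, -, χ, hχ⟩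
  exact ⟨χ, fun h => Subtype.ext (hχ h)⟩

end Triangular

/-! ### Dominance of highest weights -/

section Dominance

variable {F : Type u} [Field F] {n : ℕ}

theorem sl2_xd {i j : Fin n} (hij : i ≠ j) :
    ⁅(xd i j : Vect F n), (xd j i : Vect F n)⁆ = xd i i - xd j j ∧
    ⁅(xd i i - xd j j : Vect F n), (xd i j : Vect F n)⁆ = (2 : F) • (xd i j : Vect F n) ∧
    ⁅(xd i i - xd j j : Vect F n), (xd j i : Vect F n)⁆ = -((2 : F) • (xd j i : Vect F n)) := by
  refine ⟨?_, ?_, ?_⟩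
  · simp [xd_lie]
  · simp [vect_sub_lie, xd_lie, hij.symm, two_smul]
  · simp [vect_sub_lie, xd_lie, hij, two_smul]
    abel

theorem sl2_sub {i j k l : Fin n} (hij : i ≠ j) (hik : i ≠ k) (hil : i ≠ l) (hjk : j ≠ k)
    (hjl : j ≠ l) (hkl : k ≠ l) :
    ⁅(xd i j - xd l k : Vect F n), (xd j i - xd k l : Vect F n)⁆ =
      (xd i i - xd k k) - (xd j j - xd l l) ∧
    ⁅((xd i i - xd k k) - (xd j j - xd l l) : Vect F n), (xd i j - xd l k : Vect F n)⁆ =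
      (2 : F) • (xd i j - xd l k : Vect F n) ∧
    ⁅((xd i i - xd k k) - (xd j j - xd l l) : Vect F n), (xd j i - xd k l : Vect F n)⁆ =
      -((2 : F) • (xd j i - xd k l : Vect F n)) := by
  refine ⟨?_, ?_, ?_⟩ <;>
  · simp only [vect_sub_lie, vect_lie_sub, xd_lie, hij, hij.symm, hik, hik.symm, hil, hil.symm,
      hjk, hjk.symm, hjl, hjl.symm, hkl, hkl.symm, if_true, if_false, two_smul]
    abel

theorem sl2_add {i j k l : Fin n} (hij : i ≠ j) (hik : i ≠ k) (hil : i ≠ l) (hjk : j ≠ k)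
    (hjl : j ≠ l) (hkl : k ≠ l) :
    ⁅(xd i l + xd j k : Vect F n), (xd l i + xd k j : Vect F n)⁆ =
      (xd i i - xd k k) + (xd j j - xd l l) ∧
    ⁅((xd i i - xd k k) + (xd j j - xd l l) : Vect F n), (xd i l + xd j k : Vect F n)⁆ =
      (2 : F) • (xd i l + xd j k : Vect F n) ∧
    ⁅((xd i i - xd k k) + (xd j j - xd l l) : Vect F n), (xd l i + xd k j : Vect F n)⁆ =
      -((2 : F) • (xd l i + xd k j : Vect F n)) := by
  refine ⟨?_, ?_, ?_⟩ <;>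
  · simp only [vect_sub_lie, vect_lie_add, vect_add_lie, xd_lie, hij, hij.symm, hik, hik.symm,
      hil, hil.symm, hjk, hjk.symm, hjl, hjl.symm, hkl, hkl.symm, if_true, if_false, two_smul]
    abel

/-- Every positive coroot belongs to an `sl₂`-triple. -/
theorem exists_sl2 [CharZero F] {T : VFType} (hT : T = .H → Even n) {h : Vect F n}
    (hh : h ∈ posCoroots F T n) : ∃ e f : Vect F n, e ∈ vf0 F T n ∧ f ∈ vf0 F T n ∧
      e ∈ Submodule.span F (nPlusGens F T n) ∧ ⁅e, f⁆ = h ∧ ⁅h, e⁆ = (2 : F) • e ∧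
      ⁅h, f⁆ = -((2 : F) • f) := by
  match T, hh with
  | .W, ⟨i, j, hij, hi⟩ =>
    rw [hi]
    exact ⟨xd i j, xd j i, xd_mem_vf0_W _ _, xd_mem_vf0_W _ _,
      Submodule.subset_span ⟨i, j, hij, rfl⟩, sl2_xd hij.ne⟩
  | .S, ⟨i, j, hij, hi⟩ =>
    rw [hi]
    exact ⟨xd i j, xd j i, xd_mem_vf0_S hij.ne, xd_mem_vf0_S hij.ne',
      Submodule.subset_span ⟨i, j, hij, rfl⟩, sl2_xd hij.ne⟩
  | .H, ⟨i, i', j, j', hi, hj, h⟩ =>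
    have hn := hT rfl
    have hn2 : n % 2 = 0 := Nat.even_iff.mp hn
    have memP : ∀ D ∈ nPlusGens F .H n, D ∈ vf0 F .H n := fun D hD => (nPlusGens_spec .H hT hD).1
    have hi'lt := i'.2
    have hj'lt := j'.2
    have hij' : ∀ {a b : Fin n}, (a : ℕ) ≠ b → a ≠ b := fun h h' => h (congrArg _ h')
    have h1 : i ≠ i' := hij' (by omega)
    obtain ⟨si, ei⟩ := (val_eq_add_iff hn _ _).mp hi
    obtain ⟨sj, ej⟩ := (val_eq_add_iff hn _ _).mp hj
    rcases h with ⟨hlt, h⟩ | ⟨hlt, h⟩ | h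
    · have h2 : i ≠ j := hlt.ne
      have h3 : i ≠ j' := hij' (by omega)
      have h4 : j ≠ i' := hij' (by omega)
      have h5 : j ≠ j' := hij' (by omega)
      have h6 : i' ≠ j' := hij' (by omega)
      have hmem : (xd i j - xd j' i' : Vect F n) ∈ nPlusGens F .H n :=
        ⟨i, i', j, j', hi, hj, Or.inl ⟨hlt, rfl⟩⟩
      rw [h]
      refine ⟨_, _, memP _ hmem, ?_, Submodule.subset_span hmem, sl2_sub h2 h1 h3 h4 h5 h6⟩
      rw [ei, ej, smul_hxd hn sj si]
      exact neg_mem (hxd_mem_vf0 hn _ _)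
    · have h2 : i ≠ j := hlt.ne
      have h3 : i ≠ j' := hij' (by omega)
      have h4 : j ≠ i' := hij' (by omega)
      have h5 : j ≠ j' := hij' (by omega)
      have h6 : i' ≠ j' := hij' (by omega)
      have hmem : (xd i j' + xd j i' : Vect F n) ∈ nPlusGens F .H n :=
        ⟨i, i', j, j', hi, hj, Or.inr ⟨hlt.le, rfl⟩⟩
      rw [h]
      refine ⟨_, _, memP _ hmem, ?_, Submodule.subset_span hmem, sl2_add h2 h1 h3 h4 h5 h6⟩
      have : (xd j' i + xd i' j : Vect F n) = -hxd (cj j) (cj i) := by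
        rw [hxd, cj_cj hn, cj_cj hn, sg_cj hn, sg_cj hn, si, sj, ei, ej]
        push_cast; module
      rw [this]
      exact neg_mem (hxd_mem_vf0 hn _ _)
    -- For a long root the listed generator with `i = j` is twice `x_i ∂_{i'}`, so half of it
    -- completes the triple.
    · have half : ∀ D : Vect F n, D = (2⁻¹ : F) • (D + D) := fun D => by
        rw [← two_smul F, smul_smul, inv_mul_cancel₀ two_ne_zero, one_smul]
      have hmem : (xd i i' + xd i i' : Vect F n) ∈ nPlusGens F .H n :=
        ⟨i, i', i, i', hi, hi, Or.inr ⟨le_rfl, rfl⟩⟩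
      rw [h]
      refine ⟨xd i i', xd i' i, ?_, ?_, ?_, sl2_xd h1⟩
      · rw [half (xd i i')]
        exact Submodule.smul_mem (vf0 F .H n).toSubmodule _ (memP _ hmem)
      · have : (xd i' i + xd i' i : Vect F n) = -hxd (cj i) (cj i) := by
          rw [hxd, cj_cj hn, sg_cj hn, si, ei]
          push_cast; module
        rw [half (xd i' i), this]
        exact Submodule.smul_mem (vf0 F .H n).toSubmodule _ (neg_mem (hxd_mem_vf0 hn _ _))
      · rw [half (xd i i')]
        exact Submodule.smul_mem _ _ (Submodule.subset_span hmem)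

attribute [local instance] LieRing.ofAssociativeRing

theorem IsHighestWeight.isDominantIntegral [CharZero F] {T : VFType} (hT : T = .H → Even n)
    {V : Type w} [AddCommGroup V] [Module F V] [FiniteDimensional F V]
    {ξ : vf0 F T n →ₗ⁅F⁆ Module.End F V} {lam : Weight F T n} {v : V}
    (hv : IsHighestWeight ξ (LieCartan.cartan F T n) (nPlus F T n) lam v) (hv0 : v ≠ 0) :
    lam.IsDominantIntegral := by
  intro h hh
  obtain ⟨e, f, he, hf, heP, h1, h2, h3⟩ := exists_sl2 hT hh
  exact hv.exists_nat hv0 h (e := ⟨e, he⟩) (f := ⟨f, hf⟩) heP (Subtype.ext h1) (Subtype.ext h2)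
    (Subtype.ext h3)

end Dominance

/-! ### Highest weight vectors for dominant integral weights -/

section Columns

variable {F : Type u} [Field F] {n : ℕ}

/-- The vector field on the space of `n × n`-matrices that acts as `D` on each column. -/
def colDer (D : Vect F n) :
    Derivation F (MvPolynomial (Fin n × Fin n) F) (MvPolynomial (Fin n × Fin n) F) :=
  MvPolynomial.mkDerivation F fun p =>
    MvPolynomial.rename (fun b => (b, p.2)) (D (MvPolynomial.X p.1))

theorem colDer_X (D : Vect F n) (a k : Fin n) : colDer D (MvPolynomial.X (a, k)) =
    MvPolynomial.rename (fun b => (b, k)) (D (MvPolynomial.X a)) := by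
  simp [colDer]

theorem colDer_rename (D : Vect F n) (k : Fin n) (p : Poly F n) :
    colDer D (MvPolynomial.rename (fun b => (b, k)) p) =
      MvPolynomial.rename (fun b => (b, k)) (D p) := by
  induction p using MvPolynomial.induction_on with
  | C a => simp
  | add p q hp hq => simp [hp, hq]
  | mul_X p i hp => simp [hp, colDer_X]

theorem colDer_add (D E : Vect F n) : colDer (D + E) = colDer D + colDer E := by
  apply MvPolynomial.derivation_ext
  rintro ⟨a, k⟩
  simp [colDer_X]

theorem colDer_smul (c : F) (D : Vect F n) : colDer (c • D) = c • colDer D := by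
  apply MvPolynomial.derivation_ext
  rintro ⟨a, k⟩
  simp [colDer_X]

theorem colDer_lie (D E : Vect F n) : colDer ⁅D, E⁆ = ⁅colDer D, colDer E⁆ := by
  apply MvPolynomial.derivation_ext
  rintro ⟨a, k⟩
  simp [colDer_X, Derivation.commutator_apply, colDer_rename]

theorem colDer_xd_X (i j a k : Fin n) : colDer (xd i j : Vect F n) (MvPolynomial.X (a, k)) =
    if j = a then MvPolynomial.X (i, k) else 0 := by
  rw [colDer_X, xd_apply, pd_X]
  split_ifs <;> simp

theorem derivation_eq_sum_pderiv {σ : Type*} [Fintype σ]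
    (D : Derivation F (MvPolynomial σ F) (MvPolynomial σ F)) (p : MvPolynomial σ F) :
    D p = ∑ i, D (MvPolynomial.X i) * MvPolynomial.pderiv i p := by
  classical
  induction p using MvPolynomial.induction_on with
  | C a => simp
  | add p q hp hq => simp [hp, hq, mul_add, Finset.sum_add_distrib]
  | mul_X p i hp =>
    simp only [Derivation.leibniz, smul_eq_mul, hp, mul_add, Finset.sum_add_distrib,
      MvPolynomial.pderiv_X, Pi.single_apply, mul_ite, mul_one, mul_zero, Finset.sum_ite_eq,
      Finset.mem_univ, if_true, Finset.mul_sum]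
    congr 1
    · ring
    · exact Finset.sum_congr rfl fun j _ => by ring

theorem derivation_isHomogeneous {σ : Type*} [Fintype σ]
    {D : Derivation F (MvPolynomial σ F) (MvPolynomial σ F)} {k : ℕ}
    (hD : ∀ i, (D (MvPolynomial.X i)).IsHomogeneous k) {p : MvPolynomial σ F} {m : ℕ}
    (hp : p.IsHomogeneous m) : (D p).IsHomogeneous (k + (m - 1)) := by
  rw [derivation_eq_sum_pderiv]
  exact MvPolynomial.IsHomogeneous.sum _ _ _ fun i _ => (hD i).mul hp.pderiv

theorem derivation_eq_zero_of_isHomogeneous_zero {σ : Type*}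
    (D : Derivation F (MvPolynomial σ F) (MvPolynomial σ F)) {p : MvPolynomial σ F}
    (hp : p.IsHomogeneous 0) : D p = 0 := by
  rw [MvPolynomial.totalDegree_eq_zero_iff_eq_C.mp (Nat.le_zero.mp hp.totalDegree_le),
    MvPolynomial.derivation_C]

theorem colDer_isHomogeneous {D : Vect F n} (hD : D ∈ vectPart F n 1)
    {p : MvPolynomial (Fin n × Fin n) F} {m : ℕ} (hp : p.IsHomogeneous m) :
    (colDer D p).IsHomogeneous m := by
  rcases Nat.eq_zero_or_pos m with rfl | hm
  · rw [derivation_eq_zero_of_isHomogeneous_zero _ hp]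
    exact MvPolynomial.isHomogeneous_zero _ _ _
  · have h := derivation_isHomogeneous (D := colDer D) (k := 1) (fun p => by
      obtain ⟨a, k⟩ := p
      rw [colDer_X]
      exact (hD a).rename_isHomogeneous) hp
    rwa [show 1 + (m - 1) = m by omega] at h

theorem derivation_prod {A ι : Type*} [CommRing A] [Algebra F A] [DecidableEq ι]
    (D : Derivation F A A) (s : Finset ι) (f : ι → A) :
    D (∏ i ∈ s, f i) = ∑ i ∈ s, D (f i) * ∏ j ∈ s.erase i, f j := by
  induction s using Finset.induction_on with
  | empty => simp
  | insert a s ha ih =>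
    rw [Finset.prod_insert ha, D.leibniz, ih, Finset.sum_insert ha, Finset.erase_insert ha,
      smul_eq_mul, smul_eq_mul, Finset.mul_sum, add_comm, mul_comm (∏ i ∈ s, f i)]
    congr 1
    refine Finset.sum_congr rfl fun i hi => ?_
    have hai : a ≠ i := fun h => ha (h ▸ hi)
    rw [Finset.erase_insert_of_ne hai, Finset.prod_insert (fun h => ha (Finset.mem_of_mem_erase h))]
    ring

/-- The determinant is multilinear in the columns, so the Leibniz rule differentiates one column at
a time. -/
theorem derivation_det {A ι : Type*} [CommRing A] [Algebra F A] [DecidableEq ι] [Fintype ι]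
    (D : Derivation F A A) (M : Matrix ι ι A) :
    D M.det = ∑ k, (M.updateCol k fun i => D (M i k)).det := by
  simp only [Matrix.det_apply, map_sum]
  rw [Finset.sum_comm]
  refine Finset.sum_congr rfl fun σ _ => ?_
  rw [← Finset.smul_sum]
  have : ∀ x : A, D (Equiv.Perm.sign σ • x) = Equiv.Perm.sign σ • D x := fun x => by
    rcases Int.units_eq_one_or (Equiv.Perm.sign σ) with h | h <;> simp [h]
  rw [this, derivation_prod]
  congr 1
  refine Finset.sum_congr rfl fun k _ => ?_
  rw [← Finset.mul_prod_erase _ _ (Finset.mem_univ k), Matrix.updateCol_self]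
  congr 1
  refine Finset.prod_congr rfl fun i hi => ?_
  rw [Matrix.updateCol_ne (Finset.ne_of_mem_erase hi)]

/-- The matrix of the coordinates with both indices in `S`. -/
def minorMat (F : Type u) [Field F] (S : Finset (Fin n)) :
    Matrix S S (MvPolynomial (Fin n × Fin n) F) :=
  Matrix.of fun k a => MvPolynomial.X (a.1, k.1)

theorem det_minorMat_ne_zero (S : Finset (Fin n)) : (minorMat F S).det ≠ 0 := by
  have h : minorMat F S = (MvPolynomial.rename (R := F)
      fun p : S × S => ((p.2 : Fin n), (p.1 : Fin n))).mapMatrix (Matrix.mvPolynomialX S S F) := by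
    ext1 k a; simp [minorMat]
  rw [h, ← AlgHom.map_det]
  intro h0
  refine Matrix.det_mvPolynomialX_ne_zero S F (MvPolynomial.rename_injective _ ?_
    (h0.trans (map_zero _).symm))
  rintro ⟨a, b⟩ ⟨c, d⟩ h
  simp only [Prod.mk.injEq] at h
  exact Prod.ext (Subtype.ext h.2) (Subtype.ext h.1)

theorem colDer_xd_minor_of_notMem {S : Finset (Fin n)} (i : Fin n) {j : Fin n} (hj : j ∉ S) :
    colDer (xd i j : Vect F n) (minorMat F S).det = 0 := by
  rw [derivation_det]
  refine Finset.sum_eq_zero fun a _ => Matrix.det_eq_zero_of_column_eq_zero a fun k => ?_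
  have : j ≠ a := fun h => hj (h ▸ a.2)
  simp [minorMat, colDer_xd_X, this]

/-- The operator replaces column `j` of the minor by column `i`: nothing changes if they coincide,
and otherwise two columns are equal. -/
theorem colDer_xd_minor_of_mem {S : Finset (Fin n)} {i j : Fin n} (hi : i ∈ S) (hj : j ∈ S) :
    colDer (xd i j : Vect F n) (minorMat F S).det =
      if i = j then (minorMat F S).det else 0 := by
  have key : colDer (xd i j : Vect F n) (minorMat F S).det =
      ((minorMat F S).updateCol ⟨j, hj⟩ fun k => (minorMat F S) k ⟨i, hi⟩).det := by
    rw [derivation_det, Finset.sum_eq_single ⟨j, hj⟩]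
    · congr 2
      ext1 k
      simp [minorMat, colDer_xd_X]
    · intro a _ ha
      refine Matrix.det_eq_zero_of_column_eq_zero a fun k => ?_
      have : j ≠ a := fun h => ha (Subtype.ext h.symm)
      simp [minorMat, colDer_xd_X, this]
    · simp
  rw [key]
  split_ifs with h
  · subst h
    congr 1
    exact Matrix.updateCol_eq_self _ _
  · exact Matrix.det_updateCol_eq_zero fun h' => h (congrArg Subtype.val h')

/-- A product of minors with weight `b`. -/
def hwPoly (F : Type u) [Field F] (b : Fin n → ℕ) : MvPolynomial (Fin n × Fin n) F :=
  ∏ t ∈ Finset.range (Finset.univ.sup b), (minorMat F (Finset.univ.filter fun a => t < b a)).det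

theorem hwPoly_ne_zero (b : Fin n → ℕ) : hwPoly F b ≠ 0 :=
  Finset.prod_ne_zero_iff.mpr fun _ _ => det_minorMat_ne_zero _

theorem derivation_prod_eigen {A ι : Type*} [CommRing A] [Algebra F A] (D : Derivation F A A)
    (s : Finset ι) (f c : ι → A) (h : ∀ i ∈ s, D (f i) = c i * f i) :
    D (∏ i ∈ s, f i) = (∑ i ∈ s, c i) * ∏ i ∈ s, f i := by
  classical
  rw [derivation_prod, Finset.sum_mul]
  refine Finset.sum_congr rfl fun i hi => ?_
  rw [h i hi, mul_assoc, Finset.mul_prod_erase _ _ hi]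

/-- For decreasing `b` the index sets `{a | t < b a}` are initial segments. One containing `j` also
contains `i` and produces two equal columns; one not containing `j` gives a minor without these
variables. -/
theorem colDer_xd_hwPoly_of_lt {b : Fin n → ℕ} (hb : Antitone b) {i j : Fin n} (hij : i < j) :
    colDer (xd i j : Vect F n) (hwPoly F b) = 0 := by
  rw [hwPoly, derivation_prod_eigen _ _ _ 0]
  · simp
  · intro t _
    rw [Pi.zero_apply, zero_mul]
    by_cases hj : t < b j
    · rw [colDer_xd_minor_of_mem (by simpa using hj.trans_le (hb hij.le)) (by simpa using hj),
        if_neg hij.ne]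
    · exact colDer_xd_minor_of_notMem _ (by simpa using hj)

theorem colDer_xd_hwPoly_of_eq_zero {b : Fin n → ℕ} (i : Fin n) {j : Fin n} (hj : b j = 0) :
    colDer (xd i j : Vect F n) (hwPoly F b) = 0 := by
  rw [hwPoly, derivation_prod_eigen _ _ _ 0]
  · simp
  · intro t _
    rw [Pi.zero_apply, zero_mul]
    exact colDer_xd_minor_of_notMem _ (by simp [hj])

/-- The index `i` belongs to exactly `b i` of the sets, and each such minor is homogeneous of degree
1 in the variables of that index. -/
theorem colDer_xd_self_hwPoly (b : Fin n → ℕ) (i : Fin n) :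
    colDer (xd i i : Vect F n) (hwPoly F b) = (b i : F) • hwPoly F b := by
  rw [hwPoly, derivation_prod_eigen _ _ _ fun t => if t < b i then 1 else 0]
  · rw [Finset.sum_boole, ← hwPoly, MvPolynomial.smul_eq_C_mul, map_natCast]
    congr 2
    have : Finset.filter (fun t => t < b i) (Finset.range (Finset.univ.sup b)) =
        Finset.range (b i) := by
      ext t
      have := Finset.le_sup (f := b) (Finset.mem_univ i)
      simp only [Finset.mem_filter, Finset.mem_range]; omega
    rw [this, Finset.card_range]
  · intro t _
    split_ifs with h
    · rw [colDer_xd_minor_of_mem (by simpa using h) (by simpa using h), if_pos rfl, one_mul]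
    · rw [colDer_xd_minor_of_notMem _ (by simpa using h), zero_mul]

end Columns

/-! ### Realising dominant weights by matrix polynomials. -/

section DominantModules

attribute [local instance] LieRing.ofAssociativeRing

variable {F : Type u} [Field F] {n : ℕ}

theorem divergence_eq_C {D : Vect F n} (hD : D ∈ vectPart F n 1) :
    divergence D = MvPolynomial.C (∑ a, cf a a D) := by
  rw [divergence, map_sum]
  exact Finset.sum_congr rfl fun a _ => pd_eq_C_cf hD a a

/-- Linear fields have constant divergence, so the divergence of a bracket vanishes. Hence adding a
multiple of the trace to the action still gives a representation. -/
theorem sum_cf_lie {T : VFType} (x y : vf0 F T n) :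
    ∑ a, cf a a ((⁅x, y⁆ : vf0 F T n) : Vect F n) = 0 := by
  have h := divergence_lie (x : Vect F n) (y : Vect F n)
  rw [divergence_eq_C x.2.2, divergence_eq_C y.2.2] at h
  have h2 := divergence_eq_C (⁅x, y⁆ : vf0 F T n).2.2
  rw [LieSubalgebra.coe_bracket, h] at h2
  simp only [MvPolynomial.derivation_C, sub_zero] at h2
  exact MvPolynomial.C_injective _ _ (h2.symm.trans (map_zero _).symm)

/-- The action of vector fields on the coordinate ring of the space of matrices, twisted by a
multiple of the trace. -/
def colOp (c : F) : Vect F n →ₗ[F] Module.End F (MvPolynomial (Fin n × Fin n) F) where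
  toFun D := (colDer D : _ →ₗ[F] _) + (c * ∑ a, cf a a D) • 1
  map_add' D E := by
    simp only [colDer_add, map_add, Finset.sum_add_distrib, mul_add, add_smul,
      Derivation.coe_add_linearMap]
    abel
  map_smul' a D := by
    simp only [colDer_smul, map_smul, smul_eq_mul, ← Finset.mul_sum, RingHom.id_apply, smul_add,
      Derivation.coe_smul_linearMap, smul_smul, mul_left_comm]

theorem colOp_apply (c : F) (D : Vect F n) (p : MvPolynomial (Fin n × Fin n) F) :
    colOp c D p = colDer D p + (c * ∑ a, cf a a D) • p := rfl

/-- The twisted action as a representation of `g_0`. -/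
def colRep (T : VFType) (c : F) :
    vf0 F T n →ₗ⁅F⁆ Module.End F (MvPolynomial (Fin n × Fin n) F) where
  __ := colOp c ∘ₗ incl0 F T n
  map_lie' {x y} := by
    refine LinearMap.ext fun p => ?_
    have e : ∀ z : vf0 F T n, (colOp c ∘ₗ incl0 F T n) z p = colOp c (z : Vect F n) p :=
      fun _ => rfl
    show colOp c ((⁅x, y⁆ : vf0 F T n) : Vect F n) p =
      colOp c (x : Vect F n) (colOp c (y : Vect F n) p) -
      colOp c (y : Vect F n) (colOp c (x : Vect F n) p)
    rw [colOp_apply, sum_cf_lie, LieSubalgebra.coe_bracket, colDer_lie,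
      Derivation.commutator_apply]
    simp only [colOp_apply, map_add, Derivation.map_smul, smul_smul, mul_zero, zero_smul,
      add_zero, mul_comm]
    abel

theorem colRep_apply (T : VFType) (c : F) (x : vf0 F T n)
    (p : MvPolynomial (Fin n × Fin n) F) :
    colRep T c x p = colOp c (x : Vect F n) p := rfl

theorem homogeneousSubmodule_finiteDimensional (F : Type u) [Field F] (σ : Type*) [Finite σ]
    (m : ℕ) : FiniteDimensional F (MvPolynomial.homogeneousSubmodule σ F m) :=
  Module.Finite.iff_fg.mpr (MvPolynomial.homogeneousSubmodule_fg σ F m)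

/-- Every matrix polynomial lies in a finite-dimensional stable subspace. -/
theorem exists_finiteDimensional_stable (T : VFType) (c : F)
    (p : MvPolynomial (Fin n × Fin n) F) :
    ∃ W : Submodule F (MvPolynomial (Fin n × Fin n) F),
      FiniteDimensional F W ∧ IsStable (colRep T c) W ∧ p ∈ W := by
  have := homogeneousSubmodule_finiteDimensional F (Fin n × Fin n)
  refine ⟨⨆ m : Fin (p.totalDegree + 1), MvPolynomial.homogeneousSubmodule (Fin n × Fin n) F m,
    inferInstance, fun x => ?_, ?_⟩
  · suffices h : (⨆ m : Fin (p.totalDegree + 1),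
        MvPolynomial.homogeneousSubmodule (Fin n × Fin n) F m) ≤
        (⨆ m : Fin (p.totalDegree + 1),
        MvPolynomial.homogeneousSubmodule (Fin n × Fin n) F m).comap (colRep T c x) from
      fun v hv => h hv
    refine iSup_le fun m q hq => Submodule.mem_iSup_of_mem m ?_
    rw [colRep_apply, colOp_apply]
    exact add_mem (colDer_isHomogeneous x.2.2 hq) (Submodule.smul_mem _ _ hq)
  · conv => arg 2; rw [← MvPolynomial.sum_homogeneousComponent p]
    refine sum_mem fun m hm => Submodule.mem_iSup_of_mem ⟨m, Finset.mem_range.mp hm⟩ ?_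
    exact MvPolynomial.homogeneousComponent_isHomogeneous m p

/-- The twisted action is compatible with the weight `λ` on the generators of `n⁺` and `h`. -/
theorem isHighestWeight_colRep {T : VFType} (hT : T = .H → Even n) {c : F} {lam : Weight F T n}
    {p : MvPolynomial (Fin n × Fin n) F} (hpos : ∀ D ∈ nPlusGens F T n, colOp c D p = 0)
    (hcar : ∀ h : cartan F T n, ((h : vf0 F T n) : Vect F n) ∈ cartanGens F T n →
      colOp c ((h : vf0 F T n) : Vect F n) p = lam h • p) :
    IsHighestWeight (colRep T c) (cartan F T n) (nPlus F T n) lam p where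
  pos x hx := by
    have : Submodule.span F (nPlusGens F T n) ≤ LinearMap.ker (LinearMap.applyₗ p ∘ₗ colOp c) :=
      Submodule.span_le.mpr fun D hD => hpos D hD
    exact this hx
  cartan := by
    suffices h : ∀ D (_ : D ∈ Submodule.span F (cartanGens F T n)), ∃ x : cartan F T n,
        ((x : vf0 F T n) : Vect F n) = D ∧ colOp c D p = lam x • p by
      intro x
      obtain ⟨y, hy, hy'⟩ := h _ x.2
      have : y = x := Subtype.ext (Subtype.ext hy)
      rw [← this, ← hy']
      rw [← hy]; rfl
    intro D hD
    induction hD using Submodule.span_induction with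
    | zero => exact ⟨0, rfl, by simp⟩
    | add D E _ _ hD hE =>
      obtain ⟨x, rfl, hx⟩ := hD
      obtain ⟨y, rfl, hy⟩ := hE
      have h1 : lam (x + y) = lam x + lam y := map_add lam x y
      have h2 : colOp c (((x : vf0 F T n) : Vect F n) + ((y : vf0 F T n) : Vect F n)) p =
        colOp c ((x : vf0 F T n) : Vect F n) p + colOp c ((y : vf0 F T n) : Vect F n) p := by
        rw [map_add]; rfl
      refine ⟨x + y, rfl, ?_⟩
      rw [h1, h2, hx, hy, add_smul]
    | smul a D _ hD =>
      obtain ⟨x, rfl, hx⟩ := hD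
      have h1 : lam (a • x) = a * lam x := map_smul lam a x
      have h2 : colOp c (a • ((x : vf0 F T n) : Vect F n)) p =
        a • colOp c ((x : vf0 F T n) : Vect F n) p := by
        rw [map_smul]; rfl
      refine ⟨a • x, rfl, ?_⟩
      rw [h1, h2, hx, smul_smul]
    | mem D hD =>
      have hD0 : D ∈ vf0 F T n := cartanGens_subset T hT hD
      have hD1 : (⟨D, hD0⟩ : vf0 F T n) ∈ cartan F T n := Submodule.subset_span hD
      exact ⟨⟨⟨D, hD0⟩, hD1⟩, rfl, hcar ⟨⟨D, hD0⟩, hD1⟩ hD⟩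

variable [CharZero F]

/-- Dominance makes the differences `b i` of `λ_i` and the last entry a decreasing sequence of
natural numbers. The last entry itself is an arbitrary scalar and is supplied by the trace twist
`c`. -/
theorem exists_colRep_highestWeight_W (hn : 0 < n) (lam : Weight F .W n)
    (hl : lam.IsDominantIntegral) :
    ∃ (c : F) (p : MvPolynomial (Fin n × Fin n) F), p ≠ 0 ∧
      IsHighestWeight (colRep .W c) (cartan F .W n) (nPlus F .W n) lam p := by
  let e : Fin n → cartan F .W n := fun i => ⟨⟨xd i i, xd_mem_vf0_W i i⟩,
    Submodule.subset_span ⟨i, rfl⟩⟩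
  have hdom : ∀ i j, i ≤ j → ∃ k : ℕ, lam (e i) - lam (e j) = k := by
    intro i j hij
    rcases hij.eq_or_lt with rfl | hij
    · exact ⟨0, by simp⟩
    · obtain ⟨k, hk⟩ := hl (e i - e j) ⟨i, j, hij, rfl⟩
      exact ⟨k, by rw [← hk, map_sub]⟩
  let z : Fin n := ⟨n - 1, by omega⟩
  have hz : ∀ i : Fin n, i ≤ z := fun i => Fin.le_def.mpr (by simp only [z]; omega)
  choose b hb using fun i => hdom i z (hz i)
  have hanti : Antitone b := by
    intro i j hij
    obtain ⟨k, hk⟩ := hdom i j hij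
    have : ((b j + k : ℕ) : F) = b i := by
      push_cast; rw [← hb, ← hb, ← hk]; ring
    have : b j + k = b i := by exact_mod_cast this
    omega
  refine ⟨lam (e z), hwPoly F b, hwPoly_ne_zero b,
    isHighestWeight_colRep (by simp) ?_ ?_⟩
  · rintro D ⟨i, j, hij, rfl⟩
    rw [colOp_apply, colDer_xd_hwPoly_of_lt hanti hij]
    have : ∀ a, cf a a (xd i j : Vect F n) = 0 := fun a => by
      rw [cf_xd, if_neg]; rintro ⟨rfl, rfl⟩; exact lt_irrefl _ hij
    simp [this]
  · rintro h ⟨i, hi⟩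
    have he : h = e i := Subtype.ext (Subtype.ext hi)
    have hs : ∑ a, cf a a (xd i i : Vect F n) = 1 := by simp [cf_xd]
    rw [hi, he, colOp_apply, colDer_xd_self_hwPoly, hs, mul_one, ← add_smul, ← hb,
      sub_add_cancel]

/-- Only differences of entries matter for `sl(n)`, so the last entry is normalised to 0 and no
twist is needed. -/
theorem exists_colRep_highestWeight_S (hn : 0 < n) (lam : Weight F .S n)
    (hl : lam.IsDominantIntegral) :
    ∃ (c : F) (p : MvPolynomial (Fin n × Fin n) F), p ≠ 0 ∧
      IsHighestWeight (colRep .S c) (cartan F .S n) (nPlus F .S n) lam p := by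
  let z : Fin n := ⟨n - 1, by omega⟩
  let e : Fin n → cartan F .S n := fun i => ⟨⟨xd i i - xd z z, xd_sub_xd_mem_vf0_S i z⟩,
    xd_sub_xd_mem_span_S i z⟩
  have he : ∀ i j, (((e i - e j : cartan F .S n) : vf0 F .S n) : Vect F n) = xd i i - xd j j := by
    intro i j
    show (xd i i - xd z z : Vect F n) - (xd j j - xd z z) = _
    abel
  have hdom : ∀ i j, i ≤ j → ∃ k : ℕ, lam (e i) - lam (e j) = k := by
    intro i j hij
    rcases hij.eq_or_lt with rfl | hij
    · exact ⟨0, by simp⟩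
    · obtain ⟨k, hk⟩ := hl (e i - e j) ⟨i, j, hij, he i j⟩
      exact ⟨k, by rw [← hk, map_sub]⟩
  have hz : ∀ i : Fin n, i ≤ z := fun i => Fin.le_def.mpr (by simp only [z]; omega)
  choose b hb using fun i => hdom i z (hz i)
  have hanti : Antitone b := by
    intro i j hij
    obtain ⟨k, hk⟩ := hdom i j hij
    have : ((b j + k : ℕ) : F) = b i := by
      push_cast; rw [← hb, ← hb, ← hk]; ring
    have : b j + k = b i := by exact_mod_cast this
    omega
  refine ⟨0, hwPoly F b, hwPoly_ne_zero b, isHighestWeight_colRep (by simp) ?_ ?_⟩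
  · rintro D ⟨i, j, hij, rfl⟩
    rw [colOp_apply, colDer_xd_hwPoly_of_lt hanti hij, zero_mul, zero_smul, add_zero]
  · rintro h ⟨i, j, hij, hi⟩
    have hh : h = e i - e j := Subtype.ext (Subtype.ext (hi.trans (he i j).symm))
    rw [hi, hh, map_sub, LinearMap.sub_apply, colOp_apply, colOp_apply, colDer_xd_self_hwPoly,
      colDer_xd_self_hwPoly, zero_mul, zero_smul, zero_mul, zero_smul, add_zero, add_zero,
      ← sub_smul, ← hb, ← hb, map_sub, sub_sub_sub_cancel_right]

/-- The exponents are the values of `λ` on the coroots of the long roots for the first half of the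
indices, and 0 for the second half. The polynomial then involves no variables of the second half, so
the terms `x_a ∂_{i'}` of the positive root vectors kill it. -/
theorem exists_colRep_highestWeight_H (hn : Even n) (lam : Weight F .H n)
    (hl : lam.IsDominantIntegral) :
    ∃ (c : F) (p : MvPolynomial (Fin n × Fin n) F), p ≠ 0 ∧
      IsHighestWeight (colRep .H c) (cartan F .H n) (nPlus F .H n) lam p := by
  let e : Fin n → cartan F .H n := fun i => ⟨⟨xd i i - xd (cj i) (cj i), xd_sub_xd_mem_vf0_H hn i⟩,
    xd_sub_xd_mem_span_H hn i⟩
  have hcj : ∀ i : Fin n, sg i = 1 → ((cj i : Fin n) : ℕ) = i + n / 2 := fun i hi =>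
    (val_eq_add_iff hn _ _).mpr ⟨hi, rfl⟩
  have hnat : ∀ i, ∃ k : ℕ, (sg i = 1 → lam (e i) = k) ∧ (sg i = -1 → k = 0) := by
    intro i
    rcases sg_eq i with h | h
    · obtain ⟨k, hk⟩ := hl (e i) ⟨i, cj i, i, cj i, hcj i h, hcj i h, Or.inr (Or.inr rfl)⟩
      exact ⟨k, fun _ => hk, fun h' => by rw [h] at h'; simp at h'⟩
    · exact ⟨0, fun h' => by rw [h] at h'; simp at h', fun _ => rfl⟩
  choose b hb hb0 using hnat
  have hanti : Antitone b := by
    intro i j hij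
    rcases sg_eq j with hj | hj
    · have hi : sg i = 1 := by
        rw [lt_iff_of_sg] at hj ⊢
        exact lt_of_le_of_lt hij hj
      rcases hij.eq_or_lt with rfl | hij
      · exact le_rfl
      obtain ⟨k, hk⟩ := hl (e i - e j) ⟨i, cj i, j, cj j, hcj i hi, hcj j hj,
        Or.inl ⟨hij, rfl⟩⟩
      rw [map_sub, hb i hi, hb j hj] at hk
      have : ((b j + k : ℕ) : F) = b i := by push_cast; rw [← hk]; ring
      have : b j + k = b i := by exact_mod_cast this
      omega
    · rw [hb0 j hj]; exact Nat.zero_le _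
  refine ⟨0, hwPoly F b, hwPoly_ne_zero b, isHighestWeight_colRep (fun _ => hn) ?_ ?_⟩
  · rintro D ⟨i, i', j, j', hi, hj, h⟩
    obtain ⟨si, rfl⟩ := (val_eq_add_iff hn _ _).mp hi
    obtain ⟨sj, rfl⟩ := (val_eq_add_iff hn _ _).mp hj
    have hi0 : b (cj i) = 0 := hb0 _ (by rw [sg_cj hn, si])
    have hj0 : b (cj j) = 0 := hb0 _ (by rw [sg_cj hn, sj])
    rcases h with ⟨hij, rfl⟩ | ⟨hij, rfl⟩
    · rw [map_sub, LinearMap.sub_apply, colOp_apply, colOp_apply,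
        colDer_xd_hwPoly_of_lt hanti hij, colDer_xd_hwPoly_of_eq_zero _ hi0]
      simp
    · rw [map_add, LinearMap.add_apply, colOp_apply, colOp_apply,
        colDer_xd_hwPoly_of_eq_zero _ hj0, colDer_xd_hwPoly_of_eq_zero _ hi0]
      simp
  · rintro h ⟨i, i', hi', hi⟩
    obtain ⟨si, rfl⟩ := (val_eq_add_iff hn _ _).mp hi'
    have hh : h = e i := Subtype.ext (Subtype.ext hi)
    have hi0 : b (cj i) = 0 := hb0 _ (by rw [sg_cj hn, si])
    rw [hi, hh, map_sub, LinearMap.sub_apply, colOp_apply, colOp_apply, colDer_xd_self_hwPoly,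
      colDer_xd_self_hwPoly, zero_mul, zero_smul, zero_mul, zero_smul, add_zero, add_zero,
      ← sub_smul, hb i si, hi0, Nat.cast_zero, sub_zero]

theorem exists_colRep_highestWeight {T : VFType} (hn : 0 < n) (hT : T = .H → Even n)
    {lam : Weight F T n} (hl : lam.IsDominantIntegral) :
    ∃ (c : F) (p : MvPolynomial (Fin n × Fin n) F), p ≠ 0 ∧
      IsHighestWeight (colRep T c) (cartan F T n) (nPlus F T n) lam p := by
  match T, lam, hl with
  | .W, lam, hl => exact exists_colRep_highestWeight_W hn lam hl
  | .S, lam, hl => exact exists_colRep_highestWeight_S hn lam hl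
  | .H, lam, hl => exact exists_colRep_highestWeight_H (hT rfl) lam hl

/-- The restriction of a representation to a stable subspace. -/
def IsStable.rep {𝔤 : Type v} [LieRing 𝔤] [LieAlgebra F 𝔤] {V : Type w} [AddCommGroup V]
    [Module F V] {ξ : 𝔤 →ₗ⁅F⁆ Module.End F V} {W : Submodule F V} (hW : IsStable ξ W) :
    𝔤 →ₗ⁅F⁆ Module.End F W where
  toFun x := (ξ x).restrict (hW x)
  map_add' x y := LinearMap.ext fun w => Subtype.ext (by simp)
  map_smul' c x := LinearMap.ext fun w => Subtype.ext (by simp)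
  map_lie' {x y} := LinearMap.ext fun w => Subtype.ext (rep_lie_apply ξ x y w)

theorem lZeroVec_ne_zero_of_dominant {T : VFType} (hn : 0 < n) (hT : T = .H → Even n)
    {lam : Weight F T n} (hl : lam.IsDominantIntegral) : lZeroVec lam ≠ 0 := by
  obtain ⟨c, p, hp, H⟩ := exists_colRep_highestWeight hn hT hl
  exact lZeroVec_ne_zero (isTriangular hT) (vermaVec_ne_zero H hp)

/-- The highest weight polynomial lies in a sum of finitely many homogeneous components, which is
finite-dimensional and stable under linear fields. -/
theorem finiteDimensional_lZero_of_dominant {T : VFType} (hn : 0 < n) (hT : T = .H → Even n)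
    {lam : Weight F T n} (hl : lam.IsDominantIntegral) : FiniteDimensional F (LZero lam) := by
  obtain ⟨c, p, hp, H⟩ := exists_colRep_highestWeight hn hT hl
  obtain ⟨W, hW, hWs, hpW⟩ := exists_finiteDimensional_stable T c p
  refine finiteDimensional_lZero (ξ := hWs.rep) (v := ⟨p, hpW⟩)
    ⟨fun x hx => Subtype.ext (H.pos x hx), fun x => Subtype.ext (H.cartan x)⟩
    fun h => hp (congrArg Subtype.val h)

end DominantModules

/-! ### Homogeneous components of vector fields -/

section Components

variable {F : Type u} [Field F] {n : ℕ}

theorem pd_mem_vf (T : VFType) (i : Fin n) : (pd i : Vect F n) ∈ vf F T n := by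
  have h : ∀ a k : Fin n, (pd a : Vect F n) ((pd i : Vect F n) (MvPolynomial.X k)) = 0 := by
    intro a k
    rw [pd_X]; split_ifs <;> simp
  match T with
  | .W => exact LieSubalgebra.mem_top _
  | .S => exact Finset.sum_eq_zero fun a _ => h a a
  | .H =>
    refine lieDerivOmega_eq_zero _ fun a b => ?_
    rw [lieDerivOmega_pd]
    simp [h]

theorem pd_mem_vectPart (i : Fin n) : (pd i : Vect F n) ∈ vectPart F n 0 := by
  intro k
  rw [pd_X]
  split_ifs
  · exact MvPolynomial.isHomogeneous_one _ _
  · exact MvPolynomial.isHomogeneous_zero _ _ _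

/-- `∂_i` as an element of `g`. -/
def pdv (T : VFType) (i : Fin n) : vf F T n := ⟨pd i, pd_mem_vf T i⟩

/-- The homogeneous component of a vector field. -/
def homComp (m : ℕ) (D : Vect F n) : Vect F n :=
  ∑ i, MvPolynomial.homogeneousComponent m (D (MvPolynomial.X i)) • (pd i : Vect F n)

theorem homComp_X (m : ℕ) (D : Vect F n) (k : Fin n) : homComp m D (MvPolynomial.X k) =
    MvPolynomial.homogeneousComponent m (D (MvPolynomial.X k)) := by
  simp [homComp, vect_sum_apply, pd_X]

theorem homComp_mem_vectPart (m : ℕ) (D : Vect F n) : homComp m D ∈ vectPart F n m := fun k => by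
  rw [homComp_X]
  exact MvPolynomial.homogeneousComponent_isHomogeneous m _

theorem pd_homogeneousComponent_succ (m : ℕ) (a : Fin n) (p : Poly F n) :
    pd a (MvPolynomial.homogeneousComponent (m + 1) p) =
      MvPolynomial.homogeneousComponent m (pd a p) := by
  ext d
  simp only [pd, MvPolynomial.coeff_homogeneousComponent, MvPolynomial.coeff_pderiv]
  have : (d + Finsupp.single a 1).degree = d.degree + 1 := by
    simp
  rw [this]
  by_cases h : d.degree = m <;> simp [h]

theorem pd_homogeneousComponent_zero (a : Fin n) (p : Poly F n) :
    pd a (MvPolynomial.homogeneousComponent 0 p) = 0 := by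
  simp [MvPolynomial.homogeneousComponent_zero]

/-- In types `S` and `H` the conditions are first order with constant coefficients, so they hold
degree by degree. The component with constant coefficients is special because all its derivatives
vanish. -/
theorem homComp_mem_vf {T : VFType} (m : ℕ) {D : Vect F n} (hD : D ∈ vf F T n) :
    homComp m D ∈ vf F T n := by
  match T, m, hD with
  | .W, _, _ => exact LieSubalgebra.mem_top _
  | .S, 0, _ =>
    refine Finset.sum_eq_zero fun a _ => ?_
    rw [homComp_X, pd_homogeneousComponent_zero]
  | .S, m + 1, hD =>
    have h : divergence D = 0 := hD
    show divergence (homComp (m + 1) D) = 0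
    simp only [divergence, homComp_X, pd_homogeneousComponent_succ] at h ⊢
    rw [← map_sum, h, map_zero]
  | .H, 0, _ =>
    refine lieDerivOmega_eq_zero _ fun a b => ?_
    rw [lieDerivOmega_pd]
    simp [homComp_X]
  | .H, m + 1, hD =>
    refine lieDerivOmega_eq_zero _ fun a b => ?_
    have h := congrArg (MvPolynomial.homogeneousComponent m) (hD (pd a) (pd b))
    rw [map_zero] at h
    rw [← h, lieDerivOmega_pd, lieDerivOmega_pd]
    simp only [map_sum]
    refine Finset.sum_congr rfl fun i _ => Finset.sum_congr rfl fun j _ => ?_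
    simp only [homComp_X, pd_homogeneousComponent_succ]
    split_ifs <;> simp

theorem sum_homogeneousComponent_of_lt {σ : Type*} {p : MvPolynomial σ F} {N : ℕ}
    (h : p.totalDegree < N) :
    ∑ m ∈ Finset.range N, MvPolynomial.homogeneousComponent m p = p := by
  conv_rhs => rw [← MvPolynomial.sum_homogeneousComponent p]
  symm
  refine Finset.sum_subset (Finset.range_mono h) fun m _ hm => ?_
  exact MvPolynomial.homogeneousComponent_eq_zero _ _ (by simpa using hm)

theorem exists_eq_sum_homComp (D : Vect F n) :
    ∃ N, D = ∑ m ∈ Finset.range N, homComp m D := by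
  refine ⟨Finset.univ.sup (fun i => (D (MvPolynomial.X i)).totalDegree) + 1, ?_⟩
  apply MvPolynomial.derivation_ext
  intro k
  rw [vect_sum_apply]
  simp only [homComp_X]
  exact (sum_homogeneousComponent_of_lt (Nat.lt_succ_of_le
    (Finset.le_sup (f := fun i => (D (MvPolynomial.X i)).totalDegree) (Finset.mem_univ k)))).symm

/-- A subspace of `g` containing all homogeneous elements is everything. -/
theorem mem_of_homogeneous {T : VFType} {P : Submodule F (vf F T n)}
    (hP : ∀ (m : ℕ) (X : vf F T n), (X : Vect F n) ∈ vectPart F n m → X ∈ P) (X : vf F T n) :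
    X ∈ P := by
  obtain ⟨N, hN⟩ := exists_eq_sum_homComp (X : Vect F n)
  have : X = ∑ m ∈ Finset.range N, (⟨homComp m (X : Vect F n), homComp_mem_vf m X.2⟩ :
      vf F T n) := by
    apply Subtype.ext
    conv_lhs => rw [hN]
    exact (map_sum (vf F T n).toSubmodule.subtype (fun m => (⟨homComp m (X : Vect F n),
      homComp_mem_vf m X.2⟩ : vf F T n)) (Finset.range N)).symm
  rw [this]
  exact sum_mem fun m _ => hP m _ (homComp_mem_vectPart m _)

theorem mem_of_homogeneous_poly {P : Submodule F (Poly F n)}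
    (hP : ∀ (m : ℕ) (f : Poly F n), f.IsHomogeneous m → f ∈ P) (f : Poly F n) : f ∈ P := by
  have h := MvPolynomial.sum_homogeneousComponent f
  rw [← h]
  exact sum_mem fun m _ => hP m _ (MvPolynomial.homogeneousComponent_isHomogeneous m f)

theorem lie_pd_mem_vectPart {m : ℕ} {D : Vect F n} (hD : D ∈ vectPart F n (m + 1)) (i : Fin n) :
    ⁅(pd i : Vect F n), D⁆ ∈ vectPart F n m := by
  intro k
  rw [Derivation.commutator_apply, pd_X]
  have h1 : D (if i = k then 1 else 0) = 0 := by split_ifs <;> simp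
  rw [h1, sub_zero]
  simpa [pd] using (hD k).pderiv (i := i)

theorem lie_pdv_mem_vectPart {T : VFType} {m : ℕ} {X : vf F T n}
    (hX : (X : Vect F n) ∈ vectPart F n (m + 1)) (i : Fin n) :
    ((⁅(pdv T i : vf F T n), X⁆ : vf F T n) : Vect F n) ∈ vectPart F n m := by
  have h : ((⁅(pdv T i : vf F T n), X⁆ : vf F T n) : Vect F n) =
    ⁅(pd i : Vect F n), (X : Vect F n)⁆ := rfl
  rw [h]
  exact lie_pd_mem_vectPart hX i

theorem eq_sum_pdv_of_mem_vectPart_zero {T : VFType} {X : vf F T n}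
    (hX : (X : Vect F n) ∈ vectPart F n 0) :
    X = ∑ i, MvPolynomial.coeff 0 ((X : Vect F n) (MvPolynomial.X i)) • (pdv T i : vf F T n) := by
  apply Subtype.ext
  have e : ((∑ i, MvPolynomial.coeff 0 ((X : Vect F n) (MvPolynomial.X i)) •
      (pdv T i : vf F T n) : vf F T n) : Vect F n) =
      ∑ i, MvPolynomial.coeff 0 ((X : Vect F n) (MvPolynomial.X i)) • (pd i : Vect F n) :=
    map_sum (vf F T n).toSubmodule.subtype (fun i =>
      MvPolynomial.coeff 0 ((X : Vect F n) (MvPolynomial.X i)) • (pdv T i : vf F T n)) Finset.univ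
  rw [e]
  apply MvPolynomial.derivation_ext
  intro k
  rw [vect_sum_apply]
  conv_lhs => rw [MvPolynomial.totalDegree_eq_zero_iff_eq_C.mp
    (Nat.le_zero.mp (hX k).totalDegree_le)]
  simp [pd_X, MvPolynomial.smul_eq_C_mul]

end Components

/-! ### Graded subspaces -/

section Graded

variable {F : Type u} [Field F] {M : Type v} [AddCommGroup M] [Module F M]

theorem exists_graded_projections {A : ℤ → Submodule F M} (hA : DirectSum.IsInternal A) :
    ∃ π : ℤ → M →ₗ[F] M, (∀ i m, π i m ∈ A i) ∧ (∀ i, ∀ m ∈ A i, π i m = m) ∧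
      (∀ i j, i ≠ j → ∀ m ∈ A j, π i m = 0) ∧ ∀ m, (∀ i, π i m = 0) → m = 0 := by
  classical
  let e := LinearEquiv.ofBijective (DirectSum.coeLinearMap A) hA
  have he : ∀ j (m : M) (hm : m ∈ A j), e.symm m = DirectSum.lof F ℤ (fun i => A i) j ⟨m, hm⟩ := by
    intro j m hm
    rw [LinearEquiv.symm_apply_eq]
    exact (DirectSum.coeLinearMap_lof A j ⟨m, hm⟩).symm
  refine ⟨fun i => (A i).subtype ∘ₗ DirectSum.component F ℤ (fun i => A i) i ∘ₗ e.symm,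
    fun i m => Subtype.mem _, fun i m hm => ?_, fun i j hij m hm => ?_, fun m hm => ?_⟩
  · simp only [LinearMap.comp_apply, LinearEquiv.coe_coe, he i m hm]
    rw [DirectSum.component.lof_self]; rfl
  · simp only [LinearMap.comp_apply, LinearEquiv.coe_coe, he j m hm]
    rw [DirectSum.component.of, dif_neg (Ne.symm hij)]; rfl
  · refine e.symm.injective ?_
    rw [map_zero]
    refine DFinsupp.ext fun i => Subtype.ext (hm i)

/-- The sum of the homogeneous parts of a subspace. -/
def gradedCore (A : ℤ → Submodule F M) (V : Submodule F M) : Submodule F M := ⨆ i, V ⊓ A i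

theorem gradedCore_le (A : ℤ → Submodule F M) (V : Submodule F M) : gradedCore A V ≤ V :=
  iSup_le fun _ => inf_le_left

theorem mem_gradedCore {A : ℤ → Submodule F M} {V : Submodule F M} {i : ℤ} {v : M} (hv : v ∈ V)
    (hi : v ∈ A i) : v ∈ gradedCore A V := Submodule.mem_iSup_of_mem i ⟨hv, hi⟩

theorem gradedCore_graded (A : ℤ → Submodule F M) (V : Submodule F M) :
    gradedCore A V = ⨆ i, gradedCore A V ⊓ A i := by
  refine le_antisymm (iSup_mono fun i => le_inf ?_ inf_le_right) (iSup_le fun _ => inf_le_left)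
  exact le_iSup (fun i => V ⊓ A i) i

theorem exists_mem_ne_zero_of_graded {A : ℤ → Submodule F M} {V : Submodule F M}
    (hV : V = ⨆ i, V ⊓ A i) (h0 : V ≠ ⊥) : ∃ i, ∃ v ∈ V, v ∈ A i ∧ v ≠ 0 := by
  by_contra! h
  refine h0 ?_
  rw [hV, iSup_eq_bot]
  exact fun i => (Submodule.eq_bot_iff _).mpr fun v hv => h i v hv.1 hv.2

end Graded

/-! ### Vectors killed by `g_{-1}` in Lie–Cartan modules. -/

section LieCartanTheory

attribute [local instance] LieRing.ofAssociativeRing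

variable {F : Type u} [Field F] {T : VFType} {n : ℕ} {M : Type v} [AddCommGroup M] [Module F M]
  {D : Triple F T n M}

/-- Elements of `g` and `R` are sums of homogeneous ones, which preserve the set of homogeneous
elements of `V`. Thus irreducibility can be applied to stable subspaces not known to be graded. -/
theorem gradedCore_isSub (hD : D.IsLieCartan) {V : Submodule F M}
    (hρ : ∀ X, ∀ v ∈ V, D.ρ X v ∈ V) (hθ : ∀ f, ∀ v ∈ V, D.θ f v ∈ V) :
    D.IsSub (gradedCore D.gr V) where
  graded := gradedCore_graded _ _
  ρ_mem X v hv := by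
    refine mem_of_homogeneous (P := (gradedCore D.gr V).comap
      (LinearMap.applyₗ v ∘ₗ (D.ρ : vf F T n →ₗ[F] Module.End F M))) (fun m X hX => ?_) X
    have : gradedCore D.gr V ≤ (gradedCore D.gr V).comap (D.ρ X) :=
      iSup_le fun i w hw => mem_gradedCore (hρ X w hw.1) (hD.graded m X hX i w hw.2)
    exact this hv
  θ_mem f v hv := by
    refine mem_of_homogeneous_poly (P := (gradedCore D.gr V).comap
      (LinearMap.applyₗ v ∘ₗ D.θ.toLinearMap)) (fun m f hf => ?_) f
    have : gradedCore D.gr V ≤ (gradedCore D.gr V).comap (D.θ f) :=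
      iSup_le fun i w hw => mem_gradedCore (hθ f w hw.1) (hD.graded_poly m f hf i w hw.2)
    exact this hv

/-- A nonzero graded subspace stable under `g_{-1}` contains a nonzero homogeneous vector killed by
`g_{-1}`. -/
theorem exists_homogeneous_killed (hD : D.IsLieCartan) {V : Submodule F M}
    (hV : V = ⨆ i, V ⊓ D.gr i) (h0 : V ≠ ⊥) (hs : ∀ i, ∀ v ∈ V, D.ρ (pdv T i) v ∈ V) :
    ∃ m, ∃ v ∈ V, v ∈ D.gr m ∧ v ≠ 0 ∧ ∀ i, D.ρ (pdv T i) v = 0 := by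
  obtain ⟨j, v, hvV, hvj, hv0⟩ := exists_mem_ne_zero_of_graded hV h0
  obtain ⟨W, hvW, hWf, hW⟩ := hD.locallyFinite v
  by_contra! hcon
  -- If no such vector exists, some `∂_i` always has nonzero image, and descending from `v` never
  -- leaves the finite-dimensional space `W`.
  have step : ∀ k : ℕ, ∃ v ∈ V, v ∈ W ∧ v ∈ D.gr (j - k) ∧ v ≠ 0 := by
    intro k
    induction k with
    | zero => exact ⟨v, hvV, hvW, by simpa using hvj, hv0⟩
    | succ k ih =>
      obtain ⟨u, huV, huW, huj, hu0⟩ := ih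
      obtain ⟨i, hi⟩ := hcon _ u huV huj hu0
      refine ⟨_, hs i u huV, hW (pdv T i) (Or.inl (pd_mem_vectPart i)) u huW, ?_, hi⟩
      have := hD.graded 0 (pdv T i) (pd_mem_vectPart i) _ u huj
      convert this using 2
      push_cast; ring
  have hind : iSupIndep D.gr := hD.internal.submodule_iSupIndep
  have hind2 : iSupIndep fun k : ℕ => (D.gr (j - k)).comap W.subtype := by
    have h1 : iSupIndep fun k : ℕ => D.gr (j - k) :=
      hind.comp (f := fun k : ℕ => j - (k : ℤ)) fun a b hab => by simpa using hab
    have h2 : iSupIndep fun k : ℕ => W ⊓ D.gr (j - k) := h1.mono fun k => inf_le_right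
    have h3 : ∀ k : ℕ, (D.gr (j - k)).comap W.subtype = (W ⊓ D.gr (j - k)).comap W.subtype := by
      intro k; ext x; simp
    simp only [h3]
    refine iSupIndep_def.mpr fun k => ?_
    have h4 := iSupIndep_def.mp h2 k
    rw [Submodule.disjoint_def] at h4 ⊢
    intro x hx hx'
    refine Subtype.ext (h4 x hx ?_)
    have : (⨆ l, ⨆ (_ : l ≠ k), (W ⊓ D.gr (j - l)).comap W.subtype) ≤
        (⨆ l, ⨆ (_ : l ≠ k), (W ⊓ D.gr (j - l))).comap W.subtype :=
      iSup₂_le fun l hl => Submodule.comap_mono (le_iSup₂_of_le l hl le_rfl)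
    exact this hx'
  -- An independent family in `W` has only finitely many nonzero members, but `step` makes all of
  -- these nonzero.
  have hfin := WellFoundedGT.finite_ne_bot_of_iSupIndep hind2
  refine Set.infinite_univ (α := ℕ) (hfin.subset fun k _ => ?_)
  obtain ⟨u, -, huW, huj, hu0⟩ := step k
  intro hbot
  have : (⟨u, huW⟩ : W) ∈ (D.gr (j - k)).comap W.subtype := huj
  rw [hbot, Submodule.mem_bot] at this
  exact hu0 (congrArg Subtype.val this)

theorem apply_eq_zero_of_vectPart_zero {v : M} (hv : ∀ i, D.ρ (pdv T i) v = 0) {X : vf F T n}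
    (hX : (X : Vect F n) ∈ vectPart F n 0) : D.ρ X v = 0 := by
  rw [eq_sum_pdv_of_mem_vectPart_zero hX]
  simp [hv]

/-- The vectors of degree `j` killed by `g_{-1}`. -/
def killed (D : Triple F T n M) (j : ℤ) : Submodule F M :=
  D.gr j ⊓ ⨅ i, LinearMap.ker (D.ρ (pdv T i))

theorem mem_killed {j : ℤ} {v : M} :
    v ∈ killed D j ↔ v ∈ D.gr j ∧ ∀ i, D.ρ (pdv T i) v = 0 := by
  simp [killed]

theorem apply_mem_killed (hD : D.IsLieCartan) {j : ℤ} {v : M} (hv : v ∈ killed D j)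
    {X : vf F T n} (hX : (X : Vect F n) ∈ vectPart F n 1) : D.ρ X v ∈ killed D j := by
  rw [mem_killed] at hv ⊢
  refine ⟨by simpa using hD.graded 1 X hX j v hv.1, fun i => ?_⟩
  rw [rep_rep_apply, hv.2 i, map_zero, zero_add]
  exact apply_eq_zero_of_vectPart_zero hv.2 (lie_pd_mem_vectPart hX i)

/-- The span of the vectors `θ(f) a` with `a ∈ A`. -/
def polySpan (D : Triple F T n M) (A : Submodule F M) : Submodule F M :=
  ⨆ f : Poly F n, A.map (D.θ f)

theorem mem_polySpan {A : Submodule F M} (f : Poly F n) {a : M} (ha : a ∈ A) :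
    D.θ f a ∈ polySpan D A := Submodule.mem_iSup_of_mem f ⟨a, ha, rfl⟩

theorem le_polySpan (A : Submodule F M) : A ≤ polySpan D A := fun a ha => by
  have := mem_polySpan (D := D) 1 ha
  simpa using this

theorem θ_mem_polySpan {A : Submodule F M} (f : Poly F n) {v : M} (hv : v ∈ polySpan D A) :
    D.θ f v ∈ polySpan D A := by
  have : polySpan D A ≤ (polySpan D A).comap (D.θ f) := by
    refine iSup_le fun g => ?_
    rintro _ ⟨a, ha, rfl⟩
    have := mem_polySpan (D := D) (f * g) ha
    rwa [map_mul] at this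
  exact this hv

theorem ρ_mem_polySpan (hD : D.IsLieCartan) {A : Submodule F M} (X : vf F T n)
    (hA : ∀ a ∈ A, D.ρ X a ∈ polySpan D A) {v : M} (hv : v ∈ polySpan D A) :
    D.ρ X v ∈ polySpan D A := by
  have : polySpan D A ≤ (polySpan D A).comap (D.ρ X) := by
    refine iSup_le fun g => ?_
    rintro _ ⟨a, ha, rfl⟩
    have h := hD.compat X g a
    rw [Submodule.mem_comap, eq_add_of_sub_eq h]
    exact add_mem (mem_polySpan _ ha) (θ_mem_polySpan g (hA a ha))
  exact this hv

/-- In an irreducible Lie-Cartan module there are no nonzero vectors below the degree of a vector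
killed by `g_{-1}`. -/
theorem gr_eq_bot_of_lt (hD : D.IsLieCartan) (hirr : D.IsIrreducible) {j : ℤ} {w : M}
    (hw : w ∈ killed D j) (hw0 : w ≠ 0) {i : ℤ} (hij : i < j) : D.gr i = ⊥ := by
  set S : Set (vf F T n) := {X | ∃ m : ℕ, 2 ≤ m ∧ (X : Vect F n) ∈ vectPart F n m}
  set A := wordSpan D.ρ S (killed D j) with hA
  -- On the killed vectors `g_{-1}` acts by zero and `g_0` preserves them, so words in fields of
  -- positive degree already give a stable subspace. Such words never go below degree `j`, and
  -- neither does multiplication by `R`.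
  have hstab : IsStable D.ρ A := by
    refine isStable_wordSpan fun Y b hb => ?_
    refine mem_of_homogeneous (P := A.comap
      (LinearMap.applyₗ b ∘ₗ (D.ρ : vf F T n →ₗ[F] Module.End F M))) (fun m X hX => ?_) Y
    show D.ρ X b ∈ A
    match m, hX with
    | 0, hX => rw [apply_eq_zero_of_vectPart_zero (mem_killed.mp hb).2 hX]; exact zero_mem _
    | 1, hX => exact le_wordSpan _ _ _ (apply_mem_killed hD hb hX)
    | m + 2, hX =>
      have hXS : X ∈ S := ⟨m + 2, by omega, hX⟩
      exact apply_mem_wordSpan hXS (le_wordSpan _ _ _ hb)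
  have hAle : A ≤ ⨆ (k : ℤ) (_ : j ≤ k), D.gr k := by
    refine wordSpan_le (le_iSup₂_of_le j le_rfl inf_le_left) ?_
    rintro X ⟨m, hm, hX⟩ a ha
    have : (⨆ (k : ℤ) (_ : j ≤ k), D.gr k) ≤
        (⨆ (k : ℤ) (_ : j ≤ k), D.gr k).comap (D.ρ X) := by
      refine iSup₂_le fun k hk v hv => ?_
      exact Submodule.mem_iSup_of_mem (k + m - 1) (Submodule.mem_iSup_of_mem (by omega)
        (hD.graded m X hX k v hv))
    exact this ha
  have hRle : polySpan D A ≤ ⨆ (k : ℤ) (_ : j ≤ k), D.gr k := by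
    refine iSup_le fun f => ?_
    rintro _ ⟨a, ha, rfl⟩
    refine mem_of_homogeneous_poly (P := (⨆ (k : ℤ) (_ : j ≤ k), D.gr k).comap
      (LinearMap.applyₗ a ∘ₗ D.θ.toLinearMap)) (fun m f hf => ?_) f
    have : (⨆ (k : ℤ) (_ : j ≤ k), D.gr k) ≤
        (⨆ (k : ℤ) (_ : j ≤ k), D.gr k).comap (D.θ f) := by
      refine iSup₂_le fun k hk v hv => ?_
      exact Submodule.mem_iSup_of_mem (m + k) (Submodule.mem_iSup_of_mem (by omega)
        (hD.graded_poly m f hf k v hv))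
    exact this (hAle ha)
  have hsub := gradedCore_isSub hD (V := polySpan D A)
    (fun X v hv => ρ_mem_polySpan hD X (fun a ha => le_polySpan _ (hstab X a ha)) hv)
    (fun f v hv => θ_mem_polySpan f hv)
  have hwmem : w ∈ gradedCore D.gr (polySpan D A) :=
    mem_gradedCore (le_polySpan _ (le_wordSpan _ _ _ hw)) (mem_killed.mp hw).1
  -- The submodule contains `w`, so it is all of `M`; the projection to a degree `i < j` therefore
  -- vanishes.
  have htop : gradedCore D.gr (polySpan D A) = ⊤ := (hirr.2 _ hsub).resolve_left fun h =>
    hw0 (by simpa [h] using hwmem)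
  obtain ⟨π, -, h1, h2, -⟩ := exists_graded_projections hD.internal
  refine (Submodule.eq_bot_iff _).mpr fun v hv => ?_
  have h3 : (⨆ (k : ℤ) (_ : j ≤ k), D.gr k) ≤ LinearMap.ker (π i) :=
    iSup₂_le fun k hk u hu => h2 i k (by omega) u hu
  rw [← h1 i v hv]
  exact h3 (hRle (gradedCore_le _ _ (htop ▸ Submodule.mem_top)))

/-- With nonzero killed vectors in two degrees, the one of higher degree would make the lower degree
vanish. -/
theorem killed_eq_bot_of_ne (hD : D.IsLieCartan) (hirr : D.IsIrreducible) {j k : ℤ} {w : M}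
    (hw : w ∈ killed D j) (hw0 : w ≠ 0) (hjk : k ≠ j) : killed D k = ⊥ := by
  refine (Submodule.eq_bot_iff _).mpr fun v hv => ?_
  by_contra hv0
  rcases lt_or_gt_of_ne hjk with h | h
  · have := gr_eq_bot_of_lt hD hirr hw hw0 h
    exact hv0 (by simpa [this] using (mem_killed.mp hv).1)
  · have := gr_eq_bot_of_lt hD hirr hv hv0 h
    exact hw0 (by simpa [this] using (mem_killed.mp hw).1)

end LieCartanTheory

/-! ### Prolongations are irreducible Lie-Cartan modules -/

section Jacobian

variable {F : Type u} [Field F] {T : VFType} {n : ℕ}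

theorem jacobian_eq_zero {X : vf F T n} (hX : (X : Vect F n) ∈ vectPart F n 0) :
    jacobian T X = 0 := by
  apply jacobian_injective F n T
  rw [jacobian_spec, map_zero, jacobianW]
  refine Finset.sum_eq_zero fun i _ => Finset.sum_eq_zero fun j _ => ?_
  rw [derivation_eq_zero_of_isHomogeneous_zero _ (hX i), TensorProduct.zero_tmul]

theorem jacobian_toVf (x : vf0 F T n) : jacobian T (toVf x) = (1 : Poly F n) ⊗ₜ[F] x := by
  apply jacobian_injective F n T
  rw [jacobian_spec, jacobianW, LinearMap.lTensor_tmul]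
  have h : incl0 F T n x = ∑ a, ∑ b, cf a b (x : Vect F n) • (xd a b : Vect F n) := eq_sum_cf x.2.2
  rw [h, TensorProduct.tmul_sum, Finset.sum_comm]
  refine Finset.sum_congr rfl fun a _ => ?_
  rw [TensorProduct.tmul_sum]
  refine Finset.sum_congr rfl fun b _ => ?_
  show pd a ((x : Vect F n) (MvPolynomial.X b)) ⊗ₜ[F] _ = _
  rw [pd_eq_C_cf x.2.2, ← TensorProduct.smul_tmul, MvPolynomial.smul_eq_C_mul, mul_one]

theorem jacobian_mem_span {m : ℕ} {X : vf F T n} (hX : (X : Vect F n) ∈ vectPart F n (m + 1)) :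
    jacobian T X ∈ Submodule.span F {t | ∃ (p : Poly F n) (x : vf0 F T n),
      p.IsHomogeneous m ∧ t = p ⊗ₜ[F] x} := by
  rw [jacobian]
  refine sum_mem fun α hα => Submodule.subset_span ⟨_, _, ?_, rfl⟩
  simp only [Finset.mem_biUnion, Finset.mem_univ, true_and] at hα
  obtain ⟨i, j, hij⟩ := hα
  have h : (pd j ((X : Vect F n) (MvPolynomial.X i))).IsHomogeneous m := by
    simpa [pd] using (hX i).pderiv (i := j)
  refine MvPolynomial.isHomogeneous_monomial _ ?_
  by_contra hne
  exact MvPolynomial.mem_support_iff.mp hij (h.coeff_eq_zero hne)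

theorem cartan_apply_X (h : cartan F T n) (i : Fin n) :
    ((h : vf0 F T n) : Vect F n) (MvPolynomial.X i) =
      cartanCoord T i h • (MvPolynomial.X i : Poly F n) := by
  have h2 : ((h : vf0 F T n) : Vect F n) ∈ Submodule.span F (cartanGens F T n) := h.2
  rw [eq_diag_of_mem_cartanGens h2]
  simp only [diag, vect_sum_apply, Derivation.smul_apply, xd_apply, pd_X]
  simp
  rfl

end Jacobian

/-! ### Grading, local finiteness and weights of the prolongation `R ⊗ L`. -/

section Prolongation

attribute [local instance] LieRing.ofAssociativeRing

variable {F : Type u} [Field F] {T : VFType} {n : ℕ} {L : Type v} [AddCommGroup L] [Module F L]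
  (ξ : vf0 F T n →ₗ⁅F⁆ Module.End F L)

theorem prolong_tmul (X : vf F T n) (p : Poly F n) (l : L) :
    prolong ξ X (p ⊗ₜ l) = (X : Vect F n) p ⊗ₜ l + tensorAct ξ (jacobian T X) (p ⊗ₜ l) := rfl

theorem prolong_toVf_one_tmul (x : vf0 F T n) (l : L) :
    prolong ξ (toVf x) (1 ⊗ₜ l) = 1 ⊗ₜ ξ x l := by
  rw [prolong_tmul, jacobian_toVf, tensorAct_tmul]
  simp

theorem prolong_of_vectPart_zero {X : vf F T n} (hX : (X : Vect F n) ∈ vectPart F n 0)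
    (p : Poly F n) (l : L) : prolong ξ X (p ⊗ₜ l) = (X : Vect F n) p ⊗ₜ l := by
  rw [prolong_tmul, jacobian_eq_zero hX, map_zero, LinearMap.zero_apply, add_zero]

theorem lsmul_tmul (f p : Poly F n) (l : L) :
    Algebra.lsmul F F (Poly F n ⊗[F] L) f (p ⊗ₜ[F] l) = (f * p) ⊗ₜ[F] l := rfl

theorem tensorAct_lsmul (t : Poly F n ⊗[F] vf0 F T n) (f : Poly F n) (v : Poly F n ⊗[F] L) :
    tensorAct ξ t (Algebra.lsmul F F (Poly F n ⊗[F] L) f v) =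
      Algebra.lsmul F F (Poly F n ⊗[F] L) f (tensorAct ξ t v) := by
  induction t using TensorProduct.induction_on with
  | zero => simp
  | add a b ha hb => rw [map_add, LinearMap.add_apply, LinearMap.add_apply, ha, hb, map_add]
  | tmul q x =>
    induction v using TensorProduct.induction_on with
    | zero => simp
    | add a b ha hb => rw [map_add, map_add, ha, hb, map_add, map_add]
    | tmul p l =>
      rw [lsmul_tmul, tensorAct_tmul, tensorAct_tmul, lsmul_tmul, mul_left_comm]

theorem prolong_compat (X : vf F T n) (f : Poly F n) (v : Poly F n ⊗[F] L) :
    prolong ξ X (Algebra.lsmul F F (Poly F n ⊗[F] L) f v) -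
      Algebra.lsmul F F (Poly F n ⊗[F] L) f (prolong ξ X v) =
      Algebra.lsmul F F (Poly F n ⊗[F] L) ((X : Vect F n) f) v := by
  induction v using TensorProduct.induction_on with
  | zero => simp
  | add a b ha hb =>
    simp only [map_add] at ha hb ⊢
    rw [← ha, ← hb]; abel
  | tmul p l =>
    rw [lsmul_tmul, prolong_tmul, prolong_tmul, map_add, ← tensorAct_lsmul, lsmul_tmul, lsmul_tmul,
      lsmul_tmul, add_sub_add_right_eq_sub, ← TensorProduct.sub_tmul, Derivation.leibniz]
    congr 1
    simp only [smul_eq_mul]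
    ring

/-- The grading of the prolongation. -/
def prolongGr (F : Type u) [Field F] (n : ℕ) (L : Type v) [AddCommGroup L] [Module F L] (d k : ℤ) :
    Submodule F (Poly F n ⊗[F] L) :=
  Submodule.span F {t | ∃ (m : ℕ) (p : Poly F n) (v : L),
    p.IsHomogeneous m ∧ (m : ℤ) + d = k ∧ t = p ⊗ₜ[F] v}

variable {d : ℤ}

theorem tmul_mem_prolongGr {m : ℕ} {p : Poly F n} (hp : p.IsHomogeneous m) {k : ℤ}
    (hk : (m : ℤ) + d = k) (l : L) : p ⊗ₜ[F] l ∈ prolongGr F n L d k :=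
  Submodule.subset_span ⟨m, p, l, hp, hk, rfl⟩

theorem prolongGr_le {k : ℤ} {W : Submodule F (Poly F n ⊗[F] L)}
    (h : ∀ (m : ℕ) (p : Poly F n) (l : L), p.IsHomogeneous m → (m : ℤ) + d = k → p ⊗ₜ[F] l ∈ W) :
    prolongGr F n L d k ≤ W := by
  refine Submodule.span_le.mpr ?_
  rintro _ ⟨m, p, l, hp, hk, rfl⟩
  exact h m p l hp hk

theorem prolongGr_eq_bot {k : ℤ} (hk : k < d) : prolongGr F n L d k = ⊥ :=
  le_bot_iff.mp (prolongGr_le fun m p l _ h => by omega)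

theorem prolongGr_lowest {v : Poly F n ⊗[F] L} (hv : v ∈ prolongGr F n L d d) :
    ∃ l : L, v = 1 ⊗ₜ l := by
  have : prolongGr F n L d d ≤ LinearMap.range (TensorProduct.mk F (Poly F n) L 1) := by
    refine prolongGr_le fun m p l hp hm => ?_
    obtain rfl : m = 0 := by omega
    rw [MvPolynomial.totalDegree_eq_zero_iff_eq_C.mp (Nat.le_zero.mp hp.totalDegree_le)]
    refine ⟨MvPolynomial.coeff 0 p • l, ?_⟩
    rw [TensorProduct.mk_apply, TensorProduct.tmul_smul, TensorProduct.smul_tmul',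
      MvPolynomial.smul_eq_C_mul, mul_one]
  obtain ⟨l, hl⟩ := this hv
  exact ⟨l, hl.symm⟩

/-- The Euler operator on the prolongation. -/
def euler (F : Type u) [Field F] (n : ℕ) (L : Type v) [AddCommGroup L] [Module F L] :
    Module.End F (Poly F n ⊗[F] L) :=
  ((∑ i, (MvPolynomial.X i : Poly F n) • (pd i : Vect F n) : Vect F n) :
    Poly F n →ₗ[F] Poly F n).rTensor L

theorem euler_tmul (p : Poly F n) (l : L) : euler F n L (p ⊗ₜ l) =
    (∑ i, MvPolynomial.X i * pd i p) ⊗ₜ l := by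
  rw [euler, LinearMap.rTensor_tmul]
  congr 1
  exact (vect_sum_apply _ _ _).trans (Finset.sum_congr rfl fun i _ => rfl)

/-- Since `∂_i` acts on the left factor only, the Euler operator factors through the action of
`g_{-1}` and so annihilates every vector killed by it. -/
theorem euler_eq (v : Poly F n ⊗[F] L) : euler F n L v =
    ∑ i, Algebra.lsmul F F (Poly F n ⊗[F] L) (MvPolynomial.X i : Poly F n)
      (prolong ξ (pdv T i) v) := by
  induction v using TensorProduct.induction_on with
  | zero => simp
  | add a b ha hb => simp only [map_add, ha, hb, Finset.sum_add_distrib]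
  | tmul p l =>
    rw [euler_tmul, TensorProduct.sum_tmul]
    refine Finset.sum_congr rfl fun i _ => ?_
    rw [prolong_of_vectPart_zero ξ (pd_mem_vectPart i)]
    rfl

theorem prolongGr_le_eigenspace (k : ℤ) :
    prolongGr F n L d k ≤ (euler F n L).eigenspace ((k - d : ℤ) : F) := by
  refine prolongGr_le fun m p l hp hm => ?_
  rw [Module.End.mem_eigenspace_iff, euler_tmul]
  have h := hp.sum_X_mul_pderiv
  have h2 : ∑ i, MvPolynomial.X i * pd i p = m • p := h
  rw [h2, show k - d = m by omega, Int.cast_natCast, Nat.cast_smul_eq_nsmul, TensorProduct.smul_tmul']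

theorem tmul_mem_iSup_prolongGr (p : Poly F n) (l : L) {N : ℕ} (hN : p.totalDegree < N) :
    p ⊗ₜ[F] l ∈ ⨆ m : Fin N, prolongGr F n L d (m + d) := by
  rw [← sum_homogeneousComponent_of_lt hN, TensorProduct.sum_tmul]
  exact sum_mem fun m hm => Submodule.mem_iSup_of_mem ⟨m, Finset.mem_range.mp hm⟩
    (tmul_mem_prolongGr (MvPolynomial.homogeneousComponent_isHomogeneous m p) rfl l)

/-- Degree `k` lies in the Euler eigenspace for `k - d`, and these eigenvalues are distinct in
characteristic 0. -/
theorem prolongGr_internal [CharZero F] : DirectSum.IsInternal (prolongGr F n L d) := by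
  rw [DirectSum.isInternal_submodule_iff_iSupIndep_and_iSup_eq_top]
  constructor
  · have h1 := (Module.End.eigenspaces_iSupIndep (euler F n L)).comp
      (f := fun k : ℤ => ((k - d : ℤ) : F)) fun a b hab => by simpa using hab
    exact h1.mono prolongGr_le_eigenspace
  · refine eq_top_iff.mpr fun v _ => ?_
    induction v using TensorProduct.induction_on with
    | zero => exact zero_mem _
    | add a b ha hb => exact add_mem (ha trivial) (hb trivial)
    | tmul p l =>
      have : (⨆ m : Fin (p.totalDegree + 1), prolongGr F n L d (m + d)) ≤
          ⨆ k, prolongGr F n L d k := iSup_le fun m => le_iSup (prolongGr F n L d) _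
      exact this (tmul_mem_iSup_prolongGr p l (Nat.lt_succ_self _))

theorem prolongGr_finiteDimensional [FiniteDimensional F L] (k : ℤ) :
    FiniteDimensional F (prolongGr F n L d k) := by
  have := homogeneousSubmodule_finiteDimensional F (Fin n) (k - d).toNat
  have h : prolongGr F n L d k ≤ LinearMap.range (TensorProduct.map
      (MvPolynomial.homogeneousSubmodule (Fin n) F (k - d).toNat).subtype
      (LinearMap.id : L →ₗ[F] L)) := by
    refine prolongGr_le fun m p l hp hm => ?_
    have hm' : (k - d).toNat = m := by omega
    exact ⟨(⟨p, by rw [hm']; exact hp⟩ : MvPolynomial.homogeneousSubmodule (Fin n) F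
      (k - d).toNat) ⊗ₜ l, rfl⟩
  exact Submodule.finiteDimensional_of_le h

theorem lsmul_mem_prolongGr {m : ℕ} {f : Poly F n} (hf : f.IsHomogeneous m) {i : ℤ}
    {v : Poly F n ⊗[F] L} (hv : v ∈ prolongGr F n L d i) :
    Algebra.lsmul F F (Poly F n ⊗[F] L) f v ∈ prolongGr F n L d (m + i) := by
  have : prolongGr F n L d i ≤
      (prolongGr F n L d (m + i)).comap (Algebra.lsmul F F (Poly F n ⊗[F] L) f) := by
    refine prolongGr_le fun k p l hp hk => ?_
    rw [Submodule.mem_comap, lsmul_tmul]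
    exact tmul_mem_prolongGr (hf.mul hp) (by push_cast; omega) l
  exact this hv

theorem prolong_mem_prolongGr {m : ℕ} {X : vf F T n} (hX : (X : Vect F n) ∈ vectPart F n m) {i : ℤ}
    {v : Poly F n ⊗[F] L} (hv : v ∈ prolongGr F n L d i) :
    prolong ξ X v ∈ prolongGr F n L d (i + m - 1) := by
  have : prolongGr F n L d i ≤ (prolongGr F n L d (i + m - 1)).comap (prolong ξ X) := by
    refine prolongGr_le fun k p l hp hk => ?_
    rw [Submodule.mem_comap, prolong_tmul]
    refine add_mem ?_ ?_
    · rcases Nat.eq_zero_or_pos k with rfl | hk0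
      · rw [derivation_eq_zero_of_isHomogeneous_zero _ hp, TensorProduct.zero_tmul]
        exact zero_mem _
      · exact tmul_mem_prolongGr (derivation_isHomogeneous hX hp) (by push_cast; omega) l
    · match m, hX with
      | 0, hX => rw [jacobian_eq_zero hX, map_zero]; exact zero_mem _
      | m + 1, hX =>
        have h : Submodule.span F {t | ∃ (p : Poly F n) (x : vf0 F T n),
            p.IsHomogeneous m ∧ t = p ⊗ₜ[F] x} ≤
            (prolongGr F n L d (i + (m + 1 : ℕ) - 1)).comap
              (LinearMap.applyₗ (p ⊗ₜ[F] l) ∘ₗ tensorAct ξ) := by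
          refine Submodule.span_le.mpr ?_
          rintro _ ⟨q, x, hq, rfl⟩
          exact tmul_mem_prolongGr (hq.mul hp) (by push_cast; omega) _
        exact h (jacobian_mem_span hX)
  exact this hv

/-- The polynomials of degree below `N`, tensored with `L`, form a stable space. The shift of the
grading plays no role here and is set to 0. -/
theorem prolong_locallyFinite [FiniteDimensional F L] (v : Poly F n ⊗[F] L) :
    ∃ V : Submodule F (Poly F n ⊗[F] L), v ∈ V ∧ FiniteDimensional F V ∧
    ∀ X : vf F T n, ((X : Vect F n) ∈ vectPart F n 0 ∨ (X : Vect F n) ∈ vectPart F n 1) →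
      ∀ x ∈ V, prolong ξ X x ∈ V := by
  have hmono : ∀ {N N' : ℕ}, N ≤ N' → (⨆ m : Fin N, prolongGr F n L 0 (m + 0)) ≤
      ⨆ m : Fin N', prolongGr F n L 0 (m + 0) := fun h =>
    iSup_le fun m => le_iSup (fun m : Fin _ => prolongGr F n L 0 (m + 0)) (Fin.castLE h m)
  obtain ⟨N, hN⟩ : ∃ N : ℕ, v ∈ ⨆ m : Fin N, prolongGr F n L 0 (m + 0) := by
    induction v using TensorProduct.induction_on with
    | zero => exact ⟨0, zero_mem _⟩
    | add a b ha hb =>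
      obtain ⟨N, hN⟩ := ha
      obtain ⟨N', hN'⟩ := hb
      exact ⟨max N N', add_mem (hmono (le_max_left _ _) hN) (hmono (le_max_right _ _) hN')⟩
    | tmul p l => exact ⟨_, tmul_mem_iSup_prolongGr p l (Nat.lt_succ_self _)⟩
  have := prolongGr_finiteDimensional (F := F) (n := n) (L := L) (d := 0)
  refine ⟨_, hN, inferInstance, fun X hX => ?_⟩
  suffices h : (⨆ m : Fin N, prolongGr F n L 0 (m + 0)) ≤
      (⨆ m : Fin N, prolongGr F n L 0 (m + 0)).comap (prolong ξ X) from fun x hx => h hx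
  refine iSup_le fun m x hx => ?_
  rw [Submodule.mem_comap]
  rcases hX with hX | hX
  · have h := prolong_mem_prolongGr ξ hX hx
    -- From degree 0 the action of `g_{-1}` lands in degree `-1`, which is zero.
    rcases Nat.eq_zero_or_pos (m : ℕ) with h0 | h0
    · rw [prolongGr_eq_bot (by omega), Submodule.mem_bot] at h
      rw [h]; exact zero_mem _
    · refine Submodule.mem_iSup_of_mem ⟨m - 1, by omega⟩ ?_
      convert h using 2
      simp only; omega
  · have h := prolong_mem_prolongGr ξ hX hx
    refine Submodule.mem_iSup_of_mem m ?_
    convert h using 2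
    simp

/-- Evaluation at the origin. -/
def evalZero (F : Type u) [Field F] (n : ℕ) (L : Type v) [AddCommGroup L] [Module F L] :
    Poly F n ⊗[F] L →ₗ[F] L :=
  (TensorProduct.lid F L : F ⊗[F] L →ₗ[F] L) ∘ₗ (MvPolynomial.lcoeff F 0).rTensor L

theorem evalZero_one_tmul (l : L) : evalZero F n L (1 ⊗ₜ l) = l := by
  simp [evalZero]

theorem one_tmul_injective {a b : L} (h : (1 : Poly F n) ⊗ₜ[F] a = 1 ⊗ₜ[F] b) : a = b := by
  rw [← evalZero_one_tmul (F := F) (n := n) a, h, evalZero_one_tmul]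

theorem one_tmul_ne_zero {a : L} (ha : a ≠ 0) : (1 : Poly F n) ⊗ₜ[F] a ≠ 0 := fun h =>
  ha (one_tmul_injective (h.trans (TensorProduct.tmul_zero _ _).symm))

/-- The space `1 ⊗ L` is a sum of weight spaces, and multiplication by `x_i` shifts weights by the
`i`-th coordinate functional. These generate `R ⊗ L`. -/
theorem prolong_iSup_weight (hL : ⨆ mu : Weight F T n, ⨅ x : cartan F T n,
      (ξ x).eigenspace (mu x) = ⊤) :
    ⨆ mu : Weight F T n, ⨅ x : cartan F T n,
      (prolong ξ (toVf (x : vf0 F T n))).eigenspace (mu x) = ⊤ := by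
  set W := ⨆ mu : Weight F T n, ⨅ x : cartan F T n,
      (prolong ξ (toVf (x : vf0 F T n))).eigenspace (mu x)
  have hone : ∀ l : L, (1 : Poly F n) ⊗ₜ[F] l ∈ W := by
    have h2 : (⨆ mu : Weight F T n, ⨅ x : cartan F T n, (ξ x).eigenspace (mu x)) ≤
        W.comap (TensorProduct.mk F (Poly F n) L 1) := by
      refine iSup_le fun mu l hl => Submodule.mem_iSup_of_mem mu ?_
      rw [Submodule.mem_iInf] at hl ⊢
      intro h
      rw [Module.End.mem_eigenspace_iff, TensorProduct.mk_apply, prolong_toVf_one_tmul,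
        Module.End.mem_eigenspace_iff.mp (hl h), TensorProduct.tmul_smul]
    exact fun l => h2 (hL ▸ Submodule.mem_top)
  have hX : ∀ (i : Fin n), ∀ v ∈ W,
      Algebra.lsmul F F (Poly F n ⊗[F] L) (MvPolynomial.X i : Poly F n) v ∈ W := by
    intro i
    suffices h : W ≤ W.comap (Algebra.lsmul F F (Poly F n ⊗[F] L) (MvPolynomial.X i : Poly F n))
      from fun v hv => h hv
    refine iSup_le fun mu v hv => Submodule.mem_iSup_of_mem (mu + cartanCoord T i) ?_
    rw [Submodule.mem_iInf] at hv ⊢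
    intro h
    have h1 := prolong_compat ξ (toVf (h : vf0 F T n)) (MvPolynomial.X i) v
    have h2 : prolong ξ (toVf (h : vf0 F T n)) v = mu h • v :=
      Module.End.mem_eigenspace_iff.mp (hv h)
    have h3 : ((toVf (h : vf0 F T n) : vf F T n) : Vect F n) (MvPolynomial.X i) =
      cartanCoord T i h • (MvPolynomial.X i : Poly F n) := cartan_apply_X h i
    rw [h2, h3, map_smul, map_smul, LinearMap.smul_apply] at h1
    rw [Module.End.mem_eigenspace_iff, LinearMap.add_apply, add_smul, ← h1]
    abel
  suffices h : ∀ v, v ∈ W from eq_top_iff.mpr fun v _ => h v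
  intro v
  induction v using TensorProduct.induction_on with
  | zero => exact zero_mem _
  | add a b ha hb => exact add_mem ha hb
  | tmul p l =>
    induction p using MvPolynomial.induction_on with
    | C a =>
      have : (MvPolynomial.C a : Poly F n) ⊗ₜ[F] l = a • ((1 : Poly F n) ⊗ₜ[F] l) := by
        rw [TensorProduct.smul_tmul', MvPolynomial.smul_eq_C_mul, mul_one]
      rw [this]
      exact W.smul_mem _ (hone l)
    | add p q hp hq => rw [TensorProduct.add_tmul]; exact add_mem hp hq
    | mul_X p i hp =>
      have := hX i _ hp
      rwa [lsmul_tmul, mul_comm] at this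

/-- In the lowest degree, `1 ⊗ L`, the algebra `g_0` acts through `ξ`. Only eigenvector relations
are carried over, since they describe highest weight vectors completely, with eigenvalue 0 for `n⁺`.
-/
theorem exists_image_of_prolong_equiv {L' : Type w} [AddCommGroup L'] [Module F L']
    (ξ' : vf0 F T n →ₗ⁅F⁆ Module.End F L') (e : Poly F n ⊗[F] L ≃ₗ[F] Poly F n ⊗[F] L')
    (he : ∀ X v, e (prolong ξ X v) = prolong ξ' X (e v))
    (hgr : ∀ v, v ∈ prolongGr F n L d d → e v ∈ prolongGr F n L' d d) {l : L} (hl : l ≠ 0) :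
    ∃ l' : L', l' ≠ 0 ∧ ∀ (x : vf0 F T n) (c : F), ξ x l = c • l → ξ' x l' = c • l' := by
  obtain ⟨l', hl'⟩ := prolongGr_lowest (hgr _ (tmul_mem_prolongGr
    (MvPolynomial.isHomogeneous_one _ _) (by simp) l))
  refine ⟨l', fun h => ?_, fun x c hx => one_tmul_injective (F := F) (n := n) ?_⟩
  · rw [h, TensorProduct.tmul_zero, LinearEquiv.map_eq_zero_iff] at hl'
    exact one_tmul_ne_zero hl hl'
  · rw [← prolong_toVf_one_tmul, ← hl', ← he, prolong_toVf_one_tmul, hx, TensorProduct.tmul_smul,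
      TensorProduct.tmul_smul, map_smul, hl']

end Prolongation

/-! ### Irreducibility of prolongations and uniqueness of the parameters. -/

section Irreducible


attribute [local instance] LieRing.ofAssociativeRing

variable {F : Type u} [Field F] {T : VFType} {n : ℕ} {lam : Weight F T n}

theorem le_of_iso {mu : Weight F T n} {d e : ℤ} (hm : lZeroVec mu ≠ 0)
    (I : (prolongation lam d).Iso (prolongation mu e)) : d ≤ e := by
  by_contra! hlt
  have h0 : (1 : Poly F n) ⊗ₜ[F] lZeroVec mu ∈ (prolongation mu e).gr e :=
    tmul_mem_prolongGr (MvPolynomial.isHomogeneous_one _ _) (by simp) _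
  have h1 : I.toEquiv.symm (1 ⊗ₜ lZeroVec mu) ∈ (prolongation lam d).gr e := by
    rw [← I.map_gr, LinearEquiv.apply_symm_apply]; exact h0
  have h2 : (prolongation lam d).gr e = ⊥ := prolongGr_eq_bot hlt
  rw [h2, Submodule.mem_bot, LinearEquiv.map_eq_zero_iff] at h1
  exact one_tmul_ne_zero hm h1

/-- The inverse of an isomorphism. -/
def Triple.Iso.symm {M : Type v} [AddCommGroup M] [Module F M] {N : Type w} [AddCommGroup N]
    [Module F N] {D : Triple F T n M} {E : Triple F T n N} (I : D.Iso E) : E.Iso D where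
  toEquiv := I.toEquiv.symm
  map_ρ X v := by rw [LinearEquiv.symm_apply_eq, I.map_ρ, LinearEquiv.apply_symm_apply]
  map_θ f v := by rw [LinearEquiv.symm_apply_eq, I.map_θ, LinearEquiv.apply_symm_apply]
  map_gr i v := by rw [← I.map_gr, LinearEquiv.apply_symm_apply]

variable [CharZero F]

theorem prolongation_weight (hT : T = .H → Even n) (d : ℤ) :
    ⨆ mu, (prolongation lam d).weightSpace mu = ⊤ := by
  have h := prolong_iSup_weight (lZeroRep lam) (iSup_weight_eq_top (ξ := lZeroRep lam)
    (h := cartan F T n) (v := lZeroVec lam) (lam := lam) (top_le_span_weight hT)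
    (isCyclic'_lZeroVec lam) (isHighestWeight_lZeroVec lam).cartan)
  refine eq_top_iff.mpr (h.symm.le.trans (iSup_mono fun mu v hv x => ?_))
  rw [Submodule.mem_iInf] at hv
  exact Module.End.mem_eigenspace_iff.mp (hv x)

theorem prolongation_isLieCartan (hT : T = .H → Even n) [FiniteDimensional F (LZero lam)]
    (d : ℤ) : (prolongation lam d).IsLieCartan where
  internal := prolongGr_internal
  finite i := prolongGr_finiteDimensional i
  graded _ _ hX _ _ hv := prolong_mem_prolongGr (lZeroRep lam) hX hv
  locallyFinite := prolong_locallyFinite (lZeroRep lam)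
  weight := prolongation_weight hT d
  compat X f v := prolong_compat (lZeroRep lam) X f v
  graded_poly _ _ hf _ _ hv := lsmul_mem_prolongGr hf hv

/-- On a killed vector of degree `m` the Euler operator is both 0 and `m - d`, so `m = d` and the
vector is `1 ⊗ l`. Simplicity of `L⁰(λ)` gives all of `1 ⊗ L⁰(λ)`, and `R` gives the rest. -/
theorem prolongation_isIrreducible (hT : T = .H → Even n) [FiniteDimensional F (LZero lam)]
    (h0 : lZeroVec lam ≠ 0) (d : ℤ) : (prolongation lam d).IsIrreducible := by
  refine ⟨⟨1 ⊗ₜ lZeroVec lam, 0, one_tmul_ne_zero h0⟩, fun V hV => ?_⟩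
  by_cases hbot : V = ⊥
  · exact Or.inl hbot
  right
  obtain ⟨m, v, hvV, hvm, hv0, hk⟩ := exists_homogeneous_killed (prolongation_isLieCartan hT d)
    hV.graded hbot fun i v hv => hV.ρ_mem _ v hv
  have hE : euler F n (LZero lam) v = 0 := by
    rw [euler_eq (lZeroRep lam)]
    refine Finset.sum_eq_zero fun i _ => ?_
    have : prolong (lZeroRep lam) (pdv T i) v = 0 := hk i
    rw [this, map_zero]
  have hvm' : v ∈ prolongGr F n (LZero lam) d m := hvm
  have h1 := Module.End.mem_eigenspace_iff.mp (prolongGr_le_eigenspace m hvm')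
  rw [hE] at h1
  have h2 : ((m - d : ℤ) : F) = 0 := (smul_eq_zero.mp h1.symm).resolve_right hv0
  obtain rfl : m = d := by
    have : m - d = 0 := by exact_mod_cast h2
    omega
  obtain ⟨l, rfl⟩ := prolongGr_lowest hvm'
  have hl0 : l ≠ 0 := fun h => hv0 (by rw [h, TensorProduct.tmul_zero])
  have hst : IsStable (lZeroRep lam) (V.comap (TensorProduct.mk F (Poly F n) (LZero lam) 1)) := by
    intro x l hl
    have := hV.ρ_mem (toVf x) _ hl
    rw [Submodule.mem_comap, TensorProduct.mk_apply, ← prolong_toVf_one_tmul (lZeroRep lam)]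
    exact this
  have htop := (isSimpleRep_lZeroRep _ hst).resolve_left fun h => hl0 (by
    have : l ∈ V.comap (TensorProduct.mk F (Poly F n) (LZero lam) 1) := hvV
    simpa [h] using this)
  suffices h : ∀ w, w ∈ V from eq_top_iff.mpr fun w _ => h w
  intro w
  induction w using TensorProduct.induction_on with
  | zero => exact zero_mem _
  | add a b ha hb => exact add_mem ha hb
  | tmul p l =>
    have h3 : l ∈ V.comap (TensorProduct.mk F (Poly F n) (LZero lam) 1) :=
      htop ▸ Submodule.mem_top
    have h4 := hV.θ_mem p _ h3
    have h5 : (prolongation lam m).θ p (TensorProduct.mk F (Poly F n) (LZero lam) 1 l) =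
      (p * 1) ⊗ₜ[F] l := rfl
    rwa [h5, mul_one] at h4

/-- Comparing lowest nonzero degrees gives `d = e`. The generator of `L⁰(λ)` then goes to a highest
weight vector of weight `λ` in the simple module `L⁰(μ)`. -/
theorem eq_of_iso (hT : T = .H → Even n) {mu : Weight F T n} {d e : ℤ} (hl : lZeroVec lam ≠ 0)
    (hm : lZeroVec mu ≠ 0) (I : (prolongation lam d).Iso (prolongation mu e)) :
    lam = mu ∧ d = e := by
  obtain rfl : d = e := le_antisymm (le_of_iso hm I) (le_of_iso hl I.symm)
  refine ⟨?_, rfl⟩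
  obtain ⟨l, hl0, hact⟩ := exists_image_of_prolong_equiv (d := d) (lZeroRep lam) (lZeroRep mu)
    I.toEquiv I.map_ρ (fun v hv => (I.map_gr d v).mpr hv) hl
  have hw : IsHighestWeight (lZeroRep mu) (cartan F T n) (nPlus F T n) lam l := by
    refine ⟨fun x hx => ?_, fun x => hact x _ ((isHighestWeight_lZeroVec lam).cartan x)⟩
    have h := hact x 0 (by rw [(isHighestWeight_lZeroVec lam).pos x hx, zero_smul])
    rw [h, zero_smul]
  exact (IsHighestWeight.unique (isTriangular hT) isSimpleRep_lZeroRep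
    (isHighestWeight_lZeroVec mu) hm hw hl0).symm

end Irreducible

/-! ### Schur's lemma for Lie-Cartan modules -/

section Schur

attribute [local instance] LieRing.ofAssociativeRing

variable {F : Type u} [Field F] {T : VFType} {n : ℕ} {M : Type v} [AddCommGroup M] [Module F M]
  {N : Type w} [AddCommGroup N] [Module F N] {D : Triple F T n M} {E : Triple F T n N}

/-- Since `Φ` commutes with the projections to degrees, a kernel without nonzero homogeneous vectors
is zero. The image is spanned by homogeneous vectors, hence is a submodule. -/
theorem nonempty_iso_of_ne_zero (hD : D.IsLieCartan) (hD' : D.IsIrreducible)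
    (hE : E.IsLieCartan) (hE' : E.IsIrreducible) (Φ : M →ₗ[F] N) (h0 : Φ ≠ 0)
    (hρ : ∀ X v, Φ (D.ρ X v) = E.ρ X (Φ v)) (hθ : ∀ f v, Φ (D.θ f v) = E.θ f (Φ v))
    (hgr : ∀ i, ∀ v ∈ D.gr i, Φ v ∈ E.gr i) : Nonempty (D.Iso E) := by
  obtain ⟨π, hπm, hπ1, hπ0, hπ⟩ := exists_graded_projections hD.internal
  obtain ⟨π', -, hπ1', hπ0', -⟩ := exists_graded_projections hE.internal
  have htop : ⨆ i, D.gr i = ⊤ := hD.internal.submodule_iSup_eq_top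
  have hcomm : ∀ i v, Φ (π i v) = π' i (Φ v) := by
    intro i v
    have : (⨆ j, D.gr j) ≤ LinearMap.eqLocus (Φ ∘ₗ π i) (π' i ∘ₗ Φ) := by
      refine iSup_le fun j u hu => ?_
      rw [LinearMap.mem_eqLocus, LinearMap.comp_apply, LinearMap.comp_apply]
      by_cases hij : i = j
      · subst hij
        rw [hπ1 i u hu, hπ1' i _ (hgr i u hu)]
      · rw [hπ0 i j hij u hu, hπ0' i j hij _ (hgr j u hu), map_zero]
    exact this (htop ▸ Submodule.mem_top)
  have hker : gradedCore D.gr (LinearMap.ker Φ) = ⊥ := by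
    refine (hD'.2 _ (gradedCore_isSub hD (fun X v hv => ?_) fun f v hv => ?_)).resolve_right
      fun h => h0 ?_
    · rw [LinearMap.mem_ker] at hv ⊢
      rw [hρ, hv, map_zero]
    · rw [LinearMap.mem_ker] at hv ⊢
      rw [hθ, hv, map_zero]
    · exact LinearMap.ker_eq_top.mp (top_le_iff.mp (h.symm.le.trans (gradedCore_le _ _)))
  have hinj' : ∀ i v, Φ (π i v) = 0 → π i v = 0 := by
    intro i v h
    have := mem_gradedCore (LinearMap.mem_ker.mpr h) (hπm i v)
    rwa [hker, Submodule.mem_bot] at this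
  have hinj : Function.Injective Φ := (injective_iff_map_eq_zero Φ).mpr fun v hv =>
    hπ v fun i => hinj' i v (by rw [hcomm, hv, map_zero])
  have hle : LinearMap.range Φ ≤ gradedCore E.gr (LinearMap.range Φ) := by
    rw [LinearMap.range_eq_map, ← htop, Submodule.map_iSup]
    refine iSup_le fun i => ?_
    rintro _ ⟨v, hv, rfl⟩
    refine mem_gradedCore ?_ (hgr i v hv)
    rw [← Submodule.map_iSup, htop, ← LinearMap.range_eq_map]
    exact ⟨v, rfl⟩
  have hsurj : Function.Surjective Φ := by
    rw [← LinearMap.range_eq_top]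
    refine top_le_iff.mp (le_trans (ge_of_eq ?_) (gradedCore_le E.gr _))
    refine (hE'.2 _ (gradedCore_isSub hE ?_ ?_)).resolve_left fun h => h0 ?_
    · rintro X _ ⟨v, rfl⟩
      exact ⟨_, hρ X v⟩
    · rintro f _ ⟨v, rfl⟩
      exact ⟨_, hθ f v⟩
    · rw [h] at hle
      exact LinearMap.range_eq_bot.mp (le_bot_iff.mp hle)
  refine ⟨⟨LinearEquiv.ofBijective Φ ⟨hinj, hsurj⟩, hρ, hθ, fun i v => ⟨fun h => ?_, hgr i v⟩⟩⟩
  have h' : Φ v ∈ E.gr i := h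
  -- If `Φ v` has degree `i`, the other components of `v` map to 0 and vanish by injectivity, so the
  -- inverse respects the grading as well.
  have hv : v - π i v = 0 := by
    refine hπ _ fun j => ?_
    by_cases hij : j = i
    · subst hij
      rw [map_sub, hπ1 j _ (hπm j v), sub_self]
    · rw [map_sub, hπ0 j i hij _ (hπm i v), sub_zero]
      exact hinj' j v (by rw [hcomm, hπ0' j i hij _ h'])
  rw [sub_eq_zero.mp hv]
  exact hπm i v

end Schur

/-! ### Irreducible Lie-Cartan modules are prolongations -/

section Classification

attribute [local instance] LieRing.ofAssociativeRing

variable {F : Type u} [Field F]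

theorem exists_isSimpleRep {𝔤 : Type v} [LieRing 𝔤] [LieAlgebra F 𝔤] {V : Type w} [AddCommGroup V]
    [Module F V] [FiniteDimensional F V] [Nontrivial V] (ξ : 𝔤 →ₗ⁅F⁆ Module.End F V) :
    ∃ (W : Submodule F V) (hW : IsStable ξ W), W ≠ ⊥ ∧ IsSimpleRep hW.rep := by
  obtain ⟨W, ⟨hW, hW0⟩, hmin⟩ := exists_minimal_of_wellFoundedLT
    (fun W : Submodule F V => IsStable ξ W ∧ W ≠ ⊥) ⟨⊤, fun _ _ _ => Submodule.mem_top, top_ne_bot⟩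
  refine ⟨W, hW, hW0, fun N hN => ?_⟩
  by_cases h : N = ⊥
  · exact Or.inl h
  right
  have hst : IsStable ξ (N.map W.subtype) := by
    rintro x _ ⟨a, ha, rfl⟩
    exact ⟨_, hN x a ha, rfl⟩
  have hle := hmin ⟨hst, fun h' => h (Submodule.map_injective_of_injective
    W.injective_subtype (h'.trans (Submodule.map_bot _).symm))⟩
    (Submodule.map_subtype_le W N)
  refine eq_top_iff.mpr fun a _ => ?_
  obtain ⟨b, hb, hba⟩ := hle a.2
  rwa [← Subtype.ext hba]

variable {T : VFType} {n : ℕ}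

/-- The inclusion `g_0 → g` as a homomorphism of Lie algebras. -/
def toVfHom (F : Type u) [Field F] (T : VFType) (n : ℕ) : vf0 F T n →ₗ⁅F⁆ vf F T n where
  toFun := toVf
  map_add' _ _ := rfl
  map_smul' _ _ := rfl
  map_lie' := rfl

variable {M : Type v} [AddCommGroup M] [Module F M] {D : Triple F T n M}
  {L : Type w} [AddCommGroup L] [Module F L] {ξ : vf0 F T n →ₗ⁅F⁆ Module.End F L}

/-- The linear map `f ⊗ l ↦ θ(f) e(l)`. -/
def prolongMap (D : Triple F T n M) (e : L →ₗ[F] M) : Poly F n ⊗[F] L →ₗ[F] M :=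
  TensorProduct.lift (LinearMap.compl₂ D.θ.toLinearMap e)

theorem prolongMap_tmul (e : L →ₗ[F] M) (p : Poly F n) (l : L) :
    prolongMap D e (p ⊗ₜ l) = D.θ p (e l) := rfl

theorem prolongMap_one_tmul (e : L →ₗ[F] M) (l : L) : prolongMap D e (1 ⊗ₜ l) = e l := by
  rw [prolongMap_tmul, map_one, Module.End.one_apply]

theorem prolongMap_lsmul (e : L →ₗ[F] M) (f : Poly F n) (v : Poly F n ⊗[F] L) :
    prolongMap D e (Algebra.lsmul F F (Poly F n ⊗[F] L) f v) = D.θ f (prolongMap D e v) := by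
  induction v using TensorProduct.induction_on with
  | zero => simp
  | add a b ha hb => rw [map_add, map_add, ha, hb, map_add, map_add]
  | tmul p l => rw [lsmul_tmul, prolongMap_tmul, prolongMap_tmul, map_mul, Module.End.mul_apply]

theorem prolongMap_mem_gr (hD : D.IsLieCartan) {e : L →ₗ[F] M} {d : ℤ} (he : ∀ l, e l ∈ D.gr d)
    {k : ℤ} {v : Poly F n ⊗[F] L} (hv : v ∈ prolongGr F n L d k) : prolongMap D e v ∈ D.gr k := by
  refine prolongGr_le (W := (D.gr k).comap (prolongMap D e)) (fun m p l hp hk => ?_) hv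
  rw [Submodule.mem_comap, prolongMap_tmul, ← hk]
  exact hD.graded_poly m p hp d _ (he l)

theorem prolongMap_prolong_pdv (hD : D.IsLieCartan) {e : L →ₗ[F] M} {d : ℤ}
    (he : ∀ l, e l ∈ killed D d) (i : Fin n) (v : Poly F n ⊗[F] L) :
    prolongMap D e (prolong ξ (pdv T i) v) = D.ρ (pdv T i) (prolongMap D e v) := by
  induction v using TensorProduct.induction_on with
  | zero => simp
  | add a b ha hb => rw [map_add, map_add, ha, hb, map_add, map_add]
  | tmul p l =>
    rw [prolong_of_vectPart_zero ξ (pd_mem_vectPart i), prolongMap_tmul, prolongMap_tmul,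
      ← hD.compat, (mem_killed.mp (he l)).2 i, map_zero, sub_zero]

theorem prolongMap_prolong_toVf {e : L →ₗ[F] M}
    (hact : ∀ x l, e (ξ x l) = D.ρ (toVf x) (e l)) (x : vf0 F T n) (l : L) :
    prolongMap D e (prolong ξ (toVf x) (1 ⊗ₜ l)) = D.ρ (toVf x) (e l) := by
  rw [prolong_toVf_one_tmul, prolongMap_one_tmul, hact]

/-- Induction on the degree of `X`: applying `∂_i` to the defect turns `X` into `⁅∂_i, X⁆`, of
smaller degree, so the defect is killed by `g_{-1}`. Irreducibility leaves no such vectors outside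
degree `d`. -/
theorem prolongMap_prolong_one_tmul (hD : D.IsLieCartan) (hirr : D.IsIrreducible) {e : L →ₗ[F] M}
    {d : ℤ} {w : M} (hw : w ∈ killed D d) (hw0 : w ≠ 0) (he : ∀ l, e l ∈ killed D d)
    (hact : ∀ x l, e (ξ x l) = D.ρ (toVf x) (e l)) {k : ℕ}
    {X : vf F T n} (hX : (X : Vect F n) ∈ vectPart F n k) (l : L) :
    prolongMap D e (prolong ξ X (1 ⊗ₜ l)) = D.ρ X (e l) := by
  induction k generalizing X with
  | zero =>
    rw [prolong_of_vectPart_zero ξ hX, Derivation.map_one_eq_zero, TensorProduct.zero_tmul, map_zero,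
      apply_eq_zero_of_vectPart_zero (mem_killed.mp (he l)).2 hX]
  | succ k ih =>
    rcases k with _ | k
    -- For `X` in `g_0` the defect has degree `d` itself, where nonzero killed vectors exist. This
    -- case rests instead on `e` being `g_0`-linear.
    · exact prolongMap_prolong_toVf hact ⟨X, X.2, hX⟩ l
    have hmem : prolongMap D e (prolong ξ X (1 ⊗ₜ l)) - D.ρ X (e l) ∈
        killed D (d + (k + 1 + 1 : ℕ) - 1) := by
      rw [mem_killed]
      refine ⟨sub_mem ?_ (hD.graded _ X hX d _ (mem_killed.mp (he l)).1), fun i => ?_⟩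
      · have h3 : (1 : Poly F n) ⊗ₜ[F] l ∈ prolongGr F n L d d :=
          tmul_mem_prolongGr (MvPolynomial.isHomogeneous_one _ _) (by simp) l
        exact prolongMap_mem_gr hD (fun l => (mem_killed.mp (he l)).1)
          (prolong_mem_prolongGr ξ hX h3)
      · have h4 : ((⁅(pdv T i : vf F T n), X⁆ : vf F T n) : Vect F n) ∈ vectPart F n (k + 1) :=
          lie_pdv_mem_vectPart hX i
        have h1 := ih h4
        have h2 : prolong ξ (pdv T i) ((1 : Poly F n) ⊗ₜ[F] l) = 0 := by
          rw [prolong_of_vectPart_zero ξ (pd_mem_vectPart i), Derivation.map_one_eq_zero,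
            TensorProduct.zero_tmul]
        rw [rep_lie_apply, rep_lie_apply, h2, map_zero, sub_zero, (mem_killed.mp (he l)).2 i,
          map_zero, sub_zero] at h1
        rw [map_sub, ← prolongMap_prolong_pdv hD he, h1, sub_self]
    -- The defect has degree `d + k + 1`, which differs from `d`.
    rw [killed_eq_bot_of_ne hD hirr hw hw0 (by push_cast; omega), Submodule.mem_bot] at hmem
    exact sub_eq_zero.mp hmem

/-- Both modules satisfy `[ρ(X), θ(p)] = θ(X p)`, so equivariance at `1 ⊗ l` spreads to `p ⊗ l`. -/
theorem prolongMap_prolong (hD : D.IsLieCartan) (hirr : D.IsIrreducible) {e : L →ₗ[F] M}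
    {d : ℤ} {w : M} (hw : w ∈ killed D d) (hw0 : w ≠ 0) (he : ∀ l, e l ∈ killed D d)
    (hact : ∀ x l, e (ξ x l) = D.ρ (toVf x) (e l))
    (X : vf F T n) (v : Poly F n ⊗[F] L) :
    prolongMap D e (prolong ξ X v) = D.ρ X (prolongMap D e v) := by
  induction v using TensorProduct.induction_on with
  | zero => simp
  | add a b ha hb => rw [map_add, map_add, ha, hb, map_add, map_add]
  | tmul p l =>
    have h1 : prolongMap D e (prolong ξ X (1 ⊗ₜ l)) = D.ρ X (e l) := by
      refine mem_of_homogeneous (P := LinearMap.eqLocus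
        (prolongMap D e ∘ₗ LinearMap.applyₗ (1 ⊗ₜ[F] l) ∘ₗ
          (prolong ξ : vf F T n →ₗ[F] Module.End F (Poly F n ⊗[F] L)))
        (LinearMap.applyₗ (e l) ∘ₗ (D.ρ : vf F T n →ₗ[F] Module.End F M))) (fun k X hX => ?_) X
      exact prolongMap_prolong_one_tmul hD hirr hw hw0 he hact hX l
    have h2 := congrArg (prolongMap D e) (prolong_compat ξ X p (1 ⊗ₜ l))
    have h3 := hD.compat X p (e l)
    have h4 : p ⊗ₜ[F] l = Algebra.lsmul F F (Poly F n ⊗[F] L) p (1 ⊗ₜ l) := by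
      rw [lsmul_tmul, mul_one]
    rw [map_sub, prolongMap_lsmul, prolongMap_lsmul, prolongMap_one_tmul, h1, ← h3] at h2
    rw [h4, prolongMap_lsmul, prolongMap_one_tmul]
    exact sub_left_injective h2

theorem exists_iso_prolongation [IsAlgClosed F] [CharZero F] (hn : 0 < n) (hT : T = .H → Even n)
    (hD : D.IsLieCartan) (hirr : D.IsIrreducible) :
    ∃ lam : Weight F T n, lam.IsDominantIntegral ∧
      ∃ d : ℤ, Nonempty (D.Iso (prolongation lam d)) := by
  have := hirr.1
  obtain ⟨d, w, -, hwd, hw0, hwk⟩ := exists_homogeneous_killed (V := ⊤) hD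
    (by simpa using hD.internal.submodule_iSup_eq_top.symm) top_ne_bot
    fun _ _ _ => Submodule.mem_top
  have hB : IsStable (D.ρ.comp (toVfHom F T n)) (killed D d) :=
    fun x v hv => apply_mem_killed hD hv x.2.2
  have : FiniteDimensional F (D.gr d) := hD.finite d
  have : FiniteDimensional F (killed D d) :=
    Submodule.finiteDimensional_of_le (S₂ := D.gr d) inf_le_left
  have : Nontrivial (killed D d) :=
    ⟨⟨w, mem_killed.mpr ⟨hwd, hwk⟩⟩, 0, fun h => hw0 (congrArg Subtype.val h)⟩
  -- The killed vectors of degree `d` form a nonzero finite-dimensional `g_0`-module, so a simple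
  -- submodule with a highest weight vector can be chosen.
  obtain ⟨W, hW, hWbot, hWs⟩ := exists_isSimpleRep hB.rep
  have : Nontrivial W := (Submodule.nontrivial_iff_ne_bot).mpr hWbot
  obtain ⟨lam, v, hv0, hv⟩ := exists_isHighestWeight (isTriangular hT) hW.rep
  have hl : Weight.IsDominantIntegral lam := hv.isDominantIntegral hT hv0
  refine ⟨lam, hl, d, ?_⟩
  have := finiteDimensional_lZero_of_dominant hn hT hl
  obtain ⟨e, he0, he⟩ := exists_lZero_equiv (isTriangular hT) hWs hv hv0
  have hdeg : ∀ l, ((killed D d).subtype ∘ₗ W.subtype ∘ₗ e) l ∈ killed D d := fun l => (e l).1.2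
  have hact : ∀ x l, ((killed D d).subtype ∘ₗ W.subtype ∘ₗ e) (lZeroRep lam x l) =
      D.ρ (toVf x) (((killed D d).subtype ∘ₗ W.subtype ∘ₗ e) l) := fun x l =>
    congrArg (fun a : W => (a : M)) (he x l)
  -- The map runs from the prolongation to `M`. It is nonzero because it restricts to `e` on `1 ⊗
  -- L⁰(λ)`, and both sides are irreducible.
  obtain ⟨I⟩ := nonempty_iso_of_ne_zero (D := prolongation lam d) (E := D)
    (prolongation_isLieCartan hT d)
    (prolongation_isIrreducible hT (lZeroVec_ne_zero_of_dominant hn hT hl) d) hD hirr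
    (prolongMap D ((killed D d).subtype ∘ₗ W.subtype ∘ₗ e))
    (fun h => he0 (LinearMap.ext fun l => Subtype.ext (Subtype.ext (by
      have h1 := LinearMap.congr_fun h (1 ⊗ₜ l)
      rwa [prolongMap_one_tmul] at h1))))
    (fun X v => prolongMap_prolong hD hirr (mem_killed.mpr ⟨hwd, hwk⟩) hw0 hdeg hact X v)
    (fun f v => prolongMap_lsmul _ f v)
    (fun i v hv => prolongMap_mem_gr hD (fun l => (mem_killed.mp (hdeg l)).1) hv)
  exact ⟨I.symm⟩

end Classification

end LieCartan

end

theorem mainTheorem1 (F : Type u) [Field F] [IsAlgClosed F] [CharZero F]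
    (T : LieCartan.VFType) (n : ℕ) (hn : 0 < n) (hT : T = LieCartan.VFType.H → Even n) :
    (∀ lam : LieCartan.Weight F T n, lam.IsDominantIntegral → ∀ d : ℤ,
      (LieCartan.prolongation lam d).IsLieCartan ∧
      (LieCartan.prolongation lam d).IsIrreducible) ∧
    (∀ lam mu : LieCartan.Weight F T n, lam.IsDominantIntegral → mu.IsDominantIntegral →
      ∀ d e : ℤ, Nonempty ((LieCartan.prolongation lam d).Iso (LieCartan.prolongation mu e)) →
        lam = mu ∧ d = e) ∧
    (∀ (M : Type v) [AddCommGroup M] [Module F M] (D : LieCartan.Triple F T n M),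
      D.IsLieCartan → D.IsIrreducible →
        ∃ lam : LieCartan.Weight F T n, lam.IsDominantIntegral ∧
          ∃ d : ℤ, Nonempty (D.Iso (LieCartan.prolongation lam d))) := by
  refine ⟨fun lam hl d => ?_, fun lam mu hl hm d e ⟨I⟩ => ?_, fun M _ _ D hD hirr => ?_⟩
  · have := LieCartan.finiteDimensional_lZero_of_dominant hn hT hl
    exact ⟨LieCartan.prolongation_isLieCartan hT d, LieCartan.prolongation_isIrreducible hT
      (LieCartan.lZeroVec_ne_zero_of_dominant hn hT hl) d⟩
  · exact LieCartan.eq_of_iso hT (LieCartan.lZeroVec_ne_zero_of_dominant hn hT hl)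
      (LieCartan.lZeroVec_ne_zero_of_dominant hn hT hm) I
  · exact LieCartan.exists_iso_prolongation hn hT hD hirr
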